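/- Let $\mathbb B=\{x\in\mathbb R^3:|x|\le 1\}$, $r=|x|$, $\hat x=x/|x|$, $\alpha>-1$, $c\ge 0$, $n\ge 1$, and let $Y^n_\ell$, $1\le \ell\le 2n+1$, be a basis of the real harmonic homogeneous polynomials of degree $n$ in three variables that is orthonormal in $L^2(\mathbb S^2)$. Let $$\mathscr F_c^{(\alpha)}[u](x)=\int_{\mathbb B}e^{-ic\langle x,\tau\rangle}u(\tau)(1-|\tau|^2)^{\alpha}\,d\tau,$$ $$\mathscr L_{c,x}^{(\alpha)}=-(1-|x|^2)^{-\alpha}\nabla\cdot(\mathrm I-xx^{t})(1-|x|^2)^{\alpha}\nabla+c^2|x|^2,$$ $$\mathscr D_{c,x}^{(\alpha)}=(1-|x|^2)^{-\alpha}\nabla\times(1-|x|^2)^{\alpha+1}\nabla\times-\Delta_0+c^2|x|^2,$$ where $\Delta_0=|x|^2\Delta-(x\cdot\nabla)(x\cdot\nabla+1)$ (acting on vector fields componentwise) and products of operators are read from right to left. Let $\psi_{k,\ell}^{\alpha,n}(x;c)=\phi_k(2|x|^2-1)\,Y^n_\ell(x)$, $k\in\mathbb N_0$, $1\le\ell\le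 2n+1$, be the scalar ball prolate spheroidal wave functions (PSWFs) of degree $n$, up to normalization. That is, for $c>0$ they are nonzero functions in $L^2(\mathbb B,(1-|x|^2)^\alpha dx)$ with $$\mathscr F_c^{(\alpha)}[\psi_{k,\ell}^{\alpha,n}]=(-i)^{n+2k}\lambda_{k}\,\psi_{k,\ell}^{\alpha,n}\ \text{ on }\mathbb B,\qquad \lambda_k>0,$$ where the eigenvalues $(-i)^{n+2k}\lambda_k$, $k\in\mathbb N_0$, are pairwise distinct (for instance $\lambda_0>\lambda_1>\cdots$), and every eigenfunction of $\mathscr F_c^{(\alpha)}$ of the form $g(2|x|^2-1)Y^n_\ell(x)$ for a nonzero eigenvalue is a multiple of some $\psi^{\alpha,n}_{k,\ell}$; for $c=0$, $\phi_k$ is a nonzero multiple of the Jacobi polynomial $P_k^{(\alpha,n+1/2)}$. Let $\boldsymbol\psi^{\alpha,n}_{k,\ell}=(x\times\nabla)\psi^{\alpha,n}_{k,\ell}$ be the corresponding divergence-free ball PSWFs. (i) There are real numbers $\chi_{n,k}^{(\alpha)}(c)>0$, $k\in\mathbb N_0$, which are pairwise distinct and can be arranged in a strictly increasing sequence, such that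 for all $k\in\mathbb N_0$ and $1\le\ell\le 2n+1$ the function $\psi^{\alpha,n}_{k,\ell}$ is an eigenfunction of $\mathscr L^{(\alpha)}_{c,x}$ on $\mathbb B$ with eigenvalue $\chi^{(\alpha)}_{n,k}(c)$, the field $\boldsymbol\psi^{\alpha,n}_{k,\ell}$ is divergence free and (for $c>0$) satisfies $\mathscr F_c^{(\alpha)}[\boldsymbol\psi^{\alpha,n}_{k,\ell}]=(-i)^{n+2k}\lambda_k\boldsymbol\psi^{\alpha,n}_{k,\ell}$, and $\boldsymbol\psi^{\alpha,n}_{k,\ell}$ is an eigenfunction of $\mathscr D^{(\alpha)}_{c,x}$: $$\mathscr D_{c,x}^{(\alpha)}\boldsymbol\psi^{\alpha,n}_{k,\ell}(x;c)=\big[\chi_{n,k}^{(\alpha)}(c)+2\alpha+2\big]\boldsymbol\psi^{\alpha,n}_{k,\ell}(x;c),\qquad x\in\mathbb B.$$ Here an eigenfunction is not identically zero and smooth up to the boundary; the eigenvalue equation holds at every interior point and, at $|x|=1$, in the limit from the interior. (ii) If $c>0$, no field of the form $\nabla\times(x\times\nabla)[\theta(r)Y^n_\ell(\hat x)]$, with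 $\theta:(0,1)\to\mathbb C$ three times continuously differentiable, is an eigenfunction of $\mathscr D_{c,x}^{(\alpha)}$: if such a field $V$ satisfies $\mathscr D_{c,x}^{(\alpha)}V=\nu V$ for $0<|x|<1$ with some $\nu\in\mathbb C$, then $V=0$ there. -/

import Mathlib

open scoped ContDiff

noncomputable section

namespace BallPSWF

/-- Euclidean three-space. -/
abbrev E3 : Type := EuclideanSpace ℝ (Fin 3)

/-- The open unit ball. -/
def unitBall : Set E3 := Metric.ball (0 : E3) 1

section Operators

variable {G : Type*} [NormedAddCommGroup G] [NormedSpace ℝ G]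

/-- The partial derivative `∂_i f`. -/
def pd (i : Fin 3) (f : E3 → G) (x : E3) : G :=
  fderiv ℝ f x (EuclideanSpace.single i (1 : ℝ))

/-- `(x · ∇) f`. -/
def xDotGrad (f : E3 → G) (x : E3) : G := ∑ i, x i • pd i f x

/-- The Laplacian. -/
def lap (f : E3 → G) (x : E3) : G := ∑ i, pd i (pd i f) x

/-- The Laplace-Beltrami operator `Δ₀ = |x|² Δ - (x·∇)(x·∇ + 1)`. -/
def lap0 (f : E3 → G) (x : E3) : G :=
  ‖x‖ ^ 2 • lap f x - xDotGrad (fun y => xDotGrad f y + f y) x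

/-- `(x × ∇) f`. -/
def xCrossGrad (f : E3 → G) (x : E3) : Fin 3 → G :=
  ![x 1 • pd 2 f x - x 2 • pd 1 f x,
    x 2 • pd 0 f x - x 0 • pd 2 f x,
    x 0 • pd 1 f x - x 1 • pd 0 f x]

/-- `∇ · V`. -/
def divergence (V : E3 → Fin 3 → G) (x : E3) : G := ∑ i, pd i (fun y => V y i) x

/-- `∇ × V`. -/
def curl (V : E3 → Fin 3 → G) (x : E3) : Fin 3 → G :=
  ![pd 1 (fun y => V y 2) x - pd 2 (fun y => V y 1) x,
    pd 2 (fun y => V y 0) x - pd 0 (fun y => V y 2) x,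
    pd 0 (fun y => V y 1) x - pd 1 (fun y => V y 0) x]

/-- The weight `(1 - |x|²)^a`; it is only used for `|x| < 1`. -/
def weight (a : ℝ) (x : E3) : ℝ := (1 - ‖x‖ ^ 2) ^ a

/-- The Sturm-Liouville operator of the first kind,
`-(1-|x|²)^{-α} ∇·((I - x xᵗ)(1-|x|²)^α ∇ f) + c²|x|² f`. -/
def opL (α c : ℝ) (f : E3 → G) (x : E3) : G :=
  -(weight (-α) x •
      divergence (fun y i => weight α y • (pd i f y - y i • xDotGrad f y)) x)
    + (c ^ 2 * ‖x‖ ^ 2) • f x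

/-- The Sturm-Liouville operator of the second kind,
`(1-|x|²)^{-α} ∇×((1-|x|²)^{α+1} ∇×V) - Δ₀ V + c²|x|² V`. -/
def opD (α c : ℝ) (V : E3 → Fin 3 → G) (x : E3) : Fin 3 → G :=
  weight (-α) x • curl (fun y => weight (α + 1) y • curl V y) x
    - (fun i => lap0 (fun y => V y i) x)
    + (c ^ 2 * ‖x‖ ^ 2) • V x

/-- `u` is an eigenfunction of the differential operator `T` on the unit ball for the eigenvalue
`ν`: it is not identically zero, it is smooth up to the boundary (it coincides with the restriction
of a smooth function `U` on the whole space), the equation `T u = ν u` holds at every interior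
point, and at a boundary point, where the coefficients of `T` may be singular, it holds in the
limit from inside. -/
def IsEigenfunctionOnBall (T : (E3 → G) → E3 → G) (ν : ℝ) (u : E3 → G) : Prop :=
  (∃ x ∈ unitBall, u x ≠ 0) ∧
  (∀ x ∈ unitBall, T u x = ν • u x) ∧
  ∃ U : E3 → G, ContDiff ℝ ∞ U ∧ Set.EqOn u U unitBall ∧
    ∀ x ∈ Metric.sphere (0 : E3) 1,
      Filter.Tendsto (T u) (nhdsWithin x unitBall) (nhds (ν • U x))

end Operators

/-- The value of a polynomial in three variables at a point. -/
def evalAt (p : MvPolynomial (Fin 3) ℝ) (x : E3) : ℝ := MvPolynomial.eval (fun i => x i) p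

/-- `Y` is a basis of the real harmonic homogeneous polynomials of degree `n` in three variables
which is orthonormal in `L²` of the unit sphere for the surface measure. -/
structure IsSphericalHarmonicBasis (n : ℕ) (Y : Fin (2 * n + 1) → MvPolynomial (Fin 3) ℝ) :
    Prop where
  homogeneous : ∀ l, (Y l).IsHomogeneous n
  harmonic : ∀ l, ∑ i, MvPolynomial.pderiv i (MvPolynomial.pderiv i (Y l)) = 0
  orthonormal : ∀ l m,
    ∫ w : Metric.sphere (0 : E3) 1, evalAt (Y l) w * evalAt (Y m) w
      ∂((MeasureTheory.volume : MeasureTheory.Measure E3).toSphere) = if l = m then 1 else 0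

/-- The function `φ(2|x|² - 1) Y(x)`. -/
def ballFun (p : MvPolynomial (Fin 3) ℝ) (φ : ℝ → ℝ) (x : E3) : ℝ :=
  φ (2 * ‖x‖ ^ 2 - 1) * evalAt p x

/-- The measure `(1 - |x|²)^α dx` on the unit ball. -/
def ballMeasure (α : ℝ) : MeasureTheory.Measure E3 :=
  ((MeasureTheory.volume : MeasureTheory.Measure E3).restrict unitBall).withDensity
    (fun x => ENNReal.ofReal (weight α x))

/-- The weighted finite Fourier transform
`u ↦ ∫_𝔹 exp(-i c ⟨x, τ⟩) u(τ) (1 - |τ|²)^α dτ`. -/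
def finiteFourier (α c : ℝ) (u : E3 → ℂ) (x : E3) : ℂ :=
  ∫ t, Complex.exp (-Complex.I * (c : ℂ) * ((inner ℝ x t : ℝ) : ℂ)) * u t ∂(ballMeasure α)

/-- The real function `u` in the weighted `L²` space of the ball is an eigenfunction of the finite
Fourier transform for the eigenvalue `μ`. -/
def IsFourierEigenfunction (α c : ℝ) (μ : ℂ) (u : E3 → ℝ) : Prop :=
  MeasureTheory.MemLp u 2 (ballMeasure α) ∧
  (∃ x ∈ unitBall, u x ≠ 0) ∧
  ∀ x ∈ unitBall, finiteFourier α c (fun t => (u t : ℂ)) x = μ * (u x : ℂ)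

/-- The Jacobi polynomial `P_k^{(a,b)}` at `s`, in the classical normalization. -/
def jacobiP (a b : ℝ) (k : ℕ) (s : ℝ) : ℝ :=
  ∑ j ∈ Finset.range (k + 1),
    (ascPochhammer ℝ j).eval (k + a + b + 1) * (ascPochhammer ℝ (k - j)).eval (a + j + 1)
      / ((j.factorial : ℝ) * ((k - j).factorial : ℝ)) * ((s - 1) / 2) ^ j

/-- The functions `ψ_{k,l}(x) = φ_k(2|x|² - 1) Y_l(x)`, `k = 0, 1, …`, `1 ≤ l ≤ 2n + 1`, are the
(scalar) ball prolate spheroidal wave functions of angular degree `n`, up to normalization.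

For `c > 0` they are the eigenfunctions of the finite Fourier transform, with the eigenvalues
`(-i)^{n+2k} λ_k`, `λ_k > 0`; for fixed `n` these eigenvalues are pairwise distinct, and every
eigenfunction of the form `g(2|x|² - 1) Y_l(x)` for a nonzero eigenvalue is a multiple of some
`ψ_{k,l}`. The enumeration `λ_0 > λ_1 > …` by decreasing size is a special case.

For `c = 0` (where the transform has rank one) they are the ball polynomials, whose radial parts
are Jacobi polynomials. -/
structure IsBallPSWFSystem (α c : ℝ) (n : ℕ) (Y : Fin (2 * n + 1) → MvPolynomial (Fin 3) ℝ)
    (φ : ℕ → ℝ → ℝ) (lam : ℕ → ℝ) : Prop where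
  jacobi : c = 0 → ∀ k, ∃ a : ℝ, a ≠ 0 ∧
    ∀ s ∈ Set.Ico (-1 : ℝ) 1, φ k s = a * jacobiP α (n + 1 / 2) k s
  lam_pos : 0 < c → ∀ k, 0 < lam k
  distinct : 0 < c → Function.Injective (fun k => (-Complex.I) ^ (n + 2 * k) * (lam k : ℂ))
  eigen : 0 < c → ∀ k l,
    IsFourierEigenfunction α c ((-Complex.I) ^ (n + 2 * k) * (lam k : ℂ)) (ballFun (Y l) (φ k))
  exhaustive : 0 < c → ∀ l (g : ℝ → ℝ) (μ : ℂ), μ ≠ 0 →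
    IsFourierEigenfunction α c μ (ballFun (Y l) g) →
    ∃ (k : ℕ) (a : ℝ), ∀ x ∈ unitBall, ballFun (Y l) g x = a * ballFun (Y l) (φ k) x

/-- The divergence-free (vectorial) ball prolate spheroidal wave function `(x × ∇) ψ` which belongs
to the scalar one `ψ(x) = φ(2|x|² - 1) Y(x)`. -/
def divFreePSWF (p : MvPolynomial (Fin 3) ℝ) (φ : ℝ → ℝ) : E3 → Fin 3 → ℝ :=
  xCrossGrad (ballFun p φ)

/-- The divergence-free field `∇ × (x × ∇) [θ(r) Y(x/r)]`, `r = |x|`. -/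
def poloidalField (p : MvPolynomial (Fin 3) ℝ) (θ : ℝ → ℂ) : E3 → Fin 3 → ℂ :=
  curl (xCrossGrad (fun x => θ ‖x‖ * ((evalAt p (‖x‖⁻¹ • x) : ℝ) : ℂ)))

end BallPSWF

end

open scoped ContDiff

noncomputable section

/-! ### Partial derivatives, locality, and the operators on smooth functions -/

namespace BallPSWF

variable {G : Type*} [NormedAddCommGroup G] [NormedSpace ℝ G]

/-! Part (i) rests on two commutation relations of the finite Fourier transform. In expanded form,
the operator L acting in t on the plane wave exp(-ic⟨x,t⟩) multiplies it by a symbol symmetric in x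
and t (`waveSymbol`), so acting in x gives the same result. The flux (I - xxᵗ)∇f has normal
component (1-|x|²) x·∇f, which absorbs the singularity of the weight; hence L is symmetric for the
weighted measure without boundary conditions (`integral_weighted_divergence`) and commutes with the
transform (`finiteFourier_expandedL`). The rotations x×∇ are antisymmetric and commute with it as
well. An eigenfunction ψ for a nonzero eigenvalue extends smoothly to the whole space, because its
transform does. Then Lψ is a radial factor times the same harmonic and, unless it vanishes, an
eigenfunction for the same eigenvalue. Exhaustiveness and distinctness of the eigenvalues force Lψ =
χψ, which is an ordinary differential equation for the radial factor.

Write ψ = p(x)F(|x|²) with p a solid harmonic of degree n. Rotations kill radial functions, so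
(x×∇)ψ = F(|x|²) x×∇p, whose components are again solid harmonics of degree n times F. Computing two
curls shows that D acts on F through the same radial operator as L, plus the constant 2α+2
(`opL_radMul`, `opD_toroidal`). One radial equation therefore gives both eigenvalue equations.

Positivity of χ is the energy identity with v = u. Restriction to a ray turns the equation into a
singular Sturm-Liouville problem on (0,1) whose flux vanishes at both ends; the Wronskian then shows
that equal χ forces proportional radial factors, hence equal Fourier eigenvalues and equal indices.
An increasing arrangement requires finite sublevel sets: infinitely many normalized solutions with
bounded χ would, after multiplication by r³, be equi-Lipschitz, and a uniform limit would be
orthogonal to itself, hence zero, against a lower bound from the maximum principle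
(`not_bounded_eigenvalues`). For c = 0 the Jacobi equation gives χ explicitly.

Part (ii): a poloidal field has the form A(|x|²) x p + B(|x|²) ∇p. On each sphere x p and ∇p are
linearly independent, so the eigenvalue equation splits into two equations for one radial function
F. Elimination leaves F times a quadratic polynomial in q = |x|² with leading coefficient c⁴(α+2)²,
which is nonzero for c > 0; hence F = 0 (`radial_system_eq_zero`). -/

theorem pd_congr {f g : E3 → G} {s : Set E3} (hs : IsOpen s) (h : Set.EqOn f g s) (i : Fin 3) :
    Set.EqOn (pd i f) (pd i g) s := fun x hx => by
  have : f =ᶠ[nhds x] g := Filter.eventuallyEq_of_mem (hs.mem_nhds hx) h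
  simp only [pd, this.fderiv_eq]

theorem pd_add {f g : E3 → G} {x : E3} (hf : DifferentiableAt ℝ f x) (hg : DifferentiableAt ℝ g x)
    (i : Fin 3) : pd i (fun y => f y + g y) x = pd i f x + pd i g x := by
  simp only [pd, fderiv_fun_add hf hg, add_apply]

theorem pd_sub {f g : E3 → G} {x : E3} (hf : DifferentiableAt ℝ f x) (hg : DifferentiableAt ℝ g x)
    (i : Fin 3) : pd i (fun y => f y - g y) x = pd i f x - pd i g x := by
  simp only [pd, fderiv_fun_sub hf hg, sub_apply]

theorem pd_smul {a : E3 → ℝ} {f : E3 → G} {x : E3} (ha : DifferentiableAt ℝ a x)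
    (hf : DifferentiableAt ℝ f x) (i : Fin 3) :
    pd i (fun y => a y • f y) x = a x • pd i f x + pd i a x • f x := by
  simp only [pd, fderiv_fun_smul ha hf, add_apply, smul_apply,
    ContinuousLinearMap.smulRight_apply]

theorem pd_sum {ι : Type*} {s : Finset ι} {f : ι → E3 → G} {x : E3}
    (hf : ∀ j ∈ s, DifferentiableAt ℝ (f j) x) (i : Fin 3) :
    pd i (fun y => ∑ j ∈ s, f j y) x = ∑ j ∈ s, pd i (f j) x := by
  simp only [pd, fderiv_fun_sum hf, sum_apply]

theorem pd_coord (i j : Fin 3) (x : E3) : pd i (fun y : E3 => y j) x = if i = j then 1 else 0 := by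
  have : (fun y : E3 => y j) = ⇑(EuclideanSpace.proj j : E3 →L[ℝ] ℝ) := rfl
  rw [pd, this, ContinuousLinearMap.fderiv]
  simp [eq_comm]

theorem differentiableAt_coord (j : Fin 3) (x : E3) : DifferentiableAt ℝ (fun y : E3 => y j) x := by
  fun_prop

theorem contDiff_coord {n : WithTop ℕ∞} (j : Fin 3) : ContDiff ℝ n (fun y : E3 => y j) := by
  fun_prop

theorem pd_coord_smul {f : E3 → G} {x : E3} (hf : DifferentiableAt ℝ f x) (i j : Fin 3) :
    pd i (fun y => y j • f y) x = x j • pd i f x + if i = j then f x else 0 := by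
  rw [pd_smul (differentiableAt_coord j x) hf, pd_coord, ite_smul, one_smul, zero_smul]

theorem ContDiffAt.pd {f : E3 → G} {x : E3} {m n : WithTop ℕ∞} (hf : ContDiffAt ℝ n f x)
    (hmn : m + 1 ≤ n) (i : Fin 3) : ContDiffAt ℝ m (pd i f) x :=
  (hf.fderiv_right hmn).clm_apply contDiffAt_const

theorem ContDiff.pd {f : E3 → G} (hf : ContDiff ℝ ∞ f) (i : Fin 3) : ContDiff ℝ ∞ (pd i f) :=
  (hf.fderiv_right (by simp)).clm_apply contDiff_const

theorem pd_comm {f : E3 → G} {x : E3} (hf : ContDiffAt ℝ 2 f x) (i j : Fin 3) :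
    pd i (pd j f) x = pd j (pd i f) x := by
  have hd : DifferentiableAt ℝ (fderiv ℝ f) x :=
    (hf.fderiv_right (m := 1) (by norm_num)).differentiableAt (by norm_num)
  have key (a b : Fin 3) : BallPSWF.pd a (BallPSWF.pd b f) x
      = fderiv ℝ (fderiv ℝ f) x (EuclideanSpace.single a 1) (EuclideanSpace.single b 1) := by
    change fderiv ℝ (fun y => fderiv ℝ f y (EuclideanSpace.single b 1)) x _ = _
    rw [fderiv_clm_apply hd (differentiableAt_const _)]
    simp
  rw [key, key]
  exact (hf.isSymmSndFDerivAt (by simp)).eq _ _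

theorem norm_sq_eq (x : E3) : ‖x‖ ^ 2 = x 0 ^ 2 + x 1 ^ 2 + x 2 ^ 2 := by
  simp [EuclideanSpace.norm_sq_eq, Fin.sum_univ_three]

/-- Radial functions are written in the variable q = |x|², whose gradient 2x is polynomial, so that
no division by |x| ever occurs. -/
theorem pd_comp_norm_sq {F : ℝ → G} {x : E3} (hF : DifferentiableAt ℝ F (‖x‖ ^ 2)) (i : Fin 3) :
    pd i (fun y => F (‖y‖ ^ 2)) x = (2 * x i) • deriv F (‖x‖ ^ 2) := by
  have h1 : HasFDerivAt (fun y : E3 => ‖y‖ ^ 2) (2 • innerSL ℝ x) x :=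
    (hasStrictFDerivAt_norm_sq x).hasFDerivAt
  have h2 := hF.hasDerivAt.hasFDerivAt.comp x h1
  simp only [pd]
  rw [show (fun y : E3 => F (‖y‖ ^ 2)) = F ∘ fun y : E3 => ‖y‖ ^ 2 from rfl, h2.fderiv]
  simp [EuclideanSpace.inner_single_right]
  module

theorem xDotGrad_eq_fderiv (f : E3 → G) (x : E3) : xDotGrad f x = fderiv ℝ f x x := by
  have hx : x = ∑ i, x i • EuclideanSpace.single i (1 : ℝ) := by
    ext j; fin_cases j <;> simp [Fin.sum_univ_three]
  have := congrArg (fderiv ℝ f x) hx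
  rw [this, map_sum]
  simp [xDotGrad, pd]

theorem mem_unitBall {x : E3} : x ∈ unitBall ↔ ‖x‖ < 1 := by simp [unitBall]

theorem isOpen_unitBall : IsOpen unitBall := Metric.isOpen_ball

theorem one_sub_norm_sq_pos {x : E3} (hx : x ∈ unitBall) : 0 < 1 - ‖x‖ ^ 2 := by
  rw [mem_unitBall] at hx; nlinarith [norm_nonneg x]

theorem contDiffAt_weight (a : ℝ) {x : E3} (hx : x ∈ unitBall) {n : WithTop ℕ∞} :
    ContDiffAt ℝ n (weight a) x := by
  refine ContDiffAt.rpow_const_of_ne ?_ (one_sub_norm_sq_pos hx).ne'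
  exact contDiffAt_const.sub (contDiff_norm_sq ℝ).contDiffAt

theorem pd_weight (a : ℝ) {x : E3} (hx : x ∈ unitBall) (i : Fin 3) :
    pd i (weight a) x = -(2 * a * x i) * weight (a - 1) x := by
  have hpos := one_sub_norm_sq_pos hx
  have hd : HasDerivAt (fun q : ℝ => (1 - q) ^ a) (-1 * a * (1 - ‖x‖ ^ 2) ^ (a - 1)) (‖x‖ ^ 2) :=
    ((hasDerivAt_id _).const_sub 1).rpow_const (Or.inl hpos.ne')
  have := pd_comp_norm_sq hd.differentiableAt i
  rw [hd.deriv] at this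
  change pd i (fun y => (1 - ‖y‖ ^ 2) ^ a) x = _
  rw [this, weight, smul_eq_mul]; ring

theorem weight_neg_mul (a : ℝ) {x : E3} (hx : x ∈ unitBall) : weight (-a) x * weight a x = 1 := by
  rw [weight, weight, ← Real.rpow_add (one_sub_norm_sq_pos hx)]; simp

theorem weight_neg_mul_sub_one (a : ℝ) {x : E3} (hx : x ∈ unitBall) :
    weight (-a) x * weight (a - 1) x * (1 - ‖x‖ ^ 2) = 1 := by
  have hpos := one_sub_norm_sq_pos hx
  rw [weight, weight, ← Real.rpow_add hpos, ← Real.rpow_add_one hpos.ne']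
  rw [show -a + (a - 1) + 1 = 0 by ring, Real.rpow_zero]

theorem ContDiffAt.xDotGrad {f : E3 → G} {x : E3} {m n : WithTop ℕ∞} (hf : ContDiffAt ℝ n f x)
    (hmn : m + 1 ≤ n) : ContDiffAt ℝ m (xDotGrad f) x :=
  ContDiffAt.sum fun i _ => (contDiff_coord i).contDiffAt.smul (ContDiffAt.pd hf hmn i)

theorem ContDiff.xDotGrad {f : E3 → G} (hf : ContDiff ℝ ∞ f) : ContDiff ℝ ∞ (xDotGrad f) :=
  ContDiff.sum fun i _ => (contDiff_coord i).smul (ContDiff.pd hf i)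

theorem xDotGrad_congr {f g : E3 → G} {s : Set E3} (hs : IsOpen s) (h : Set.EqOn f g s) :
    Set.EqOn (xDotGrad f) (xDotGrad g) s := fun x hx => by
  simp only [xDotGrad, pd_congr hs h _ hx]

theorem lap_congr {f g : E3 → G} {s : Set E3} (hs : IsOpen s) (h : Set.EqOn f g s) :
    Set.EqOn (lap f) (lap g) s := fun x hx => by
  simp only [lap, pd_congr hs (pd_congr hs h _) _ hx]

theorem lap0_congr {f g : E3 → G} {s : Set E3} (hs : IsOpen s) (h : Set.EqOn f g s) :
    Set.EqOn (lap0 f) (lap0 g) s := fun x hx => by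
  have : Set.EqOn (fun y => xDotGrad f y + f y) (fun y => xDotGrad g y + g y) s :=
    fun y hy => by simp only [xDotGrad_congr hs h hy, h hy]
  simp only [lap0, lap_congr hs h hx, xDotGrad_congr hs this hx]

theorem xCrossGrad_congr {f g : E3 → G} {s : Set E3} (hs : IsOpen s) (h : Set.EqOn f g s) :
    Set.EqOn (xCrossGrad f) (xCrossGrad g) s := fun x hx => by
  simp only [xCrossGrad, pd_congr hs h _ hx]

theorem divergence_congr {f g : E3 → Fin 3 → G} {s : Set E3} (hs : IsOpen s) (h : Set.EqOn f g s) :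
    Set.EqOn (divergence f) (divergence g) s := fun x hx => by
  have (i : Fin 3) : Set.EqOn (fun y => f y i) (fun y => g y i) s := fun y hy => by simp only [h hy]
  simp only [divergence, pd_congr hs (this _) _ hx]

theorem curl_congr {f g : E3 → Fin 3 → G} {s : Set E3} (hs : IsOpen s) (h : Set.EqOn f g s) :
    Set.EqOn (curl f) (curl g) s := fun x hx => by
  have (i : Fin 3) : Set.EqOn (fun y => f y i) (fun y => g y i) s := fun y hy => by simp only [h hy]
  simp only [curl, pd_congr hs (this _) _ hx]

/-- The operators are local. This permits replacing a function on the ball by a smooth extension, or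
on the punctured ball by its explicit product form. -/
theorem opL_congr (α c : ℝ) {f g : E3 → G} {s : Set E3} (hs : IsOpen s) (h : Set.EqOn f g s) :
    Set.EqOn (opL α c f) (opL α c g) s := fun x hx => by
  have : Set.EqOn (fun y i => weight α y • (pd i f y - y i • xDotGrad f y))
      (fun y i => weight α y • (pd i g y - y i • xDotGrad g y)) s := fun y hy => by
    simp only [xDotGrad_congr hs h hy, pd_congr hs h _ hy]
  simp only [opL, divergence_congr hs this hx, h hx]

theorem opD_congr (α c : ℝ) {f g : E3 → Fin 3 → G} {s : Set E3} (hs : IsOpen s)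
    (h : Set.EqOn f g s) : Set.EqOn (opD α c f) (opD α c g) s := fun x hx => by
  have h1 : Set.EqOn (fun y => weight (α + 1) y • curl f y)
      (fun y => weight (α + 1) y • curl g y) s := fun y hy => by
    simp only [curl_congr hs h hy]
  have h2 (i : Fin 3) : Set.EqOn (fun y => f y i) (fun y => g y i) s :=
    fun y hy => by simp only [h hy]
  simp only [opD, curl_congr hs h1 hx, h hx, lap0_congr hs (h2 _) hx]

/-- The expanded form `-Δ + (x·∇)² + (2α+3) x·∇ + c²|x|²` of the operator `opL`. -/
def expandedL (α c : ℝ) (f : E3 → G) (x : E3) : G :=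
  -lap f x + xDotGrad (xDotGrad f) x + (2 * α + 3) • xDotGrad f x + (c ^ 2 * ‖x‖ ^ 2) • f x

/-- The divergence of `(I - x xᵗ) ∇ f`. -/
theorem divergence_tangentialGrad {f : E3 → G} {x : E3} (hf : ContDiffAt ℝ 2 f x) :
    divergence (fun y i => pd i f y - y i • xDotGrad f y) x
      = lap f x - (3 : ℝ) • xDotGrad f x - xDotGrad (xDotGrad f) x := by
  have h1 (i : Fin 3) : DifferentiableAt ℝ (pd i f) x :=
    (ContDiffAt.pd hf (m := 1) (by norm_num) i).differentiableAt (by norm_num)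
  have h2 : DifferentiableAt ℝ (xDotGrad f) x :=
    (ContDiffAt.xDotGrad hf (m := 1) (by norm_num)).differentiableAt (by norm_num)
  have h3 (i : Fin 3) : pd i (fun y => pd i f y - y i • xDotGrad f y) x
      = pd i (pd i f) x - x i • pd i (xDotGrad f) x - xDotGrad f x := by
    rw [pd_sub (h1 i) ((differentiableAt_coord i x).fun_smul h2), pd_coord_smul h2]
    simp only [if_true]; abel
  simp only [divergence, h3, lap]
  rw [xDotGrad.eq_def (xDotGrad f) x]
  simp only [Fin.sum_univ_three]
  module

/-- Differentiating the weight produces (1-|x|²)^{α-1} times the normal component (1-|x|²) x·∇f of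
the flux, so the singular powers cancel. The expanded form has polynomial coefficients and makes
sense on the whole space, including the sphere. -/
theorem opL_eq_expandedL (α c : ℝ) {f : E3 → G} {x : E3} (hx : x ∈ unitBall)
    (hf : ContDiffAt ℝ 2 f x) : opL α c f x = expandedL α c f x := by
  have h1 (i : Fin 3) : DifferentiableAt ℝ (pd i f) x :=
    (ContDiffAt.pd hf (m := 1) (by norm_num) i).differentiableAt (by norm_num)
  have h2 : DifferentiableAt ℝ (xDotGrad f) x :=
    (ContDiffAt.xDotGrad hf (m := 1) (by norm_num)).differentiableAt (by norm_num)
  have hw : DifferentiableAt ℝ (weight α) x :=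
    (contDiffAt_weight α hx (n := 1)).differentiableAt (by norm_num)
  have h3 (i : Fin 3) : pd i (fun y => weight α y • (pd i f y - y i • xDotGrad f y)) x
      = weight α x • pd i (fun y => pd i f y - y i • xDotGrad f y) x
        + (-(2 * α) * weight (α - 1) x) • (x i • pd i f x - (x i ^ 2) • xDotGrad f x) := by
    rw [pd_smul hw ((h1 i).fun_sub ((differentiableAt_coord i x).fun_smul h2)), pd_weight α hx]
    module
  have h4 : divergence (fun y i => weight α y • (pd i f y - y i • xDotGrad f y)) x
      = weight α x • divergence (fun y i => pd i f y - y i • xDotGrad f y) x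
        + (-(2 * α) * weight (α - 1) x) • ((1 - ‖x‖ ^ 2) • xDotGrad f x) := by
    simp only [divergence, h3, Finset.sum_add_distrib, ← Finset.smul_sum, Finset.sum_sub_distrib,
      ← Finset.sum_smul]
    rw [show ∑ i, x i • pd i f x = xDotGrad f x from rfl, norm_sq_eq,
      Fin.sum_univ_three (fun i => x i ^ 2)]
    module
  rw [opL, h4, divergence_tangentialGrad hf, expandedL, smul_add, smul_smul, weight_neg_mul α hx,
    smul_smul, smul_smul, show weight (-α) x * (-(2 * α) * weight (α - 1) x) * (1 - ‖x‖ ^ 2)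
      = -(2 * α) * (weight (-α) x * weight (α - 1) x * (1 - ‖x‖ ^ 2)) by ring,
    weight_neg_mul_sub_one α hx]
  module

theorem ContDiff.expandedL {f : E3 → G} (α c : ℝ) (hf : ContDiff ℝ ∞ f) :
    ContDiff ℝ ∞ (expandedL α c f) := by
  have h1 : ContDiff ℝ ∞ (lap f) := ContDiff.sum fun i _ => ContDiff.pd (ContDiff.pd hf i) i
  have h2 := ContDiff.xDotGrad hf
  have h3 := ContDiff.xDotGrad h2
  have h4 : ContDiff ℝ ∞ fun x : E3 => ‖x‖ ^ 2 := contDiff_norm_sq ℝ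
  unfold BallPSWF.expandedL
  fun_prop

theorem contDiff_xCrossGrad {f : E3 → G} (hf : ContDiff ℝ ∞ f) :
    ContDiff ℝ ∞ (xCrossGrad f) := by
  have h := ContDiff.pd hf
  have hc (i : Fin 3) : ContDiff ℝ ∞ (fun x : E3 => x i) := contDiff_coord i
  rw [contDiff_pi]
  intro i
  fin_cases i
  · exact ((hc 1).smul (h 2)).sub ((hc 2).smul (h 1))
  · exact ((hc 2).smul (h 0)).sub ((hc 0).smul (h 2))
  · exact ((hc 0).smul (h 1)).sub ((hc 1).smul (h 0))

theorem contDiffAt_curl {V : E3 → Fin 3 → G} {x : E3} (hV : ContDiffAt ℝ ∞ V x) :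
    ContDiffAt ℝ ∞ (curl V) x := by
  have h (i j : Fin 3) : ContDiffAt ℝ ∞ (pd i fun y => V y j) x :=
    ContDiffAt.pd (contDiffAt_pi.1 hV j) (by simp) i
  rw [contDiffAt_pi]
  intro i
  fin_cases i
  · exact (h 1 2).sub (h 2 1)
  · exact (h 2 0).sub (h 0 2)
  · exact (h 0 1).sub (h 1 0)

theorem continuousAt_opD (α c : ℝ) {V : E3 → Fin 3 → G} {x : E3} (hx : x ∈ unitBall)
    (hV : ContDiff ℝ ∞ V) : ContinuousAt (opD α c V) x := by
  have h1 := contDiffAt_curl (hV.contDiffAt (x := x))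
  have h2 : ContDiffAt ℝ ∞ (fun y => weight (α + 1) y • curl V y) x :=
    (contDiffAt_weight _ hx).smul h1
  have h3 : ContDiffAt ℝ ∞ (fun y => weight (-α) y •
      curl (fun y => weight (α + 1) y • curl V y) y) x :=
    (contDiffAt_weight _ hx).smul (contDiffAt_curl h2)
  have hn : ContDiff ℝ ∞ fun x : E3 => ‖x‖ ^ 2 := contDiff_norm_sq ℝ
  have h4 : ContDiff ℝ ∞ fun y => (fun i => lap0 (fun y => V y i) y) := by
    rw [contDiff_pi]
    intro i
    have hi := contDiff_pi.1 hV i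
    have a1 : ContDiff ℝ ∞ (lap fun y => V y i) :=
      ContDiff.sum fun j _ => ContDiff.pd (ContDiff.pd hi j) j
    exact (hn.smul a1).sub (ContDiff.xDotGrad ((ContDiff.xDotGrad hi).add hi))
  have h5 : ContDiff ℝ ∞ fun y => (c ^ 2 * ‖y‖ ^ 2) • V y := (contDiff_const.mul hn).smul hV
  exact ((h3.sub h4.contDiffAt).add h5.contDiffAt).continuousAt

theorem divergence_xCrossGrad {f : E3 → G} {x : E3} (hf : ContDiffAt ℝ 2 f x) :
    divergence (xCrossGrad f) x = 0 := by
  have h1 (i : Fin 3) : DifferentiableAt ℝ (pd i f) x :=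
    (ContDiffAt.pd hf (m := 1) (by norm_num) i).differentiableAt (by norm_num)
  have h2 (i j : Fin 3) : DifferentiableAt ℝ (fun y => y i • pd j f y) x :=
    (differentiableAt_coord i x).smul (h1 j)
  simp only [divergence, Fin.sum_univ_three, xCrossGrad, Matrix.cons_val_zero, Matrix.cons_val_one,
    Matrix.cons_val]
  simp only [pd_sub (h2 _ _) (h2 _ _), pd_coord_smul (h1 _)]
  rw [pd_comm hf 2 1, pd_comm hf 2 0, pd_comm hf 1 0]
  simp only [Fin.isValue, Fin.reduceEq, if_false]
  module

end BallPSWF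

/-! ### Products of a homogeneous polynomial with a radial function -/

namespace BallPSWF

open MvPolynomial (pderiv X)

variable {G : Type*} [NormedAddCommGroup G] [NormedSpace ℝ G]

theorem pderiv_comm (p : MvPolynomial (Fin 3) ℝ) (i j : Fin 3) :
    pderiv i (pderiv j p) = pderiv j (pderiv i p) := by
  induction p using MvPolynomial.induction_on with
  | C a => simp
  | add p q hp hq => simp [hp, hq]
  | mul_X p k hp =>
    have h (a b : Fin 3) : pderiv a (pderiv b (X k : MvPolynomial (Fin 3) ℝ)) = 0 := by
      rcases eq_or_ne k b with rfl | hb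
      · rw [MvPolynomial.pderiv_X_self]; exact MvPolynomial.pderiv_one
      · rw [MvPolynomial.pderiv_X_of_ne hb, map_zero]
    simp only [MvPolynomial.pderiv_mul, map_add, h, hp]
    ring

section evalAt

variable (p r : MvPolynomial (Fin 3) ℝ) (x : E3)

theorem evalAt_mul : evalAt (p * r) x = evalAt p x * evalAt r x := map_mul _ _ _
theorem evalAt_add : evalAt (p + r) x = evalAt p x + evalAt r x := map_add _ _ _
theorem evalAt_sub : evalAt (p - r) x = evalAt p x - evalAt r x := map_sub _ _ _
theorem evalAt_X (i : Fin 3) : evalAt (X i) x = x i := MvPolynomial.eval_X _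
theorem evalAt_zero : evalAt 0 x = 0 := map_zero _
theorem evalAt_two : evalAt 2 x = 2 := map_ofNat _ 2

theorem contDiff_evalAt {n : WithTop ℕ∞} : ContDiff ℝ n (evalAt p) := by
  induction p using MvPolynomial.induction_on with
  | C a =>
    rw [show evalAt (MvPolynomial.C a) = fun _ => a from funext fun y => MvPolynomial.eval_C _]
    exact contDiff_const
  | add p q hp hq =>
    rw [show evalAt (p + q) = fun x => evalAt p x + evalAt q x from funext (evalAt_add p q)]
    exact hp.add hq
  | mul_X p k hp =>
    rw [show evalAt (p * X k) = fun x => evalAt p x * x k by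
      funext x; rw [evalAt_mul, evalAt_X]]
    exact hp.mul (contDiff_coord k)

theorem differentiableAt_evalAt : DifferentiableAt ℝ (evalAt p) x :=
  (contDiff_evalAt p (n := 1)).differentiable (by norm_num) x

theorem pd_evalAt (i : Fin 3) : pd i (evalAt p) x = evalAt (pderiv i p) x := by
  induction p using MvPolynomial.induction_on with
  | C a =>
    have : evalAt (MvPolynomial.C a) = fun _ => a := funext fun y => MvPolynomial.eval_C _
    simp [this, pd, evalAt]
  | add p q hp hq =>
    rw [show evalAt (p + q) = fun x => evalAt p x + evalAt q x from funext (evalAt_add p q),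
      pd_add (differentiableAt_evalAt p x) (differentiableAt_evalAt q x), hp, hq, map_add,
      evalAt_add]
  | mul_X p k hp =>
    rw [show evalAt (p * X k) = fun x => x k • evalAt p x by
      funext x; rw [evalAt_mul, evalAt_X, smul_eq_mul, mul_comm],
      pd_coord_smul (differentiableAt_evalAt p x), hp, MvPolynomial.pderiv_mul, evalAt_add,
      evalAt_mul, evalAt_mul, evalAt_X, smul_eq_mul]
    rcases eq_or_ne k i with rfl | hk
    · simp [evalAt]; ring
    · simp [MvPolynomial.pderiv_X_of_ne hk, hk.symm, evalAt]; ring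

end evalAt

theorem euler_evalAt {p : MvPolynomial (Fin 3) ℝ} {m : ℕ} (hp : p.IsHomogeneous m) (x : E3) :
    x 0 * evalAt (pderiv 0 p) x + x 1 * evalAt (pderiv 1 p) x + x 2 * evalAt (pderiv 2 p) x
      = m * evalAt p x := by
  have h := congrArg (fun r => evalAt r x) hp.sum_X_mul_pderiv
  simp only [Fin.sum_univ_three, evalAt_add, evalAt_mul, evalAt_X] at h
  rw [h]
  simp [evalAt]

theorem evalAt_smul {p : MvPolynomial (Fin 3) ℝ} {m : ℕ} (hp : p.IsHomogeneous m) (a : ℝ) (x : E3) :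
    evalAt p (a • x) = a ^ m * evalAt p x := by
  simp only [evalAt, MvPolynomial.eval_eq, Finset.mul_sum]
  refine Finset.sum_congr rfl fun d hd => ?_
  have hdeg : ∑ i ∈ d.support, d i = m := by
    have := hp (MvPolynomial.mem_support_iff.1 hd)
    rwa [Finsupp.weight_apply, Finsupp.sum, Finset.sum_congr rfl fun i _ => by
      rw [Pi.one_apply, smul_eq_mul, mul_one]] at this
  simp only [PiLp.smul_apply, smul_eq_mul, mul_pow, Finset.prod_mul_distrib,
    Finset.prod_pow_eq_pow_sum, hdeg]
  ring

/-- The punctured open unit ball. -/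
def puncturedBall : Set E3 := {x | 0 < ‖x‖ ∧ ‖x‖ < 1}

theorem isOpen_puncturedBall : IsOpen puncturedBall :=
  (isOpen_lt continuous_const continuous_norm).inter (isOpen_lt continuous_norm continuous_const)

theorem puncturedBall_subset : puncturedBall ⊆ unitBall := fun _ hx => mem_unitBall.2 hx.2

theorem norm_sq_mem {x : E3} (hx : x ∈ puncturedBall) : ‖x‖ ^ 2 ∈ Set.Ioo (0 : ℝ) 1 :=
  ⟨by have := hx.1; positivity, by nlinarith [hx.1, hx.2]⟩

/-- The function `p(x) F(|x|²)`. -/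
def radMul (p : MvPolynomial (Fin 3) ℝ) (F : ℝ → G) (x : E3) : G := evalAt p x • F (‖x‖ ^ 2)

theorem differentiableAt_radMul (p : MvPolynomial (Fin 3) ℝ) {F : ℝ → G} {x : E3}
    (hF : DifferentiableAt ℝ F (‖x‖ ^ 2)) : DifferentiableAt ℝ (radMul p F) x := by
  have h : DifferentiableAt ℝ (fun y : E3 => F (‖y‖ ^ 2)) x :=
    hF.comp x ((contDiff_norm_sq ℝ (n := 1)).differentiable (by norm_num) x)
  exact (differentiableAt_evalAt p x).smul h

theorem contDiffAt_radMul (p : MvPolynomial (Fin 3) ℝ) {F : ℝ → G} {x : E3} {n : WithTop ℕ∞}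
    (hF : ContDiffAt ℝ n F (‖x‖ ^ 2)) : ContDiffAt ℝ n (radMul p F) x := by
  have h : ContDiffAt ℝ n (fun y : E3 => F (‖y‖ ^ 2)) x :=
    hF.comp x (contDiff_norm_sq ℝ).contDiffAt
  exact (contDiff_evalAt p).contDiffAt.smul h

theorem pd_radMul (p : MvPolynomial (Fin 3) ℝ) {F : ℝ → G} {x : E3}
    (hF : DifferentiableAt ℝ F (‖x‖ ^ 2)) (i : Fin 3) :
    pd i (radMul p F) x = radMul (pderiv i p) F x + radMul (2 * X i * p) (deriv F) x := by
  have h : DifferentiableAt ℝ (fun y : E3 => F (‖y‖ ^ 2)) x :=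
    hF.comp x ((contDiff_norm_sq ℝ (n := 1)).differentiable (by norm_num) x)
  unfold radMul
  rw [pd_smul (differentiableAt_evalAt p x) h, pd_comp_norm_sq hF, pd_evalAt]
  simp only [evalAt_mul, evalAt_X, evalAt_two]
  module

theorem xDotGrad_radMul {p : MvPolynomial (Fin 3) ℝ} {m : ℕ} (hp : p.IsHomogeneous m) {F : ℝ → G}
    {x : E3} (hF : DifferentiableAt ℝ F (‖x‖ ^ 2)) :
    xDotGrad (radMul p F) x = radMul p (fun q => (m : ℝ) • F q + (2 * q) • deriv F q) x := by
  simp only [xDotGrad, pd_radMul p hF, Fin.sum_univ_three, radMul, evalAt_mul, evalAt_X,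
    evalAt_two]
  have e := euler_evalAt hp x
  have h : x 0 • (evalAt (pderiv 0 p) x • F (‖x‖ ^ 2) + (2 * x 0 * evalAt p x) • deriv F (‖x‖ ^ 2))
      + x 1 • (evalAt (pderiv 1 p) x • F (‖x‖ ^ 2) + (2 * x 1 * evalAt p x) • deriv F (‖x‖ ^ 2))
      + x 2 • (evalAt (pderiv 2 p) x • F (‖x‖ ^ 2) + (2 * x 2 * evalAt p x) • deriv F (‖x‖ ^ 2))
      = (x 0 * evalAt (pderiv 0 p) x + x 1 * evalAt (pderiv 1 p) x + x 2 * evalAt (pderiv 2 p) x)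
          • F (‖x‖ ^ 2)
        + (2 * (x 0 ^ 2 + x 1 ^ 2 + x 2 ^ 2) * evalAt p x) • deriv F (‖x‖ ^ 2) := by module
  rw [h, e, ← norm_sq_eq]
  module

theorem contDiffOn_deriv {F : ℝ → G} {k l : WithTop ℕ∞} (hF : ContDiffOn ℝ k F (Set.Ioo 0 1))
    (h : l + 1 ≤ k) : ContDiffOn ℝ l (deriv F) (Set.Ioo 0 1) :=
  hF.deriv_of_isOpen isOpen_Ioo h

theorem differentiableAt_of_contDiffOn {F : ℝ → G} {k : WithTop ℕ∞}
    (hF : ContDiffOn ℝ k F (Set.Ioo 0 1)) (hk : 1 ≤ k) {q : ℝ} (hq : q ∈ Set.Ioo (0 : ℝ) 1) :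
    DifferentiableAt ℝ F q :=
  (hF.contDiffAt (isOpen_Ioo.mem_nhds hq)).differentiableAt (by rintro rfl; simp at hk)

/-- Harmonicity is not assumed, since x_i p, whose Laplacian is 2∂_i p, occurs in poloidal fields.
The origin is excluded because F is controlled only for 0 < q < 1. -/
theorem lap_radMul (p : MvPolynomial (Fin 3) ℝ) {m : ℕ} (hp : p.IsHomogeneous m) {F : ℝ → G}
    (hF : ContDiffOn ℝ 2 F (Set.Ioo 0 1)) {x : E3} (hx : x ∈ puncturedBall) :
    lap (radMul p F) x
      = evalAt (∑ i, pderiv i (pderiv i p)) x • F (‖x‖ ^ 2)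
        + evalAt p x • ((6 + 4 * m : ℝ) • deriv F (‖x‖ ^ 2)
          + (4 * ‖x‖ ^ 2) • deriv (deriv F) (‖x‖ ^ 2)) := by
  have hq := norm_sq_mem hx
  have h1 := differentiableAt_of_contDiffOn hF (by norm_num) hq
  have hF' := contDiffOn_deriv hF (l := 1) (by norm_num)
  have h2 := differentiableAt_of_contDiffOn hF' le_rfl hq
  have e (i : Fin 3) : pd i (pd i (radMul p F)) x
      = radMul (pderiv i (pderiv i p)) F x + radMul (2 * X i * pderiv i p) (deriv F) x
        + (radMul (pderiv i (2 * X i * p)) (deriv F) x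
          + radMul (2 * X i * (2 * X i * p)) (deriv (deriv F)) x) := by
    have : Set.EqOn (pd i (radMul p F))
        (fun y => radMul (pderiv i p) F y + radMul (2 * X i * p) (deriv F) y) puncturedBall :=
      fun y hy => pd_radMul p (differentiableAt_of_contDiffOn hF (by norm_num) (norm_sq_mem hy)) i
    rw [pd_congr isOpen_puncturedBall this i hx,
      pd_add (differentiableAt_radMul _ h1) (differentiableAt_radMul _ h2), pd_radMul _ h1,
      pd_radMul _ h2]
  have e3 (i : Fin 3) : pderiv i (2 * X i * p) = 2 * p + 2 * X i * pderiv i p := by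
    rw [MvPolynomial.pderiv_mul, MvPolynomial.pderiv_mul, MvPolynomial.pderiv_X_self]
    have : pderiv i (2 : MvPolynomial (Fin 3) ℝ) = 0 := by
      rw [show (2 : MvPolynomial (Fin 3) ℝ) = MvPolynomial.C 2 from (map_ofNat _ 2).symm,
        MvPolynomial.pderiv_C]
    rw [this]; ring
  have eu := euler_evalAt hp x
  simp only [lap, e, e3, Fin.sum_univ_three, radMul, evalAt_mul, evalAt_add, evalAt_X, evalAt_two]
  rw [norm_sq_eq] at *
  -- The mixed term 2x_i ∂_i p F' arises twice, once from each order of differentiation; Euler's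
  -- relation turns the sum into 4m p F'.
  linear_combination (norm := module) (4 * eu) • deriv F (x 0 ^ 2 + x 1 ^ 2 + x 2 ^ 2)

theorem xDotGrad_radMul_eqOn {p : MvPolynomial (Fin 3) ℝ} {m : ℕ} (hp : p.IsHomogeneous m)
    {F : ℝ → G} {k : WithTop ℕ∞} (hF : ContDiffOn ℝ k F (Set.Ioo 0 1)) (hk : 1 ≤ k) :
    Set.EqOn (xDotGrad (radMul p F))
      (radMul p (fun q => (m : ℝ) • F q + (2 * q) • deriv F q)) puncturedBall :=
  fun _ hx => xDotGrad_radMul hp (differentiableAt_of_contDiffOn hF hk (norm_sq_mem hx))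

theorem deriv_euler {F : ℝ → G} (hF : ContDiffOn ℝ 2 F (Set.Ioo 0 1)) (a : ℝ) {q : ℝ}
    (hq : q ∈ Set.Ioo (0 : ℝ) 1) :
    HasDerivAt (fun q => a • F q + (2 * q) • deriv F q)
      ((a + 2) • deriv F q + (2 * q) • deriv (deriv F) q) q := by
  have h1 := (differentiableAt_of_contDiffOn hF (by norm_num) hq).hasDerivAt
  have h2 := (differentiableAt_of_contDiffOn (contDiffOn_deriv hF (l := 1) (by norm_num))
    le_rfl hq).hasDerivAt
  have h3 := (h1.const_smul a).add ((((hasDerivAt_id q).const_mul 2)).smul h2)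
  refine h3.congr_deriv ?_
  simp only [id]
  module

theorem xDotGrad_xDotGrad_radMul {p : MvPolynomial (Fin 3) ℝ} {m : ℕ} (hp : p.IsHomogeneous m)
    {F : ℝ → G} (hF : ContDiffOn ℝ 2 F (Set.Ioo 0 1)) {x : E3} (hx : x ∈ puncturedBall) :
    xDotGrad (xDotGrad (radMul p F)) x = evalAt p x • ((m ^ 2 : ℝ) • F (‖x‖ ^ 2)
      + (4 * (m + 1) * ‖x‖ ^ 2 : ℝ) • deriv F (‖x‖ ^ 2)
      + (4 * (‖x‖ ^ 2) ^ 2) • deriv (deriv F) (‖x‖ ^ 2)) := by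
  have h := deriv_euler hF m (norm_sq_mem hx)
  rw [xDotGrad_congr isOpen_puncturedBall (xDotGrad_radMul_eqOn hp hF (by norm_num)) hx,
    xDotGrad_radMul hp h.differentiableAt, radMul, h.deriv]
  module

/-- Δ₀ acts only in the angular variables, so all derivatives of F cancel. -/
theorem lap0_radMul (p : MvPolynomial (Fin 3) ℝ) {m : ℕ} (hp : p.IsHomogeneous m) {F : ℝ → G}
    (hF : ContDiffOn ℝ 2 F (Set.Ioo 0 1)) {x : E3} (hx : x ∈ puncturedBall) :
    lap0 (radMul p F) x = (‖x‖ ^ 2 * evalAt (∑ i, pderiv i (pderiv i p)) x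
      - m * (m + 1) * evalAt p x) • F (‖x‖ ^ 2) := by
  have hd : DifferentiableAt ℝ (radMul p F) x :=
    differentiableAt_radMul p (differentiableAt_of_contDiffOn hF (by norm_num) (norm_sq_mem hx))
  have hd2 : DifferentiableAt ℝ (xDotGrad (radMul p F)) x :=
    (ContDiffAt.xDotGrad (contDiffAt_radMul p
      (hF.contDiffAt (isOpen_Ioo.mem_nhds (norm_sq_mem hx)))) (m := 1)
      (by norm_num)).differentiableAt (by norm_num)
  have e : xDotGrad (fun y => xDotGrad (radMul p F) y + radMul p F y) x
      = xDotGrad (xDotGrad (radMul p F)) x + xDotGrad (radMul p F) x := by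
    rw [xDotGrad_eq_fderiv, xDotGrad_eq_fderiv, xDotGrad_eq_fderiv (radMul p F),
      fderiv_fun_add hd2 hd, add_apply]
  rw [lap0, e, lap_radMul p hp hF hx, xDotGrad_xDotGrad_radMul hp hF hx,
    xDotGrad_radMul_eqOn hp hF (by norm_num) hx, radMul]
  module

end BallPSWF

/-! ### Solid harmonics, and both operators on scalar and toroidal functions -/

namespace BallPSWF

open MvPolynomial (pderiv X)

variable {G : Type*} [NormedAddCommGroup G] [NormedSpace ℝ G]

/-- The components of `x × ∇ p`. -/
def crossPoly (p : MvPolynomial (Fin 3) ℝ) : Fin 3 → MvPolynomial (Fin 3) ℝ :=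
  ![X 1 * pderiv 2 p - X 2 * pderiv 1 p, X 2 * pderiv 0 p - X 0 * pderiv 2 p,
    X 0 * pderiv 1 p - X 1 * pderiv 0 p]

theorem isHomogeneous_crossPoly {p : MvPolynomial (Fin 3) ℝ} {n : ℕ} (hn : 1 ≤ n)
    (hp : p.IsHomogeneous n) (i : Fin 3) : (crossPoly p i).IsHomogeneous n := by
  have h (j k : Fin 3) : (X j * pderiv k p).IsHomogeneous n := by
    have := (MvPolynomial.isHomogeneous_X ℝ j).mul (hp.pderiv (i := k))
    rwa [show 1 + (n - 1) = n by omega] at this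
  fin_cases i
  · exact (h 1 2).sub (h 2 1)
  · exact (h 2 0).sub (h 0 2)
  · exact (h 0 1).sub (h 1 0)

section Harmonic

variable {p : MvPolynomial (Fin 3) ℝ}

theorem harmonic_eval (hΔ : ∑ i, pderiv i (pderiv i p) = 0) (x : E3) :
    evalAt (pderiv 0 (pderiv 0 p)) x + evalAt (pderiv 1 (pderiv 1 p)) x
      + evalAt (pderiv 2 (pderiv 2 p)) x = 0 := by
  have := congrArg (fun r => evalAt r x) hΔ
  simpa only [Fin.sum_univ_three, evalAt_add, evalAt_zero] using this

theorem harmonic_pderiv (hΔ : ∑ i, pderiv i (pderiv i p) = 0) (k : Fin 3) :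
    ∑ i, pderiv i (pderiv i (pderiv k p)) = 0 := by
  have := congrArg (pderiv k) hΔ
  rw [map_sum, map_zero] at this
  rw [← this]
  refine Finset.sum_congr rfl fun i _ => ?_
  rw [pderiv_comm p i k, pderiv_comm _ i k]

theorem laplacian_X_mul (k : Fin 3) (r : MvPolynomial (Fin 3) ℝ) :
    ∑ i, pderiv i (pderiv i (X k * r)) = X k * ∑ i, pderiv i (pderiv i r) + 2 * pderiv k r := by
  have h0 (i : Fin 3) : pderiv i (1 : MvPolynomial (Fin 3) ℝ) = 0 := MvPolynomial.pderiv_one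
  fin_cases k <;> simp [Fin.sum_univ_three, h0] <;> ring

/-- Rotations commute with the Laplacian: the two correction terms 2∂_a∂_b p cancel by symmetry. -/
theorem harmonic_crossPoly (hΔ : ∑ i, pderiv i (pderiv i p) = 0) (k : Fin 3) :
    ∑ i, pderiv i (pderiv i (crossPoly p k)) = 0 := by
  have h (a b : Fin 3) : ∑ i, pderiv i (pderiv i (X a * pderiv b p - X b * pderiv a p)) = 0 := by
    simp only [map_sub, Finset.sum_sub_distrib]
    rw [laplacian_X_mul, laplacian_X_mul, harmonic_pderiv hΔ, harmonic_pderiv hΔ, pderiv_comm p a b]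
    ring
  fin_cases k
  · exact h 1 2
  · exact h 2 0
  · exact h 0 1

variable {n : ℕ}

/-- The bracket is the radial operator shared with `opD_toroidal`, where only the constant 2α+2 is
added to the coefficient of F. -/
theorem opL_radMul (α c : ℝ) (hp : p.IsHomogeneous n) (hΔ : ∑ i, pderiv i (pderiv i p) = 0)
    {F : ℝ → G} (hF : ContDiffOn ℝ 2 F (Set.Ioo 0 1)) {x : E3} (hx : x ∈ puncturedBall) :
    opL α c (radMul p F) x = evalAt p x •
      ((n * (n + 2 * α + 3) + c ^ 2 * ‖x‖ ^ 2 : ℝ) • F (‖x‖ ^ 2)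
        + ((4 * n + 10 + 4 * α) * ‖x‖ ^ 2 - (4 * n + 6) : ℝ) • deriv F (‖x‖ ^ 2)
        - (4 * ‖x‖ ^ 2 * (1 - ‖x‖ ^ 2)) • deriv (deriv F) (‖x‖ ^ 2)) := by
  rw [opL_eq_expandedL α c (puncturedBall_subset hx)
    (contDiffAt_radMul p (hF.contDiffAt (isOpen_Ioo.mem_nhds (norm_sq_mem hx)))), expandedL,
    lap_radMul p hp hF hx, hΔ, xDotGrad_xDotGrad_radMul hp hF hx,
    xDotGrad_radMul_eqOn hp hF (by norm_num) hx, evalAt_zero, radMul, radMul]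
  module

/-- The gradient of F(|x|²) is parallel to x, so the rotation only sees p. -/
theorem xCrossGrad_radMul {F : ℝ → G} {x : E3} (hF : DifferentiableAt ℝ F (‖x‖ ^ 2)) :
    xCrossGrad (radMul p F) x = fun i => radMul (crossPoly p i) F x := by
  funext i
  fin_cases i <;>
  · simp [xCrossGrad, pd_radMul p hF, radMul, crossPoly, evalAt_mul, evalAt_X, evalAt_sub,
      evalAt_two]
    module

/-- The components of `∇ × P`. -/
def curlPoly (P : Fin 3 → MvPolynomial (Fin 3) ℝ) : Fin 3 → MvPolynomial (Fin 3) ℝ :=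
  ![pderiv 1 (P 2) - pderiv 2 (P 1), pderiv 2 (P 0) - pderiv 0 (P 2),
    pderiv 0 (P 1) - pderiv 1 (P 0)]

/-- The components of `x × P`. -/
def posCross (P : Fin 3 → MvPolynomial (Fin 3) ℝ) : Fin 3 → MvPolynomial (Fin 3) ℝ :=
  ![X 1 * P 2 - X 2 * P 1, X 2 * P 0 - X 0 * P 2, X 0 * P 1 - X 1 * P 0]

theorem curl_radMul (P : Fin 3 → MvPolynomial (Fin 3) ℝ) {F : ℝ → G} {x : E3}
    (hF : DifferentiableAt ℝ F (‖x‖ ^ 2)) :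
    curl (fun y i => radMul (P i) F y) x = fun i =>
      evalAt (curlPoly P i) x • F (‖x‖ ^ 2)
        + (2 * evalAt (posCross P i) x) • deriv F (‖x‖ ^ 2) := by
  funext i
  simp only [curl, pd_radMul _ hF]
  simp only [radMul, curlPoly, posCross]
  fin_cases i <;>
  · simp [evalAt_mul, evalAt_X, evalAt_sub, evalAt_two]
    module

/-- By vector calculus ∇×(x×∇p) = xΔp - 2∇p - (x·∇)∇p; here Δp = 0, and ∇p has degree n-1, which
gives -(2+n-1)∇p. -/
theorem curlPoly_crossPoly (hn : 1 ≤ n) (hp : p.IsHomogeneous n)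
    (hΔ : ∑ i, pderiv i (pderiv i p) = 0) (x : E3) (i : Fin 3) :
    evalAt (curlPoly (crossPoly p) i) x = -(n + 1) * evalAt (pderiv i p) x := by
  have h1 : ((n - 1 : ℕ) : ℝ) = n - 1 := by push_cast [hn]; ring
  have e' (k : Fin 3) := euler_evalAt (hp.pderiv (i := k)) x
  have hl := harmonic_eval hΔ x
  have e0 := e' 0
  have e1 := e' 1
  have e2 := e' 2
  rw [h1] at e0 e1 e2
  rw [pderiv_comm p 1 0, pderiv_comm p 2 0] at e0
  rw [pderiv_comm p 2 1] at e1
  fin_cases i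
  · simp [curlPoly, crossPoly, evalAt_mul, evalAt_X, evalAt_sub, evalAt_add,
      pderiv_comm p 1 0, pderiv_comm p 2 0, pderiv_comm p 2 1]
    linear_combination x 0 * hl - e0
  · simp [curlPoly, crossPoly, evalAt_mul, evalAt_X, evalAt_sub, evalAt_add,
      pderiv_comm p 1 0, pderiv_comm p 2 0, pderiv_comm p 2 1]
    linear_combination x 1 * hl - e1
  · simp [curlPoly, crossPoly, evalAt_mul, evalAt_X, evalAt_sub, evalAt_add,
      pderiv_comm p 1 0, pderiv_comm p 2 0, pderiv_comm p 2 1]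
    linear_combination x 2 * hl - e2

/-- This is x×(x×∇p) = x(x·∇p) - |x|²∇p together with Euler's relation. -/
theorem posCross_crossPoly (hp : p.IsHomogeneous n) (x : E3) (i : Fin 3) :
    evalAt (posCross (crossPoly p) i) x
      = n * x i * evalAt p x - ‖x‖ ^ 2 * evalAt (pderiv i p) x := by
  have e := euler_evalAt hp x
  rw [norm_sq_eq]
  fin_cases i
  · simp [posCross, crossPoly, evalAt_mul, evalAt_X, evalAt_sub]
    linear_combination x 0 * e
  · simp [posCross, crossPoly, evalAt_mul, evalAt_X, evalAt_sub]
    linear_combination x 1 * e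
  · simp [posCross, crossPoly, evalAt_mul, evalAt_X, evalAt_sub]
    linear_combination x 2 * e

/-- The curl of `F(|x|²) x × ∇p` for a solid harmonic `p`. -/
theorem curl_toroidal (hn : 1 ≤ n) (hp : p.IsHomogeneous n)
    (hΔ : ∑ i, pderiv i (pderiv i p) = 0)
    {F : ℝ → G} {x : E3} (hF : DifferentiableAt ℝ F (‖x‖ ^ 2)) :
    curl (fun y i => radMul (crossPoly p i) F y) x = fun i =>
      radMul (X i * p) (fun q => (2 * n : ℝ) • deriv F q) x
        + radMul (pderiv i p) (fun q => -(((n + 1 : ℝ) • F q) + (2 * q) • deriv F q)) x := by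
  rw [curl_radMul _ hF]
  funext i
  rw [curlPoly_crossPoly hn hp hΔ, posCross_crossPoly hp, radMul, radMul, evalAt_mul, evalAt_X]
  module

theorem curlPoly_pos (x : E3) (i : Fin 3) :
    evalAt (curlPoly (fun j => X j * p) i) x = -evalAt (crossPoly p i) x := by
  fin_cases i <;>
  · simp [curlPoly, crossPoly, evalAt_mul, evalAt_X, evalAt_sub]

theorem posCross_pos (x : E3) (i : Fin 3) :
    evalAt (posCross (fun j => X j * p) i) x = 0 := by
  fin_cases i <;>
  · simp [posCross, evalAt_mul, evalAt_X, evalAt_sub]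
    ring

theorem curlPoly_grad (x : E3) (i : Fin 3) :
    evalAt (curlPoly (fun j => pderiv j p) i) x = 0 := by
  fin_cases i <;>
  · simp [curlPoly, pderiv_comm p 1 0, pderiv_comm p 2 0, pderiv_comm p 2 1, evalAt_zero]

theorem posCross_grad (x : E3) (i : Fin 3) :
    evalAt (posCross (fun j => pderiv j p) i) x = evalAt (crossPoly p i) x := by
  fin_cases i <;> simp [posCross, crossPoly]

theorem curl_add {V W : E3 → Fin 3 → G} {x : E3} (hV : ∀ i, DifferentiableAt ℝ (fun y => V y i) x)
    (hW : ∀ i, DifferentiableAt ℝ (fun y => W y i) x) :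
    curl (fun y i => V y i + W y i) x = fun i => curl V x i + curl W x i := by
  funext i
  simp only [curl, pd_add (hV _) (hW _)]
  fin_cases i <;> simp <;> abel

/-- The curl of `A(|x|²) x p + B(|x|²) ∇p`. -/
theorem curl_poloidal {A B : ℝ → G} {x : E3} (hA : DifferentiableAt ℝ A (‖x‖ ^ 2))
    (hB : DifferentiableAt ℝ B (‖x‖ ^ 2)) :
    curl (fun y i => radMul (X i * p) A y + radMul (pderiv i p) B y) x = fun i =>
      radMul (crossPoly p i) (fun q => (2 : ℝ) • deriv B q - A q) x := by
  rw [curl_add (fun i => differentiableAt_radMul _ hA) (fun i => differentiableAt_radMul _ hB),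
    curl_radMul (fun j => X j * p) hA, curl_radMul (fun j => pderiv j p) hB]
  funext i
  simp only [curlPoly_pos, posCross_pos, curlPoly_grad, posCross_grad, radMul]
  module

theorem hasDerivAt_one_sub_rpow (a : ℝ) {q : ℝ} (hq : q ∈ Set.Ioo (0 : ℝ) 1) :
    HasDerivAt (fun q : ℝ => (1 - q) ^ (a + 1)) (-((a + 1) * (1 - q) ^ a)) q := by
  have := ((hasDerivAt_id q).const_sub 1).rpow_const (p := a + 1)
    (Or.inl (sub_pos.2 hq.2).ne')
  refine this.congr_deriv ?_
  rw [add_sub_cancel_right, id]; ring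

theorem hasDerivAt_weighted (a : ℝ) {F : ℝ → G} {q : ℝ} (hq : q ∈ Set.Ioo (0 : ℝ) 1)
    (hF : DifferentiableAt ℝ F q) :
    HasDerivAt (fun q : ℝ => ((1 - q) ^ (a + 1) : ℝ) • F q)
      ((1 - q) ^ (a + 1) • deriv F q - ((a + 1) * (1 - q) ^ a) • F q) q := by
  refine ((hasDerivAt_one_sub_rpow a hq).smul hF.hasDerivAt).congr_deriv ?_
  module

theorem rpow_neg_mul (a : ℝ) {q : ℝ} (hq : q ∈ Set.Ioo (0 : ℝ) 1) :
    (1 - q) ^ (-a) * (1 - q) ^ a = 1 := by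
  rw [← Real.rpow_add (sub_pos.2 hq.2)]; simp

theorem rpow_neg_mul_add_one (a : ℝ) {q : ℝ} (hq : q ∈ Set.Ioo (0 : ℝ) 1) :
    (1 - q) ^ (-a) * (1 - q) ^ (a + 1) = 1 - q := by
  rw [← Real.rpow_add (sub_pos.2 hq.2)]; simp

/-- The operator `opD` on `F(|x|²) x × ∇p` for a solid harmonic `p`. -/
theorem opD_toroidal (α c : ℝ) (hn : 1 ≤ n) (hp : p.IsHomogeneous n)
    (hΔ : ∑ i, pderiv i (pderiv i p) = 0) {F : ℝ → G} (hF : ContDiffOn ℝ 2 F (Set.Ioo 0 1))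
    {x : E3} (hx : x ∈ puncturedBall) :
    opD α c (fun y i => radMul (crossPoly p i) F y) x = fun i => evalAt (crossPoly p i) x •
      ((n * (n + 2 * α + 3) + c ^ 2 * ‖x‖ ^ 2 + 2 * α + 2 : ℝ) • F (‖x‖ ^ 2)
        + ((4 * n + 10 + 4 * α) * ‖x‖ ^ 2 - (4 * n + 6) : ℝ) • deriv F (‖x‖ ^ 2)
        - (4 * ‖x‖ ^ 2 * (1 - ‖x‖ ^ 2)) • deriv (deriv F) (‖x‖ ^ 2)) := by
  have hq := norm_sq_mem hx
  have hF' := contDiffOn_deriv hF (l := 1) (by norm_num)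
  set A : ℝ → G := fun q => (2 * n : ℝ) • deriv F q with hA
  set B : ℝ → G := fun q => -(((n + 1 : ℝ) • F q) + (2 * q) • deriv F q) with hB
  have dA : HasDerivAt A ((2 * n : ℝ) • deriv (deriv F) (‖x‖ ^ 2)) (‖x‖ ^ 2) :=
    (differentiableAt_of_contDiffOn hF' le_rfl hq).hasDerivAt.const_smul _
  have dB : HasDerivAt B (-((n + 1 + 2 : ℝ) • deriv F (‖x‖ ^ 2)
      + (2 * ‖x‖ ^ 2) • deriv (deriv F) (‖x‖ ^ 2))) (‖x‖ ^ 2) := (deriv_euler hF (n + 1) hq).neg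
  have h1 : Set.EqOn
      (fun y => weight (α + 1) y • curl (fun y i => radMul (crossPoly p i) F y) y)
      (fun y i => radMul (X i * p) (fun q => (1 - q) ^ (α + 1) • A q) y
        + radMul (pderiv i p) (fun q => (1 - q) ^ (α + 1) • B q) y) puncturedBall := fun y hy => by
    dsimp only
    rw [curl_toroidal hn hp hΔ (differentiableAt_of_contDiffOn hF (by norm_num) (norm_sq_mem hy))]
    funext i
    simp only [Pi.smul_apply, radMul, weight, hA, hB]
    module
  have dwA := hasDerivAt_weighted α hq dA.differentiableAt
  have dwB := hasDerivAt_weighted α hq dB.differentiableAt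
  rw [opD, curl_congr isOpen_puncturedBall h1 hx,
    curl_poloidal dwA.differentiableAt dwB.differentiableAt]
  funext i
  have h2 : lap0 (fun y => radMul (crossPoly p i) F y) x
      = -((n * (n + 1) * evalAt (crossPoly p i) x : ℝ) • F (‖x‖ ^ 2)) := by
    have := lap0_radMul (crossPoly p i) (isHomogeneous_crossPoly hn hp i) hF hx
    rw [harmonic_crossPoly hΔ, evalAt_zero] at this
    rw [show (fun y => radMul (crossPoly p i) F y) = radMul (crossPoly p i) F from rfl, this]
    module
  have e1 := rpow_neg_mul α hq
  have e2 := rpow_neg_mul_add_one α hq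
  simp only [Pi.add_apply, Pi.sub_apply, Pi.smul_apply, h2]
  simp only [radMul, dwB.deriv, dB.deriv, weight]
  simp only [hA, hB]
  -- The outer weight cancels both powers left by differentiating (1-q)^{α+1}. The term -2(α+1)B,
  -- with B = -((n+1)F + 2qF'), contributes 2(α+1)(n+1)F; added to n(n+1)F from -Δ₀ it equals
  -- (n(n+2α+3) + 2α+2)F, which is the source of the shift.
  have key (u v w : G) (s : ℝ) : ((1 - ‖x‖ ^ 2) ^ (-α)) • s •
        ((2 : ℝ) • ((1 - ‖x‖ ^ 2) ^ (α + 1) • u - ((α + 1) * (1 - ‖x‖ ^ 2) ^ α) • v)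
          - (1 - ‖x‖ ^ 2) ^ (α + 1) • w)
      = s • ((2 * (1 - ‖x‖ ^ 2)) • u - (2 * (α + 1)) • v - (1 - ‖x‖ ^ 2) • w) := by
    linear_combination (norm := module) (s * e2) • ((2 : ℝ) • u - w) - (2 * (α + 1) * s * e1) • v
  rw [key]
  module

end Harmonic

end BallPSWF

/-! ### The second operator on poloidal fields, and independence of x p and ∇p -/

namespace BallPSWF

open MvPolynomial (pderiv X)

variable {G : Type*} [NormedAddCommGroup G] [NormedSpace ℝ G]

section Harmonic

variable {p : MvPolynomial (Fin 3) ℝ} {n : ℕ}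

theorem lap0_add {f g : E3 → G} {x : E3} (hf : ContDiffAt ℝ 2 f x) (hg : ContDiffAt ℝ 2 g x) :
    lap0 (fun y => f y + g y) x = lap0 f x + lap0 g x := by
  obtain ⟨s, hs, hso, hxs⟩ : ∃ s : Set E3, (∀ y ∈ s, DifferentiableAt ℝ f y ∧ DifferentiableAt ℝ g y)
      ∧ IsOpen s ∧ x ∈ s := by
    have h1 := (hf.eventually (by simp)).and (hg.eventually (by simp))
    obtain ⟨s, hs, hso, hxs⟩ := mem_nhds_iff.1 h1
    exact ⟨s, fun y hy => ⟨(hs hy).1.differentiableAt (by norm_num),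
      (hs hy).2.differentiableAt (by norm_num)⟩, hso, hxs⟩
  have hpd (i : Fin 3) : Set.EqOn (pd i fun y => f y + g y) (fun y => pd i f y + pd i g y) s :=
    fun y hy => pd_add (hs y hy).1 (hs y hy).2 i
  have d1 {u : E3 → G} (hu : ContDiffAt ℝ 2 u x) (i : Fin 3) : DifferentiableAt ℝ (pd i u) x :=
    (ContDiffAt.pd hu (m := 1) (by norm_num) i).differentiableAt (by norm_num)
  have d2 {u : E3 → G} (hu : ContDiffAt ℝ 2 u x) :
      DifferentiableAt ℝ (fun y => xDotGrad u y + u y) x :=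
    ((ContDiffAt.xDotGrad hu (m := 1) (by norm_num)).differentiableAt (by norm_num)).fun_add
      (hu.differentiableAt (by norm_num))
  have hl : lap (fun y => f y + g y) x = lap f x + lap g x := by
    simp only [lap, ← Finset.sum_add_distrib]
    refine Finset.sum_congr rfl fun i _ => ?_
    rw [pd_congr hso (hpd i) i hxs, pd_add (d1 hf i) (d1 hg i)]
  have hx : Set.EqOn (fun y => xDotGrad (fun y => f y + g y) y + (f y + g y))
      (fun y => (xDotGrad f y + f y) + (xDotGrad g y + g y)) s := fun y hy => by
    simp only [xDotGrad, hpd _ hy, smul_add, Finset.sum_add_distrib]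
    abel
  rw [lap0, hl, xDotGrad_congr hso hx hxs, xDotGrad_eq_fderiv, fderiv_fun_add (d2 hf) (d2 hg),
    add_apply, ← xDotGrad_eq_fderiv, ← xDotGrad_eq_fderiv, lap0, lap0]
  module

/-- The operator `opD` on `A(|x|²) x p + B(|x|²) ∇p` for a solid harmonic `p`. -/
theorem opD_poloidal (α c : ℝ) (hn : 1 ≤ n) (hp : p.IsHomogeneous n)
    (hΔ : ∑ i, pderiv i (pderiv i p) = 0) {A B : ℝ → G} (hA : ContDiffOn ℝ 2 A (Set.Ioo 0 1))
    (hB : ContDiffOn ℝ 2 B (Set.Ioo 0 1)) {E : ℝ → G}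
    (hE : E = fun q => (2 : ℝ) • deriv B q - A q)
    {x : E3} (hx : x ∈ puncturedBall) :
    opD α c (fun y i => radMul (X i * p) A y + radMul (pderiv i p) B y) x = fun i =>
      evalAt (X i * p) x • ((2 * n : ℝ) • ((1 - ‖x‖ ^ 2) • deriv E (‖x‖ ^ 2)
          - (α + 1) • E (‖x‖ ^ 2)) + ((n + 1) * (n + 2) + c ^ 2 * ‖x‖ ^ 2 : ℝ) • A (‖x‖ ^ 2))
      + evalAt (pderiv i p) x • (-((n + 1) * (1 - ‖x‖ ^ 2) : ℝ) • E (‖x‖ ^ 2)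
          - (2 * ‖x‖ ^ 2) • ((1 - ‖x‖ ^ 2) • deriv E (‖x‖ ^ 2) - (α + 1) • E (‖x‖ ^ 2))
          - (2 * ‖x‖ ^ 2) • A (‖x‖ ^ 2)
          + (n * (n - 1) + c ^ 2 * ‖x‖ ^ 2 : ℝ) • B (‖x‖ ^ 2)) := by
  have hq := norm_sq_mem hx
  have hB' := contDiffOn_deriv hB (l := 1) (by norm_num)
  have hEd : DifferentiableAt ℝ E (‖x‖ ^ 2) := by
    rw [hE]
    exact ((differentiableAt_of_contDiffOn hB' le_rfl hq).const_smul _).fun_sub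
      (differentiableAt_of_contDiffOn hA (by norm_num) hq)
  have h1 : Set.EqOn
      (fun y => weight (α + 1) y •
        curl (fun y i => radMul (X i * p) A y + radMul (pderiv i p) B y) y)
      (fun y i => radMul (crossPoly p i) (fun q => (1 - q) ^ (α + 1) • E q) y)
      puncturedBall := fun y hy => by
    dsimp only
    rw [curl_poloidal (differentiableAt_of_contDiffOn hA (by norm_num) (norm_sq_mem hy))
      (differentiableAt_of_contDiffOn hB (by norm_num) (norm_sq_mem hy))]
    funext i
    simp only [Pi.smul_apply, radMul, weight, hE]
    module
  have dwE := hasDerivAt_weighted α hq hEd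
  rw [opD, curl_congr isOpen_puncturedBall h1 hx, curl_toroidal hn hp hΔ dwE.differentiableAt]
  funext i
  -- The degrees n+1 of x_i p and n-1 of ∂_i p give the constants (n+1)(n+2) and n(n-1). Since Δ(x_i
  -- p) = 2∂_i p, the factor A also enters the ∇p component.
  have h2 : lap0 (fun y => radMul (X i * p) A y + radMul (pderiv i p) B y) x
      = (‖x‖ ^ 2 * (2 * evalAt (pderiv i p) x) - (n + 1) * (n + 2) * evalAt (X i * p) x)
          • A (‖x‖ ^ 2) - (n * (n - 1) * evalAt (pderiv i p) x) • B (‖x‖ ^ 2) := by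
    have hi := isOpen_Ioo.mem_nhds hq
    have hXp : (X i * p).IsHomogeneous (n + 1) := by
      have := (MvPolynomial.isHomogeneous_X ℝ i).mul hp
      rwa [add_comm] at this
    rw [lap0_add (contDiffAt_radMul _ (hA.contDiffAt hi)) (contDiffAt_radMul _ (hB.contDiffAt hi)),
      lap0_radMul _ hXp hA hx, lap0_radMul _ hp.pderiv hB hx, laplacian_X_mul, hΔ,
      harmonic_pderiv hΔ]
    have hn1 : ((n - 1 : ℕ) : ℝ) = n - 1 := by push_cast [hn]; ring
    rw [hn1, mul_zero, zero_add, evalAt_zero, evalAt_mul 2, evalAt_two]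
    push_cast
    module
  have e1 := rpow_neg_mul α hq
  have e2 := rpow_neg_mul_add_one α hq
  simp only [Pi.add_apply, Pi.sub_apply, Pi.smul_apply, h2]
  simp only [radMul, dwE.deriv, weight]
  set s := evalAt (X i * p) x
  set t := evalAt (pderiv i p) x
  set W := (1 - ‖x‖ ^ 2) ^ (-α)
  set w := (1 - ‖x‖ ^ 2) ^ α
  set w1 := (1 - ‖x‖ ^ 2) ^ (α + 1)
  linear_combination (norm := module)
    e2 • ((2 * n * s - t * 2 * ‖x‖ ^ 2 : ℝ) • deriv E (‖x‖ ^ 2) - (t * (n + 1)) • E (‖x‖ ^ 2))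
    - e1 • ((α + 1) * (2 * n * s - t * 2 * ‖x‖ ^ 2)) • E (‖x‖ ^ 2)

/-- If x×∇p vanished on one sphere, it would vanish everywhere by homogeneity. Its curl -(n+1)∇p
would vanish too, and Euler's relation would give p = 0. -/
theorem exists_crossPoly_ne_zero (hn : 1 ≤ n) (hp : p.IsHomogeneous n)
    (hΔ : ∑ i, pderiv i (pderiv i p) = 0) (hp0 : ∃ x, evalAt p x ≠ 0) {r : ℝ} (hr : 0 < r) :
    ∃ x : E3, ‖x‖ = r ∧ ∃ i, evalAt (crossPoly p i) x ≠ 0 := by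
  by_contra! h
  have h1 (i : Fin 3) (x : E3) : evalAt (crossPoly p i) x = 0 := by
    rcases eq_or_ne x 0 with rfl | hx
    · fin_cases i <;> simp [crossPoly, evalAt_sub, evalAt_mul, evalAt_X]
    · have hx' : ‖x‖ ≠ 0 := norm_ne_zero_iff.2 hx
      have := h ((r * ‖x‖⁻¹) • x)
        (by rw [norm_smul, norm_mul, norm_inv, norm_norm, mul_assoc, inv_mul_cancel₀ hx', mul_one,
          Real.norm_of_nonneg hr.le]) i
      rw [evalAt_smul (isHomogeneous_crossPoly hn hp i)] at this
      exact (mul_eq_zero.1 this).resolve_left (by positivity)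
  have h2 (i : Fin 3) : crossPoly p i = 0 := by
    refine MvPolynomial.funext fun v => ?_
    have := h1 i (WithLp.toLp 2 v)
    rw [map_zero]
    exact this
  obtain ⟨x, hx⟩ := hp0
  have h3 (i : Fin 3) : evalAt (pderiv i p) x = 0 := by
    have e := curlPoly_crossPoly hn hp hΔ x i
    have : curlPoly (crossPoly p) i = 0 := by
      fin_cases i <;> simp [curlPoly, h2]
    rw [this, evalAt_zero] at e
    have hne : -((n : ℝ) + 1) ≠ 0 := by
      have : (0 : ℝ) ≤ n := n.cast_nonneg
      linarith
    exact (mul_eq_zero.1 e.symm).resolve_left hne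
  have e := euler_evalAt hp x
  rw [h3, h3, h3] at e
  have : (n : ℝ) * evalAt p x ≠ 0 := mul_ne_zero (by positivity) hx
  exact this (by rw [← e]; ring)

theorem exists_norm_eq_evalAt_ne_zero (hp : p.IsHomogeneous n)
    (hp0 : ∃ x : E3, x ≠ 0 ∧ evalAt p x ≠ 0) {r : ℝ} (hr : 0 < r) :
    ∃ x : E3, ‖x‖ = r ∧ evalAt p x ≠ 0 := by
  obtain ⟨x, hx, hpx⟩ := hp0
  have hx' : ‖x‖ ≠ 0 := norm_ne_zero_iff.2 hx
  refine ⟨(r * ‖x‖⁻¹) • x, ?_, ?_⟩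
  · rw [norm_smul, norm_mul, norm_inv, norm_norm, mul_assoc, inv_mul_cancel₀ hx', mul_one,
      Real.norm_of_nonneg hr.le]
  · rw [evalAt_smul hp]
    exact mul_ne_zero (by positivity) hpx

/-- On each sphere the fields `x p` and `∇p` are linearly independent. -/
theorem eq_zero_of_poloidal_eq_zero (hn : 1 ≤ n) (hp : p.IsHomogeneous n)
    (hΔ : ∑ i, pderiv i (pderiv i p) = 0) (hp0 : ∃ x, x ≠ 0 ∧ evalAt p x ≠ 0) {r : ℝ} (hr : 0 < r)
    {a b : G} (h : ∀ x : E3, ‖x‖ = r → ∀ i, evalAt (X i * p) x • a + evalAt (pderiv i p) x • b = 0) :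
    a = 0 ∧ b = 0 := by
  have hb : b = 0 := by
    obtain ⟨x, hx, i, hi⟩ := exists_crossPoly_ne_zero hn hp hΔ (hp0.imp fun _ h => h.2) hr
    have hx := h x hx
    simp only [evalAt_mul, evalAt_X] at hx
    refine (smul_eq_zero.1 (?_ : evalAt (crossPoly p i) x • b = 0)).resolve_left hi
    -- The cross product with x eliminates a.
    have key (j k : Fin 3) :
        (x j * evalAt (pderiv k p) x - x k * evalAt (pderiv j p) x) • b = 0 := by
      linear_combination (norm := module) x j • hx k - x k • hx j
    fin_cases i <;>
    · simp only [crossPoly, evalAt_sub, evalAt_mul, evalAt_X, Fin.zero_eta, Fin.mk_one,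
        Fin.reduceFinMk, Matrix.cons_val]
      exact key _ _
  refine ⟨?_, hb⟩
  obtain ⟨x, hx, hpx⟩ := exists_norm_eq_evalAt_ne_zero hp hp0 hr
  have h1 := h x hx
  have : ∃ i, x i ≠ 0 := by
    by_contra! h0
    have : x = 0 := by ext i; exact h0 i
    rw [this, norm_zero] at hx
    exact hr.ne hx
  obtain ⟨i, hi⟩ := this
  have h2 := h1 i
  rw [hb, smul_zero, add_zero, evalAt_mul, evalAt_X] at h2
  exact (smul_eq_zero.1 h2).resolve_left (mul_ne_zero hi hpx)

end Harmonic

end BallPSWF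

/-! ### Absence of poloidal eigenfields -/

namespace BallPSWF

open MvPolynomial (pderiv X)

section Poloidal

variable {p : MvPolynomial (Fin 3) ℝ} {n : ℕ}

/-- The radial factor of `θ(|x|) p(x/|x|)` with respect to the solid harmonic `p`. -/
def radialFactor (n : ℕ) (θ : ℝ → ℂ) (q : ℝ) : ℂ := ((√q ^ n)⁻¹ : ℝ) • θ √q

theorem contDiffOn_radialFactor {θ : ℝ → ℂ} (hθ : ContDiffOn ℝ 3 θ (Set.Ioo 0 1)) :
    ContDiffOn ℝ 3 (radialFactor n θ) (Set.Ioo 0 1) := by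
  have hs : ContDiffOn ℝ 3 Real.sqrt (Set.Ioo 0 1) :=
    fun q hq => (Real.contDiffAt_sqrt hq.1.ne').contDiffWithinAt
  have hm : Set.MapsTo Real.sqrt (Set.Ioo 0 1) (Set.Ioo 0 1) := fun q hq =>
    ⟨Real.sqrt_pos.2 hq.1, by rw [Real.sqrt_lt' one_pos]; simpa using hq.2⟩
  exact ((hs.pow n).inv fun q hq => pow_ne_zero _ (hm hq).1.ne').smul (hθ.comp hs hm)

theorem poloidalField_eqOn (hn : 1 ≤ n) (hp : p.IsHomogeneous n)
    (hΔ : ∑ i, pderiv i (pderiv i p) = 0) {θ : ℝ → ℂ} (hθ : ContDiffOn ℝ 3 θ (Set.Ioo 0 1)) :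
    Set.EqOn (poloidalField p θ) (fun y i =>
      radMul (X i * p) (fun q => (2 * n : ℝ) • deriv (radialFactor n θ) q) y
        + radMul (pderiv i p) (fun q => -(((n + 1 : ℝ) • radialFactor n θ q)
          + (2 * q) • deriv (radialFactor n θ) q)) y) puncturedBall := by
  have hF := contDiffOn_radialFactor (n := n) hθ
  have h1 : Set.EqOn (fun x => θ ‖x‖ * ((evalAt p (‖x‖⁻¹ • x) : ℝ) : ℂ))
      (radMul p (radialFactor n θ)) puncturedBall := fun x hx => by
    simp only [radMul, radialFactor, Real.sqrt_sq (norm_nonneg x), evalAt_smul hp,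
      Complex.real_smul, inv_pow]
    push_cast
    ring
  have h2 := xCrossGrad_congr isOpen_puncturedBall h1
  have h3 : Set.EqOn (xCrossGrad (radMul p (radialFactor n θ)))
      (fun y i => radMul (crossPoly p i) (radialFactor n θ) y) puncturedBall := fun x hx =>
    xCrossGrad_radMul (differentiableAt_of_contDiffOn hF (by norm_num) (norm_sq_mem hx))
  intro x hx
  rw [poloidalField, curl_congr isOpen_puncturedBall (h2.trans h3) hx,
    curl_toroidal hn hp hΔ (differentiableAt_of_contDiffOn hF (by norm_num) (norm_sq_mem hx))]

/-- The overdetermined radial system of a poloidal eigenfield has only the zero solution. -/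
theorem radial_system_eq_zero {α c : ℝ} (hα : -1 < α) (hc : 0 < c) (hn : 1 ≤ n) {F : ℝ → ℂ}
    (hF : ContDiffOn ℝ 3 F (Set.Ioo 0 1)) (ν : ℂ) {E : ℝ → ℂ}
    (hE : ∀ q ∈ Set.Ioo (0 : ℝ) 1, E q = -(4 * q * deriv (deriv F) q + (4 * n + 6) * deriv F q))
    (ha : ∀ q ∈ Set.Ioo (0 : ℝ) 1, 2 * n * ((1 - q) * deriv E q - (α + 1) * E q)
      + ((n + 1) * (n + 2) + c ^ 2 * q) * (2 * n * deriv F q) = ν * (2 * n * deriv F q))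
    (hb : ∀ q ∈ Set.Ioo (0 : ℝ) 1, -((n + 1) * (1 - q)) * E q
      - 2 * q * ((1 - q) * deriv E q - (α + 1) * E q) - 2 * q * (2 * n * deriv F q)
      + (n * (n - 1) + c ^ 2 * q) * (-((n + 1) * F q + 2 * q * deriv F q))
      = ν * (-((n + 1) * F q + 2 * q * deriv F q))) :
    ∀ q ∈ Set.Ioo (0 : ℝ) 1, F q = 0 := by
  have hF1 := contDiffOn_deriv hF (l := 2) (by norm_num)
  have hF2 := contDiffOn_deriv hF1 (l := 1) (by norm_num)
  have hdF (q : ℝ) (hq : q ∈ Set.Ioo (0 : ℝ) 1) : HasDerivAt F (deriv F q) q :=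
    (differentiableAt_of_contDiffOn hF (by norm_num) hq).hasDerivAt
  have hdF1 (q : ℝ) (hq : q ∈ Set.Ioo (0 : ℝ) 1) : HasDerivAt (deriv F) (deriv (deriv F) q) q :=
    (differentiableAt_of_contDiffOn hF1 (by norm_num) hq).hasDerivAt
  have hdq (q : ℝ) : HasDerivAt (fun q : ℝ => (q : ℂ)) 1 q := Complex.ofRealCLM.hasDerivAt
  have hdE (q : ℝ) (hq : q ∈ Set.Ioo (0 : ℝ) 1) : HasDerivAt E (deriv E q) q := by
    have h2 := differentiableAt_of_contDiffOn hF2 le_rfl hq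
    have h1 := (hdF1 q hq).differentiableAt
    have : DifferentiableAt ℝ
        (fun q : ℝ => -(4 * q * deriv (deriv F) q + (4 * n + 6) * deriv F q)) q :=
      ((((hdq q).differentiableAt.const_mul 4).mul h2).add (h1.const_mul _)).neg
    exact (this.congr_of_eventuallyEq
      (Filter.eventuallyEq_of_mem (isOpen_Ioo.mem_nhds hq) hE)).hasDerivAt
  have hn0 : (n : ℂ) ≠ 0 := by exact_mod_cast (by omega : n ≠ 0)
  have hn1 : (n : ℂ) + 1 ≠ 0 := by exact_mod_cast (by omega : n + 1 ≠ 0)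
  -- The combination -q·(first equation) - n·(second equation) removes E' and leaves a common factor
  -- n(n+1).
  have h1 : ∀ q ∈ Set.Ioo (0 : ℝ) 1,
      (1 - q) * E q = (ν - c ^ 2 * q - n * (n - 1)) * F q + 4 * q * deriv F q := by
    intro q hq
    have h := mul_ne_zero hn0 hn1
    refine mul_left_cancel₀ h ?_
    linear_combination -(q : ℂ) * ha q hq - n * hb q hq
  have h1' : ∀ q ∈ Set.Ioo (0 : ℝ) 1, (1 - q) * deriv E q - E q
      = -c ^ 2 * F q + (ν - c ^ 2 * q - n * (n - 1)) * deriv F q + 4 * deriv F q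
        + 4 * q * deriv (deriv F) q := by
    intro q hq
    have l := ((hdq q).const_sub 1).mul (hdE q hq)
    have r := ((((((hdq q).const_mul ((c : ℂ) ^ 2)).const_sub ν).sub_const
      ((n : ℂ) * (n - 1))).mul (hdF q hq)).add (((hdq q).const_mul 4).mul (hdF1 q hq)))
    have heq := (l.congr_of_eventuallyEq (Filter.eventuallyEq_of_mem (isOpen_Ioo.mem_nhds hq)
      fun y hy => (h1 y hy).symm)).unique r
    linear_combination heq
  -- Comparing the derivative of `h1` with the first equation cancels E' and the terms with ν; the
  -- definition of E then absorbs the derivatives of F.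
  have h2 : ∀ q ∈ Set.Ioo (0 : ℝ) 1, (α + 1) * E q = -c ^ 2 * F q := by
    intro q hq
    refine mul_left_cancel₀ (mul_ne_zero two_ne_zero hn0) ?_
    linear_combination -ha q hq + 2 * n * h1' q hq + 2 * n * hE q hq
  set a : ℂ := c ^ 2 * (α + 2) with hadef
  set b : ℂ := -c ^ 2 - (α + 1) * (ν - n * (n - 1)) with hbdef
  -- Inserting `h2` into (α+1) times `h1` leaves a first-order equation for F.
  have h3 : ∀ q ∈ Set.Ioo (0 : ℝ) 1, (a * q + b) * F q = (α + 1) * (4 * q * deriv F q) := by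
    intro q hq
    linear_combination -(1 - (q : ℂ)) * h2 q hq + (α + 1) * h1 q hq
  have h3' : ∀ q ∈ Set.Ioo (0 : ℝ) 1,
      a * F q + (a * q + b) * deriv F q
        = (α + 1) * (4 * deriv F q + 4 * q * deriv (deriv F) q) := by
    intro q hq
    have l := (((hdq q).const_mul a).add_const b).mul (hdF q hq)
    have r := (((hdq q).const_mul 4).mul (hdF1 q hq)).const_mul ((α : ℂ) + 1)
    have heq := (l.congr_of_eventuallyEq (Filter.eventuallyEq_of_mem (isOpen_Ioo.mem_nhds hq)
      fun y hy => (h3 y hy).symm)).unique r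
    linear_combination heq
  -- F'' is known both from the derivative of `h3` and from `h2` with the definition of E; equating
  -- the two and removing F' by `h3` leaves an algebraic condition.
  have h4 : ∀ q ∈ Set.Ioo (0 : ℝ) 1, F q * ((a * q + b) * (a * q + b + (α + 1) * (4 * n + 2))
      + 4 * q * (α + 1) * (a - c ^ 2)) = 0 := by
    intro q hq
    have e : (α + 1) * (4 * q * deriv (deriv F) q)
        = c ^ 2 * F q - (α + 1) * (4 * n + 6) * deriv F q := by
      linear_combination -(h2 q hq) + (α + 1) * hE q hq
    linear_combination (a * q + b + (α + 1) * (4 * n + 2)) * h3 q hq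
      + 4 * q * (α + 1) * h3' q hq + 4 * q * (α + 1) * e
  have ha0 : a ≠ 0 := by
    have : c ^ 2 * (α + 2) ≠ 0 := mul_ne_zero (by positivity) (by linarith)
    rw [hadef]; exact_mod_cast this
  intro q hq
  by_contra hne
  have hcont : ContinuousAt F q := (hdF q hq).continuousAt
  obtain ⟨δ, hδ, hball⟩ := Metric.mem_nhds_iff.1
    (Filter.inter_mem (isOpen_Ioo.mem_nhds hq) (hcont.eventually_ne hne))
  have hP : ∀ y ∈ Metric.ball q δ, (a * y + b) * (a * y + b + (α + 1) * (4 * n + 2))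
      + 4 * y * (α + 1) * (a - c ^ 2) = 0 := fun y hy =>
    (mul_eq_zero.1 (h4 y (hball hy).1)).resolve_left (hball hy).2
  have p0 := hP q (Metric.mem_ball_self hδ)
  have p1 := hP (q + δ / 2) (by rw [Metric.mem_ball, Real.dist_eq, add_sub_cancel_left,
    abs_of_pos (by positivity)]; linarith)
  have p2 := hP (q - δ / 2) (by rw [Metric.mem_ball, Real.dist_eq, sub_sub_cancel_left, abs_neg,
    abs_of_pos (by positivity)]; linarith)
  push_cast at p1 p2
  -- Where F ≠ 0 the quadratic vanishes at the three points q and q ± δ/2; twice its second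
  -- difference is a²δ², so the leading coefficient would vanish.
  have : a ^ 2 * (δ : ℂ) ^ 2 = 0 := by linear_combination 2 * p1 + 2 * p2 - 4 * p0
  exact mul_ne_zero (pow_ne_zero 2 ha0) (pow_ne_zero 2 (by exact_mod_cast hδ.ne')) this

theorem poloidalField_eq_zero {α c : ℝ} (hα : -1 < α) (hc : 0 < c) (hn : 1 ≤ n)
    (hp : p.IsHomogeneous n) (hΔ : ∑ i, pderiv i (pderiv i p) = 0)
    (hp0 : ∃ x, x ≠ 0 ∧ evalAt p x ≠ 0) {θ : ℝ → ℂ} (hθ : ContDiffOn ℝ 3 θ (Set.Ioo 0 1)) {ν : ℂ}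
    (h : ∀ x ∈ puncturedBall, opD α c (poloidalField p θ) x = ν • poloidalField p θ x) :
    ∀ x ∈ puncturedBall, poloidalField p θ x = 0 := by
  have hF := contDiffOn_radialFactor (n := n) hθ
  have heq := poloidalField_eqOn hn hp hΔ hθ
  set F := radialFactor n θ
  set A : ℝ → ℂ := fun q => (2 * n : ℝ) • deriv F q with hAdef
  set B : ℝ → ℂ := fun q => -(((n + 1 : ℝ) • F q) + (2 * q) • deriv F q) with hBdef
  have hF1 := contDiffOn_deriv hF (l := 2) (by norm_num)
  have hA : ContDiffOn ℝ 2 A (Set.Ioo 0 1) := hF1.const_smul (2 * n : ℝ)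
  have hB : ContDiffOn ℝ 2 B (Set.Ioo 0 1) :=
    (((hF.of_le (by norm_num)).const_smul (n + 1 : ℝ)).add
      ((contDiffOn_const (c := (2 : ℝ)).mul contDiffOn_id).smul hF1)).neg
  have hE (q : ℝ) (hq : q ∈ Set.Ioo (0 : ℝ) 1) : (2 : ℝ) • deriv B q - A q
      = -(4 * q * deriv (deriv F) q + (4 * n + 6) * deriv F q) := by
    have := (deriv_euler (hF.of_le (by norm_num)) (n + 1) hq).neg.deriv
    change deriv B q = _ at this
    rw [this, hAdef]
    simp only [Complex.real_smul]
    push_cast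
    ring
  set E : ℝ → ℂ := fun q => (2 : ℝ) • deriv B q - A q with hEdef
  have key (q : ℝ) (hq : q ∈ Set.Ioo (0 : ℝ) 1) :
      (2 * n : ℝ) • ((1 - q) • deriv E q - (α + 1) • E q)
        + ((n + 1) * (n + 2) + c ^ 2 * q : ℝ) • A q - ν * A q = 0 ∧
      -((n + 1) * (1 - q) : ℝ) • E q - (2 * q) • ((1 - q) • deriv E q - (α + 1) • E q)
        - (2 * q) • A q + (n * (n - 1) + c ^ 2 * q : ℝ) • B q - ν * B q = 0 := by
    refine eq_zero_of_poloidal_eq_zero (G := ℂ) hn hp hΔ hp0 (Real.sqrt_pos.2 hq.1)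
      fun x hx i => ?_
    have hxq : ‖x‖ ^ 2 = q := by rw [hx, Real.sq_sqrt hq.1.le]
    have hxΩ : x ∈ puncturedBall :=
      ⟨hx ▸ Real.sqrt_pos.2 hq.1, by rw [hx, Real.sqrt_lt' one_pos]; simpa using hq.2⟩
    have h1 := h x hxΩ
    rw [opD_congr α c isOpen_puncturedBall heq hxΩ,
      opD_poloidal α c hn hp hΔ hA hB hEdef hxΩ, heq hxΩ] at h1
    have h2 := congrFun h1 i
    simp only [Pi.smul_apply, radMul, hxq] at h2
    simp only [smul_eq_mul, Complex.real_smul] at h2 ⊢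
    linear_combination h2
  have hzero : ∀ q ∈ Set.Ioo (0 : ℝ) 1, F q = 0 := by
    refine radial_system_eq_zero hα hc hn hF ν hE ?_ ?_
    · intro q hq
      have := (key q hq).1
      simp only [Complex.real_smul] at this
      simp only [hAdef, Complex.real_smul] at this
      push_cast at this
      linear_combination this
    · intro q hq
      have := (key q hq).2
      simp only [Complex.real_smul, hAdef, hBdef] at this
      push_cast at this
      linear_combination this
  intro x hx
  rw [heq hx]
  have hq := norm_sq_mem hx
  have hd : deriv F (‖x‖ ^ 2) = 0 := by
    have : F =ᶠ[nhds (‖x‖ ^ 2)] fun _ => 0 :=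
      Filter.eventuallyEq_of_mem (isOpen_Ioo.mem_nhds hq) hzero
    rw [this.deriv_eq, deriv_const]
  funext i
  simp only [radMul, hAdef, hBdef, hd, hzero _ hq]
  simp

end Poloidal

end BallPSWF

/-! ### The weighted measure and a divergence theorem without boundary term -/

namespace BallPSWF

open MeasureTheory

variable {G : Type*} [NormedAddCommGroup G] [NormedSpace ℝ G]

/-- In (1-r)^α (1+r)^α only the first factor is singular, and it is integrable since α > -1. -/
theorem integrableOn_one_sub_sq_rpow {α : ℝ} (hα : -1 < α) :
    IntegrableOn (fun r : ℝ => (1 - r ^ 2) ^ α) (Set.Ioo 0 1) := by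
  have h1 : IntervalIntegrable (fun r : ℝ => (1 - r) ^ α) volume 0 1 := by
    have := (intervalIntegral.intervalIntegrable_rpow' (a := 0) (b := 1) hα).comp_sub_left 1
    simpa using this.symm
  have h2 : ContinuousOn (fun r : ℝ => (1 + r) ^ α) (Set.uIcc 0 1) := by
    refine ContinuousOn.rpow_const (by fun_prop) fun r hr => Or.inl ?_
    rw [Set.uIcc_of_le zero_le_one] at hr
    linarith [hr.1]
  have h3 := (h1.mul_continuousOn h2).1
  rw [← integrableOn_Ioc_iff_integrableOn_Ioo]
  refine h3.congr_fun (fun r hr => ?_) measurableSet_Ioc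
  dsimp only
  rw [← Real.mul_rpow (by linarith [hr.2]) (by linarith [hr.1])]
  ring_nf

theorem integrableOn_weight {α : ℝ} (hα : -1 < α) : IntegrableOn (weight α) unitBall := by
  have := (integrableOn_fun_norm_addHaar (E := E3) volume
    (f := fun r : ℝ => (1 - r ^ 2) ^ α) (r := 1)).2
  refine this ?_
  have h := integrableOn_one_sub_sq_rpow hα
  refine h.mono' ?_ ?_
  · exact (by fun_prop : Measurable fun r : ℝ => r ^ (Module.finrank ℝ E3 - 1) • (1 - r ^ 2) ^ α)
      |>.aestronglyMeasurable
  · refine (ae_restrict_mem measurableSet_Ioo).mono fun r hr => ?_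
    have h1 : (0 : ℝ) ≤ (1 - r ^ 2) ^ α := Real.rpow_nonneg (by nlinarith [hr.1, hr.2]) _
    rw [norm_smul, Real.norm_of_nonneg h1, norm_pow, Real.norm_of_nonneg hr.1.le]
    exact mul_le_of_le_one_left h1 (pow_le_one₀ hr.1.le hr.2.le)

theorem measurable_weight (α : ℝ) : Measurable (weight α) := by
  unfold weight; fun_prop

theorem isFiniteMeasure_ballMeasure {α : ℝ} (hα : -1 < α) : IsFiniteMeasure (ballMeasure α) :=
  isFiniteMeasure_withDensity_ofReal (integrableOn_weight hα).2

theorem ae_mem_unitBall (α : ℝ) : ∀ᵐ x ∂(ballMeasure α), x ∈ unitBall :=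
  (withDensity_absolutelyContinuous _ _).ae_le (ae_restrict_mem Metric.isOpen_ball.measurableSet)

theorem integral_ballMeasure (α : ℝ) (f : E3 → G) :
    ∫ x, f x ∂(ballMeasure α) = ∫ x in unitBall, weight α x • f x := by
  rw [ballMeasure, integral_withDensity_eq_integral_toReal_smul
    (measurable_weight α).ennreal_ofReal (Filter.Eventually.of_forall fun _ => by simp)]
  refine setIntegral_congr_fun Metric.isOpen_ball.measurableSet fun x hx => ?_
  rw [ENNReal.toReal_ofReal]
  exact Real.rpow_nonneg (one_sub_norm_sq_pos hx).le _

theorem exists_bound_on_ball {G : Type*} [NormedAddCommGroup G] {f : E3 → G} (hf : Continuous f) :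
    ∃ C, 0 ≤ C ∧ ∀ x ∈ unitBall, ‖f x‖ ≤ C := by
  obtain ⟨C, hC⟩ := (isCompact_closedBall (0 : E3) 1).exists_bound_of_continuousOn hf.continuousOn
  exact ⟨max C 0, le_max_right _ _,
    fun x hx => (hC x (Metric.ball_subset_closedBall hx)).trans (le_max_left _ _)⟩

theorem memLp_ballMeasure {G : Type*} [NormedAddCommGroup G] {α : ℝ} (hα : -1 < α)
    {f : E3 → G} (hf : Continuous f) (q : ENNReal) :
    MemLp f q (ballMeasure α) := by
  have := isFiniteMeasure_ballMeasure hα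
  obtain ⟨C, -, hC⟩ := exists_bound_on_ball hf
  exact MemLp.of_bound hf.aestronglyMeasurable C ((ae_mem_unitBall α).mono hC)

theorem integrable_ballMeasure {G : Type*} [NormedAddCommGroup G] {α : ℝ} (hα : -1 < α)
    {f : E3 → G} (hf : Continuous f) :
    Integrable f (ballMeasure α) :=
  memLp_one_iff_integrable.1 (memLp_ballMeasure hα hf 1)

theorem integral_pd_eq_zero {f : E3 → G} (hf : ContDiff ℝ 1 f) (hs : HasCompactSupport f)
    (i : Fin 3) : ∫ x, pd i f x = 0 := by
  have hc : Continuous (pd i f) := (hf.continuous_fderiv (by norm_num)).clm_apply continuous_const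
  have h := integral_smul_fderiv_eq_neg_fderiv_smul_of_integrable (𝕜 := ℝ) (f := fun _ : E3 => 1)
    (g := f) (v := EuclideanSpace.single i (1 : ℝ)) (μ := volume) (by simp) ?_ ?_
    (fun _ _ => differentiableAt_const _) (fun _ _ => hf.differentiable (by norm_num) _)
  · simpa [pd] using h
  · simp only [one_smul]
    exact hc.integrable_of_hasCompactSupport (hs.fderiv_apply ℝ _)
  · simpa using hf.continuous.integrable_of_hasCompactSupport hs

/-- A smooth cutoff of the weight near the unit sphere. -/
def cutWeight (α : ℝ) (m : ℕ) (x : E3) : ℝ :=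
  weight α x * Real.smoothTransition ((m + 1) * (1 - ‖x‖ ^ 2) - 1)

theorem cutWeight_eq_zero (α : ℝ) (m : ℕ) {x : E3} (hx : (m + 1) * (1 - ‖x‖ ^ 2) ≤ 1) :
    cutWeight α m x = 0 := by
  rw [cutWeight, Real.smoothTransition.zero_of_nonpos (by linarith), mul_zero]

/-- The cutoff vanishes on the open set (m+1)(1-|x|²) < 1, a neighbourhood of every point outside
the open ball; hence the cut weight is C¹ on the whole space although the weight may blow up on the
sphere. -/
theorem cutWeight_eventuallyEq_zero (α : ℝ) (m : ℕ) {x : E3} (hx : x ∉ unitBall) :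
    cutWeight α m =ᶠ[nhds x] fun _ => 0 := by
  have ho : IsOpen {y : E3 | ((m : ℝ) + 1) * (1 - ‖y‖ ^ 2) < 1} :=
    isOpen_lt (by fun_prop) continuous_const
  refine Filter.eventuallyEq_of_mem (ho.mem_nhds ?_) fun y hy =>
    cutWeight_eq_zero α m (le_of_lt hy)
  rw [mem_unitBall, not_lt] at hx
  have h1 : 1 - ‖x‖ ^ 2 ≤ 0 := by nlinarith
  have : ((m : ℝ) + 1) * (1 - ‖x‖ ^ 2) ≤ 0 := mul_nonpos_of_nonneg_of_nonpos (by positivity) h1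
  exact lt_of_le_of_lt this one_pos

theorem contDiff_smoothTransition_norm (m : ℕ) :
    ContDiff ℝ 1 fun x : E3 => Real.smoothTransition ((m + 1) * (1 - ‖x‖ ^ 2) - 1) := by
  have hn : ContDiff ℝ 1 fun x : E3 => ‖x‖ ^ 2 := contDiff_norm_sq ℝ
  exact (Real.smoothTransition.contDiff (n := 1)).comp
    ((contDiff_const.mul (contDiff_const.sub hn)).sub contDiff_const)

theorem contDiff_cutWeight (α : ℝ) (m : ℕ) : ContDiff ℝ 1 (cutWeight α m) := by
  rw [contDiff_iff_contDiffAt]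
  intro x
  by_cases hx : x ∈ unitBall
  · exact (contDiffAt_weight α hx).mul (contDiff_smoothTransition_norm m).contDiffAt
  · exact contDiffAt_const.congr_of_eventuallyEq (cutWeight_eventuallyEq_zero α m hx)

theorem pd_cutWeight (α : ℝ) (m : ℕ) {x : E3} (hx : x ∈ unitBall) (i : Fin 3) :
    pd i (cutWeight α m) x * (1 - ‖x‖ ^ 2) = weight α x * (-(2 * x i) *
      (α * Real.smoothTransition ((m + 1) * (1 - ‖x‖ ^ 2) - 1)
        + (m + 1) * (1 - ‖x‖ ^ 2) *
          deriv Real.smoothTransition ((m + 1) * (1 - ‖x‖ ^ 2) - 1))) := by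
  have hT (t : ℝ) : HasDerivAt Real.smoothTransition (deriv Real.smoothTransition t) t :=
    ((Real.smoothTransition.contDiff (n := 1)).differentiable (by norm_num) t).hasDerivAt
  have h1 : HasDerivAt (fun q : ℝ => Real.smoothTransition ((m + 1) * (1 - q) - 1))
      (deriv Real.smoothTransition ((m + 1) * (1 - ‖x‖ ^ 2) - 1) * (-(m + 1))) (‖x‖ ^ 2) := by
    have h0 : HasDerivAt (fun q : ℝ => ((m : ℝ) + 1) * (1 - q) - 1) (-(m + 1)) (‖x‖ ^ 2) :=
      ((((hasDerivAt_id (‖x‖ ^ 2)).const_sub 1).const_mul ((m : ℝ) + 1)).sub_const 1).congr_deriv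
        (by ring)
    exact (hT _).comp (‖x‖ ^ 2) h0
  have h2 := pd_comp_norm_sq h1.differentiableAt i
  have h3 := pd_smul ((contDiffAt_weight α hx (n := 1)).differentiableAt (by norm_num))
    ((contDiff_smoothTransition_norm m).differentiable (by norm_num) x) i
  have hw : weight (α - 1) x * (1 - ‖x‖ ^ 2) = weight α x := by
    have hpos := one_sub_norm_sq_pos hx
    rw [weight, weight, ← Real.rpow_add_one hpos.ne', sub_add_cancel]
  change pd i (fun y => weight α y • Real.smoothTransition ((m + 1) * (1 - ‖y‖ ^ 2) - 1)) x * _ = _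
  rw [h3, h2, h1.deriv, pd_weight α hx]
  simp only [smul_eq_mul]
  linear_combination (-(2 * α * x i)) *
    Real.smoothTransition ((m + 1) * (1 - ‖x‖ ^ 2) - 1) * hw

/-- With t + 1 = (m+1)(1-|x|²), this bounds (1-|x|²) times the q-derivative of the cutoff uniformly
in m: the growth of the derivative is compensated by the width of the layer. -/
theorem exists_bound_deriv_smoothTransition :
    ∃ K, ∀ t : ℝ, ‖(t + 1) * deriv Real.smoothTransition t‖ ≤ K := by
  have hc : Continuous fun t : ℝ => (t + 1) * deriv Real.smoothTransition t :=
    (by fun_prop : Continuous fun t : ℝ => t + 1).mul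
      ((Real.smoothTransition.contDiff (n := 1)).continuous_deriv (by norm_num))
  refine HasCompactSupport.exists_bound_of_continuous
    (HasCompactSupport.intro (isCompact_Icc (a := (0 : ℝ)) (b := 1)) fun t ht => ?_) hc
  have : deriv Real.smoothTransition t = 0 := by
    rcases lt_or_ge t 0 with h | h
    · have : Real.smoothTransition =ᶠ[nhds t] fun _ => 0 :=
        Filter.eventuallyEq_of_mem (isOpen_Iio.mem_nhds h) fun s hs =>
          Real.smoothTransition.zero_of_nonpos (le_of_lt hs)
      rw [this.deriv_eq, deriv_const]
    · have h1 : 1 < t := by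
        by_contra h2
        exact ht ⟨h, not_lt.1 h2⟩
      have : Real.smoothTransition =ᶠ[nhds t] fun _ => 1 :=
        Filter.eventuallyEq_of_mem (isOpen_Ioi.mem_nhds h1) fun s hs =>
          Real.smoothTransition.one_of_one_le (le_of_lt hs)
      rw [this.deriv_eq, deriv_const]
  rw [this, mul_zero]

theorem continuous_divergence {A : E3 → Fin 3 → G} (hA : ∀ i, ContDiff ℝ 1 fun x => A x i) :
    Continuous (divergence A) :=
  continuous_finsetSum _ fun i _ =>
    ((hA i).continuous_fderiv (by norm_num)).clm_apply continuous_const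

/-- The weighted divergence theorem on the unit ball for a field whose normal component vanishes
on the sphere. -/
theorem integral_weighted_divergence {α : ℝ} (hα : -1 < α) {A : E3 → Fin 3 → G}
    (hA : ∀ i, ContDiff ℝ 1 fun x => A x i) {b : E3 → G} (hb : Continuous b)
    (hAb : ∀ x, ∑ i, x i • A x i = (1 - ‖x‖ ^ 2) • b x) :
    ∫ x, (divergence A x - (2 * α) • b x) ∂(ballMeasure α) = 0 := by
  have hfin := isFiniteMeasure_ballMeasure hα
  have hdA := continuous_divergence hA
  set T : ℕ → E3 → ℝ := fun m x => Real.smoothTransition ((m + 1) * (1 - ‖x‖ ^ 2) - 1) with hT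
  set S : ℕ → E3 → ℝ := fun m x => ((m + 1) * (1 - ‖x‖ ^ 2)) *
    deriv Real.smoothTransition ((m + 1) * (1 - ‖x‖ ^ 2) - 1) with hS
  have hTc (m : ℕ) : Continuous (T m) := (contDiff_smoothTransition_norm m).continuous
  have hSc (m : ℕ) : Continuous (S m) := by
    refine Continuous.mul (by fun_prop) ?_
    exact ((Real.smoothTransition.contDiff (n := 1)).continuous_deriv (by norm_num)).comp
      (by fun_prop)
  -- A compactly supported divergence integrates to zero. Differentiating the cut weight brings a
  -- factor (1-|x|²)⁻¹, cancelled by the normal component (1-|x|²)b of the field.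
  have key (m : ℕ) : ∫ x, (T m x • (divergence A x - (2 * α) • b x) - (2 * S m x) • b x)
      ∂(ballMeasure α) = 0 := by
    have hcs (i : Fin 3) : HasCompactSupport fun x => cutWeight α m x • A x i := by
      refine HasCompactSupport.intro (isCompact_closedBall (0 : E3) 1) fun x hx => ?_
      have : x ∉ unitBall := fun h => hx (Metric.ball_subset_closedBall h)
      rw [(cutWeight_eventuallyEq_zero α m this).eq_of_nhds, zero_smul]
    have hcd (i : Fin 3) : ContDiff ℝ 1 fun x => cutWeight α m x • A x i :=
      (contDiff_cutWeight α m).smul (hA i)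
    have h0 : ∫ x, ∑ i, pd i (fun x => cutWeight α m x • A x i) x = 0 := by
      rw [integral_finsetSum]
      · exact Finset.sum_eq_zero fun i _ => integral_pd_eq_zero (hcd i) (hcs i) i
      · intro i _
        exact (((hcd i).continuous_fderiv (by norm_num)).clm_apply
          continuous_const).integrable_of_hasCompactSupport ((hcs i).fderiv_apply ℝ _)
    rw [integral_ballMeasure, ← h0, ← setIntegral_eq_integral_of_forall_compl_eq_zero
      (s := unitBall) (f := fun x => ∑ i, pd i (fun x => cutWeight α m x • A x i) x)]
    · refine setIntegral_congr_fun Metric.isOpen_ball.measurableSet fun x hx => ?_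
      have hpos := one_sub_norm_sq_pos hx
      have hpd (i : Fin 3) : pd i (fun x => cutWeight α m x • A x i) x
          = cutWeight α m x • pd i (fun x => A x i) x
            + (weight α x * (-2) * (1 - ‖x‖ ^ 2)⁻¹ * (α * T m x + S m x)) • (x i • A x i) := by
        rw [pd_smul ((contDiff_cutWeight α m).differentiable (by norm_num) x)
          ((hA i).differentiable (by norm_num) x)]
        have h := pd_cutWeight α m hx i
        have h' : pd i (cutWeight α m) x
            = weight α x * (-2) * (1 - ‖x‖ ^ 2)⁻¹ * (α * T m x + S m x) * x i := by
          rw [← mul_right_inj' hpos.ne', mul_comm, h]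
          field_simp
          simp only [hT, hS]
        rw [h', smul_smul]
      simp only [hpd, Finset.sum_add_distrib, ← Finset.smul_sum, hAb]
      rw [show ∑ i, pd i (fun x => A x i) x = divergence A x from rfl, smul_smul,
        show cutWeight α m x = weight α x * T m x from rfl,
        show weight α x * (-2) * (1 - ‖x‖ ^ 2)⁻¹ * (α * T m x + S m x) * (1 - ‖x‖ ^ 2)
          = weight α x * (-2) * (α * T m x + S m x) by field_simp]
      module
    · intro x hx
      refine Finset.sum_eq_zero fun i _ => ?_
      have : (fun x => cutWeight α m x • A x i) =ᶠ[nhds x] fun _ => 0 :=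
        (cutWeight_eventuallyEq_zero α m hx).mono fun y hy => by simp only [hy, zero_smul]
      simp only [pd, this.fderiv_eq, fderiv_fun_const]
      simp
  obtain ⟨K, hK⟩ := exists_bound_deriv_smoothTransition
  obtain ⟨C₁, hC₁, hb₁⟩ := exists_bound_on_ball (hdA.sub (hb.const_smul (2 * α)))
  obtain ⟨C₂, hC₂, hb₂⟩ := exists_bound_on_ball hb
  -- Pointwise T tends to 1 and S to 0, and both are bounded uniformly in m; a constant dominates
  -- because the measure is finite.
  have hlim := tendsto_integral_of_dominated_convergence (μ := ballMeasure α)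
    (F := fun m x => T m x • (divergence A x - (2 * α) • b x) - (2 * S m x) • b x)
    (f := fun x => divergence A x - (2 * α) • b x) (fun _ => C₁ + 2 * K * C₂)
    (fun m => (((hTc m).smul (hdA.sub (hb.const_smul _))).sub
      ((continuous_const.mul (hSc m)).smul hb)).aestronglyMeasurable)
    (integrable_const _) ?_ ?_
  · simp only [key] at hlim
    exact (tendsto_nhds_unique hlim tendsto_const_nhds)
  · intro m
    filter_upwards [ae_mem_unitBall α] with x hx
    have hTle : ‖T m x‖ ≤ 1 := by
      rw [Real.norm_of_nonneg (Real.smoothTransition.nonneg _)]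
      exact Real.smoothTransition.le_one _
    have hSle : ‖S m x‖ ≤ K := by
      have := hK ((m + 1) * (1 - ‖x‖ ^ 2) - 1)
      rwa [sub_add_cancel] at this
    calc _ ≤ ‖T m x • (divergence A x - (2 * α) • b x)‖ + ‖(2 * S m x) • b x‖ := norm_sub_le _ _
      _ = ‖T m x‖ * ‖divergence A x - (2 * α) • b x‖ + 2 * ‖S m x‖ * ‖b x‖ := by
        rw [norm_smul, norm_smul, norm_mul, Real.norm_ofNat]
      _ ≤ 1 * C₁ + 2 * K * C₂ := by
        have : ‖divergence A x - (2 * α) • b x‖ ≤ C₁ := hb₁ x hx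
        have := hb₂ x hx
        have : 0 ≤ K := (norm_nonneg _).trans hSle
        gcongr
      _ = _ := by ring
  · filter_upwards [ae_mem_unitBall α] with x hx
    have hpos := one_sub_norm_sq_pos hx
    -- For m beyond 2/(1-|x|²) the argument of the transition exceeds 1, where the transition is
    -- constant.
    obtain ⟨N, hN⟩ := exists_nat_gt (2 / (1 - ‖x‖ ^ 2))
    refine tendsto_const_nhds.congr' ?_
    filter_upwards [Filter.eventually_ge_atTop N] with m hm
    have h1 : 1 < (m + 1) * (1 - ‖x‖ ^ 2) - 1 := by
      rw [div_lt_iff₀ hpos] at hN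
      have : (N : ℝ) ≤ m := by exact_mod_cast hm
      nlinarith
    have hT1 : T m x = 1 := Real.smoothTransition.one_of_one_le h1.le
    have hS0 : S m x = 0 := by
      have : Real.smoothTransition =ᶠ[nhds ((m + 1) * (1 - ‖x‖ ^ 2) - 1)] fun _ => 1 :=
        Filter.eventuallyEq_of_mem (isOpen_Ioi.mem_nhds h1) fun s hs =>
          Real.smoothTransition.one_of_one_le (le_of_lt hs)
      simp only [hS, this.deriv_eq, deriv_const, mul_zero]
    rw [hT1, hS0]
    simp

end BallPSWF

/-! ### Symmetry of the first operator and antisymmetry of rotations -/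

namespace BallPSWF

open MeasureTheory

section Energy

variable {R : Type*} [NormedCommRing R] [NormedAlgebra ℝ R]

theorem pd_mul {f g : E3 → R} {x : E3} (hf : DifferentiableAt ℝ f x) (hg : DifferentiableAt ℝ g x)
    (i : Fin 3) : pd i (fun y => f y * g y) x = f x * pd i g x + pd i f x * g x := by
  simp only [pd, fderiv_fun_mul hf hg, add_apply, smul_apply, smul_eq_mul]
  ring

/-- The quadratic form `∇u·∇v - (x·∇u)(x·∇v)`. -/
def gradForm (u v : E3 → R) (x : E3) : R := ∑ i, pd i u x * pd i v x - xDotGrad u x * xDotGrad v x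

theorem gradForm_comm (u v : E3 → R) : gradForm u v = gradForm v u := by
  funext x
  simp only [gradForm, mul_comm]

theorem continuous_gradForm {u v : E3 → R} (hu : ContDiff ℝ ∞ u) (hv : ContDiff ℝ ∞ v) :
    Continuous (gradForm u v) :=
  (continuous_finsetSum _ fun i _ =>
    (ContDiff.pd hu i).continuous.mul (ContDiff.pd hv i).continuous).sub
    ((ContDiff.xDotGrad hu).continuous.mul (ContDiff.xDotGrad hv).continuous)

theorem smooth_differentiableAt {G : Type*} [NormedAddCommGroup G] [NormedSpace ℝ G] {f : E3 → G}
    (hf : ContDiff ℝ ∞ f) (x : E3) : DifferentiableAt ℝ f x :=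
  hf.differentiable (by simp) x

/-- This is the weighted divergence theorem for v(I - xxᵗ)∇u. Values lie in a commutative normed
algebra, so that it serves both the real energy estimate and the complex Fourier kernel. -/
theorem integral_mul_expandedL {α : ℝ} (hα : -1 < α) (c : ℝ) {u v : E3 → R} (hu : ContDiff ℝ ∞ u)
    (hv : ContDiff ℝ ∞ v) :
    ∫ x, v x * expandedL α c u x ∂(ballMeasure α)
      = ∫ x, (gradForm u v x + (c ^ 2 * ‖x‖ ^ 2) • (u x * v x)) ∂(ballMeasure α) := by
  have hDu := ContDiff.xDotGrad hu
  have hM (i : Fin 3) : ContDiff ℝ ∞ fun y : E3 => pd i u y - y i • xDotGrad u y :=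
    (ContDiff.pd hu i).sub ((contDiff_coord i).smul hDu)
  have key := integral_weighted_divergence hα
    (A := fun y i => v y * (pd i u y - y i • xDotGrad u y)) (b := fun y => v y * xDotGrad u y)
    (fun i => (hv.mul (hM i)).of_le (by norm_cast)) (hv.continuous.mul hDu.continuous) ?_
  · have h1 (x : E3) : divergence (fun y i => v y * (pd i u y - y i • xDotGrad u y)) x
        = gradForm u v x + v x * divergence (fun y i => pd i u y - y i • xDotGrad u y) x := by
      have h2 (i : Fin 3) : pd i (fun y => v y * (pd i u y - y i • xDotGrad u y)) x
          = v x * pd i (fun y => pd i u y - y i • xDotGrad u y) x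
            + (pd i u x * pd i v x - xDotGrad u x * (x i • pd i v x)) := by
        rw [pd_mul (smooth_differentiableAt hv x) (smooth_differentiableAt (hM i) x), mul_sub,
          mul_smul_comm, mul_smul_comm, mul_comm (pd i u x), mul_comm (xDotGrad u x)]
      simp only [divergence, h2, Finset.sum_add_distrib, Finset.sum_sub_distrib, ← Finset.mul_sum]
      rw [gradForm, show ∑ i, x i • pd i v x = xDotGrad v x from rfl]
      ring
    have hL := (ContDiff.expandedL α c hu).continuous
    have hsq : Continuous fun x : E3 => (c ^ 2 * ‖x‖ ^ 2) • (u x * v x) :=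
      Continuous.smul (by fun_prop) (hu.continuous.mul hv.continuous)
    rw [← sub_eq_zero, ← neg_eq_zero, neg_sub, ← integral_sub
      (integrable_ballMeasure hα (f := fun x => gradForm u v x + _)
        ((continuous_gradForm hu hv).add hsq))
      (integrable_ballMeasure hα (f := fun x => v x * _) (hv.continuous.mul hL)), ← key]
    refine integral_congr_ae (Filter.Eventually.of_forall fun x => ?_)
    dsimp only
    rw [h1, divergence_tangentialGrad (hu.contDiffAt.of_le (by norm_cast)), expandedL]
    simp only [Algebra.smul_def, map_add, map_mul, map_ofNat]
    ring
  · intro x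
    simp only [← mul_smul_comm, ← Finset.mul_sum, smul_sub, Finset.sum_sub_distrib, smul_smul,
      ← Finset.sum_smul]
    rw [show ∑ i, x i • pd i u x = xDotGrad u x from rfl, norm_sq_eq,
      Fin.sum_univ_three (fun i => x i * x i), sub_smul, one_smul]
    congr 3
    ring

theorem integral_expandedL_comm {α : ℝ} (hα : -1 < α) (c : ℝ) {u v : E3 → R}
    (hu : ContDiff ℝ ∞ u) (hv : ContDiff ℝ ∞ v) :
    ∫ x, v x * expandedL α c u x ∂(ballMeasure α)
      = ∫ x, u x * expandedL α c v x ∂(ballMeasure α) := by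
  rw [integral_mul_expandedL hα c hu hv, integral_mul_expandedL hα c hv hu, gradForm_comm]
  simp only [mul_comm]

theorem integral_xCrossGrad {α : ℝ} (hα : -1 < α) {u v : E3 → R}
    (hu : ContDiff ℝ ∞ u) (hv : ContDiff ℝ ∞ v) (i : Fin 3) :
    ∫ x, v x * xCrossGrad u x i ∂(ballMeasure α)
      = -∫ x, u x * xCrossGrad v x i ∂(ballMeasure α) := by
  have hw : ContDiff ℝ ∞ fun x => u x * v x := hu.mul hv
  have hcu : Continuous fun x => xCrossGrad u x i :=
    (contDiff_pi.1 (contDiff_xCrossGrad hu) i).continuous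
  have hcv : Continuous fun x => xCrossGrad v x i :=
    (contDiff_pi.1 (contDiff_xCrossGrad hv) i).continuous
  rw [← sub_eq_zero, sub_neg_eq_add, ← integral_add
    (integrable_ballMeasure hα (f := fun x => v x * _) (hv.continuous.mul hcu))
    (integrable_ballMeasure hα (f := fun x => u x * _) (hu.continuous.mul hcv))]
  have main (a b : Fin 3) (hab : a ≠ b) : ∫ x : E3, (v x * (x a • pd b u x - x b • pd a u x)
      + u x * (x a • pd b v x - x b • pd a v x)) ∂(ballMeasure α) = 0 := by
    -- The field with entry x_a uv in slot b and -x_b uv in slot a is tangent to spheres, and its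
    -- divergence is the rotation derivative of uv.
    have key := integral_weighted_divergence hα
      (A := fun y j => if j = b then y a • (u y * v y) else
        if j = a then -(y b • (u y * v y)) else 0) (b := fun _ => 0) ?_ continuous_const ?_
    · rw [← key]
      refine integral_congr_ae (Filter.Eventually.of_forall fun x => ?_)
      dsimp only
      have hd := smooth_differentiableAt hw x
      have e1 : pd b (fun y => y a • (u y * v y)) x = x a • pd b (fun y => u y * v y) x := by
        rw [pd_coord_smul hd, if_neg hab.symm, add_zero]
      have e2 : pd a (fun y => -(y b • (u y * v y))) x = -(x b • pd a (fun y => u y * v y) x) := by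
        have h := pd_coord_smul hd a b
        rw [if_neg hab, add_zero] at h
        rw [← h]
        simp only [pd, fderiv_fun_neg, neg_apply]
      have e3 : divergence (fun y j => if j = b then y a • (u y * v y) else
          if j = a then -(y b • (u y * v y)) else 0) x
          = pd b (fun y => y a • (u y * v y)) x + pd a (fun y => -(y b • (u y * v y))) x := by
        rw [divergence, ← Finset.add_sum_erase _ _ (Finset.mem_univ b),
          ← Finset.add_sum_erase (Finset.univ.erase b) _ (Finset.mem_erase.2
            ⟨hab, Finset.mem_univ a⟩), Finset.sum_eq_zero]
        · simp [hab]
        · intro j hj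
          simp only [Finset.mem_erase, Finset.mem_univ, and_true] at hj
          simp [hj.1, hj.2, pd]
      rw [e3, e1, e2, pd_mul (smooth_differentiableAt hu x) (smooth_differentiableAt hv x),
        pd_mul (smooth_differentiableAt hu x) (smooth_differentiableAt hv x)]
      simp only [Algebra.smul_def]
      ring
    · intro j
      have h1 (k : Fin 3) : ContDiff ℝ 1 fun y : E3 => y k • (u y * v y) :=
        (contDiff_coord k).smul (hw.of_le (by norm_cast))
      by_cases hb : j = b
      · simpa [hb] using h1 a
      · by_cases ha : j = a
        · simpa [ha, hab] using (h1 b).neg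
        · simpa [ha, hb] using contDiff_const
    · intro x
      rw [← Finset.add_sum_erase _ _ (Finset.mem_univ b),
          ← Finset.add_sum_erase (Finset.univ.erase b) _ (Finset.mem_erase.2
            ⟨hab, Finset.mem_univ a⟩), Finset.sum_eq_zero]
      · simp only [if_true, if_neg hab, smul_smul, smul_neg, mul_comm, add_zero, smul_zero]
        exact add_neg_cancel _
      · intro j hj
        simp only [Finset.mem_erase, Finset.mem_univ, and_true] at hj
        simp [hj.1, hj.2]
  fin_cases i
  · exact main 1 2 (by decide)
  · exact main 2 0 (by decide)
  · exact main 0 1 (by decide)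

end Energy

end BallPSWF

/-! ### Commutation of the finite Fourier transform with the differential operators -/

namespace BallPSWF

open MeasureTheory

/-- The kernel `exp(-i c ⟨x, t⟩)` of the finite Fourier transform. -/
def fourierKernel (c : ℝ) (x t : E3) : ℂ :=
  Complex.exp (-Complex.I * (c : ℂ) * ((inner ℝ x t : ℝ) : ℂ))

theorem finiteFourier_eq (α c : ℝ) (u : E3 → ℂ) (x : E3) :
    finiteFourier α c u x = ∫ t, fourierKernel c x t * u t ∂(ballMeasure α) := rfl

theorem contDiff_fourierKernel (c : ℝ) (x : E3) : ContDiff ℝ ∞ (fourierKernel c x) := by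
  have h1 : ContDiff ℝ ∞ fun t : E3 => ((inner ℝ x t : ℝ) : ℂ) :=
    Complex.ofRealCLM.contDiff.comp (contDiff_const.inner ℝ contDiff_id)
  exact (contDiff_const.mul h1).cexp

theorem norm_fourierKernel (c : ℝ) (x t : E3) : ‖fourierKernel c x t‖ = 1 := by
  rw [fourierKernel, show -Complex.I * (c : ℂ) * ((inner ℝ x t : ℝ) : ℂ)
    = ((-(c * inner ℝ x t) : ℝ) : ℂ) * Complex.I by push_cast; ring, Complex.norm_exp_ofReal_mul_I]

theorem pd_fourierKernel (c : ℝ) (x t : E3) (i : Fin 3) :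
    pd i (fourierKernel c x) t = (-Complex.I * c * x i) * fourierKernel c x t := by
  have h1 : HasFDerivAt (fun t : E3 => (inner ℝ x t : ℝ)) (innerSL ℝ x) t :=
    (innerSL ℝ x).hasFDerivAt
  have h2 : HasFDerivAt (fun t : E3 => ((inner ℝ x t : ℝ) : ℂ))
      (Complex.ofRealCLM.comp (innerSL ℝ x)) t := Complex.ofRealCLM.hasFDerivAt.comp t h1
  have h3 := (h2.const_mul (-Complex.I * (c : ℂ))).cexp
  simp only [pd]
  rw [show fourierKernel c x = fun t => Complex.exp (-Complex.I * (c : ℂ) *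
    ((inner ℝ x t : ℝ) : ℂ)) from rfl, h3.fderiv]
  simp [EuclideanSpace.inner_single_right]
  ring

theorem integrable_kernel_mul {α c : ℝ} {u : E3 → ℂ} (hu : Integrable u (ballMeasure α)) (x : E3) :
    Integrable (fun t => fourierKernel c x t * u t) (ballMeasure α) :=
  hu.bdd_mul (contDiff_fourierKernel c x).continuous.aestronglyMeasurable
    (Filter.Eventually.of_forall fun t => (norm_fourierKernel c x t).le)

theorem integrable_continuous_mul {α : ℝ} {u : E3 → ℂ} (hu : Integrable u (ballMeasure α))
    {g : E3 → ℂ} (hg : Continuous g) : Integrable (fun t => g t * u t) (ballMeasure α) := by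
  obtain ⟨C, -, hC⟩ := exists_bound_on_ball hg
  exact hu.bdd_mul hg.aestronglyMeasurable ((ae_mem_unitBall α).mono hC)

/-- With the pairing (c/2π)⟨·,·⟩ the transform is an instance of the general Fourier integral, which
provides smoothness and differentiation under the integral. -/
theorem finiteFourier_eq_fourierIntegral (α c : ℝ) (u : E3 → ℂ) :
    finiteFourier α c u = VectorFourier.fourierIntegral Real.fourierChar (ballMeasure α)
      (((c / (2 * Real.pi)) • innerSL ℝ : E3 →L[ℝ] E3 →L[ℝ] ℝ)).toLinearMap₁₂ u := by
  funext x
  rw [finiteFourier, VectorFourier.fourierIntegral]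
  refine integral_congr_ae (Filter.Eventually.of_forall fun t => ?_)
  simp only [Circle.smul_def, Real.fourierChar_apply, smul_eq_mul]
  congr 2
  simp
  rw [real_inner_comm]
  have : (Real.pi : ℂ) ≠ 0 := by exact_mod_cast Real.pi_ne_zero
  field_simp

theorem integrable_norm_pow_mul {α : ℝ} {u : E3 → ℂ} (hu : Integrable u (ballMeasure α)) (k : ℕ) :
    Integrable (fun t => ‖t‖ ^ k * ‖u t‖) (ballMeasure α) := by
  obtain ⟨C, -, hC⟩ := exists_bound_on_ball (continuous_norm.pow k : Continuous fun t : E3 => ‖t‖ ^ k)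
  exact hu.norm.bdd_mul (continuous_norm.pow k).aestronglyMeasurable ((ae_mem_unitBall α).mono hC)

/-- The measure lives on a bounded set, so all moments of an integrable u are finite and the
transform is smooth on the whole space. -/
theorem contDiff_finiteFourier {α c : ℝ} {u : E3 → ℂ} (hu : Integrable u (ballMeasure α)) :
    ContDiff ℝ ∞ (finiteFourier α c u) := by
  rw [finiteFourier_eq_fourierIntegral]
  exact VectorFourier.contDiff_fourierIntegral _ (N := ⊤) fun k _ => integrable_norm_pow_mul hu k

theorem pd_finiteFourier {α c : ℝ} {u : E3 → ℂ} (hu : Integrable u (ballMeasure α)) (i : Fin 3) :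
    pd i (finiteFourier α c u) = finiteFourier α c (fun t => (-Complex.I * c * t i) * u t) := by
  funext x
  have h1 := integrable_norm_pow_mul hu 1
  simp only [pow_one] at h1
  rw [pd, finiteFourier_eq_fourierIntegral, VectorFourier.fderiv_fourierIntegral _ hu h1,
    VectorFourier.fourierIntegral, ContinuousLinearMap.integral_apply]
  · rw [finiteFourier]
    refine integral_congr_ae (Filter.Eventually.of_forall fun t => ?_)
    simp only [Circle.smul_def, Real.fourierChar_apply, smul_eq_mul, smul_apply,
      VectorFourier.fourierSMulRight_apply]
    have h2 : Complex.exp (2 * Real.pi * ((-((((c / (2 * Real.pi)) • innerSL ℝ :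
        E3 →L[ℝ] E3 →L[ℝ] ℝ)).toLinearMap₁₂ t) x : ℝ) : ℂ) * Complex.I)
        = Complex.exp (-Complex.I * c * ((inner ℝ x t : ℝ) : ℂ)) := by
      congr 1
      simp
      rw [real_inner_comm]
      have : (Real.pi : ℂ) ≠ 0 := by exact_mod_cast Real.pi_ne_zero
      field_simp
    have hpi : (Real.pi : ℂ) ≠ 0 := by exact_mod_cast Real.pi_ne_zero
    push_cast at h2 ⊢
    rw [h2]
    congr 1
    simp
    field_simp
    rw [innerSL_apply_apply, EuclideanSpace.inner_single_right]
    simp only [one_mul, conj_trivial]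
    ring
  · refine (VectorFourier.fourierIntegral_convergent_iff Real.continuous_fourierChar
      (((c / (2 * Real.pi)) • innerSL ℝ : E3 →L[ℝ] E3 →L[ℝ] ℝ).continuous₂ :) x).2 ?_
    refine (h1.const_mul (2 * Real.pi * ‖((c / (2 * Real.pi)) • innerSL ℝ :
      E3 →L[ℝ] E3 →L[ℝ] ℝ)‖)).mono' hu.1.fourierSMulRight (Filter.Eventually.of_forall fun t => ?_)
    rw [← mul_assoc]
    exact VectorFourier.norm_fourierSMulRight_le _ _ _

theorem finiteFourier_add {α c : ℝ} {u v : E3 → ℂ} (hu : Integrable u (ballMeasure α))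
    (hv : Integrable v (ballMeasure α)) (x : E3) :
    finiteFourier α c (fun t => u t + v t) x = finiteFourier α c u x + finiteFourier α c v x := by
  simp only [finiteFourier_eq, mul_add]
  exact integral_add (integrable_kernel_mul hu x) (integrable_kernel_mul hv x)

theorem finiteFourier_sum {α c : ℝ} {ι : Type*} (s : Finset ι) {u : ι → E3 → ℂ}
    (hu : ∀ i ∈ s, Integrable (u i) (ballMeasure α)) (x : E3) :
    finiteFourier α c (fun t => ∑ i ∈ s, u i t) x = ∑ i ∈ s, finiteFourier α c (u i) x := by
  simp only [finiteFourier_eq, Finset.mul_sum]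
  exact integral_finsetSum _ fun i hi => integrable_kernel_mul (hu i hi) x

theorem finiteFourier_const_mul (α c : ℝ) (a : ℂ) (u : E3 → ℂ) (x : E3) :
    finiteFourier α c (fun t => a * u t) x = a * finiteFourier α c u x := by
  simp only [finiteFourier_eq, mul_left_comm _ a]
  exact integral_const_mul a _

theorem xDotGrad_xDotGrad {G : Type*} [NormedAddCommGroup G] [NormedSpace ℝ G] {f : E3 → G}
    (hf : ContDiff ℝ ∞ f) (x : E3) : xDotGrad (xDotGrad f) x
      = ∑ i, ∑ j, (x i * x j) • pd i (pd j f) x + xDotGrad f x := by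
  have h1 (i : Fin 3) : pd i (xDotGrad f) x = ∑ j, x j • pd i (pd j f) x + pd i f x := by
    have hd (j : Fin 3) : DifferentiableAt ℝ (pd j f) x := smooth_differentiableAt (ContDiff.pd hf j) x
    have : xDotGrad f = fun y => ∑ j, y j • pd j f y := rfl
    rw [this, pd_sum fun j _ => (differentiableAt_coord j x).fun_smul (hd j)]
    simp only [pd_coord_smul (hd _), Finset.sum_add_distrib, Finset.sum_ite_eq, Finset.mem_univ,
      if_true]
  rw [xDotGrad.eq_def (xDotGrad f)]
  simp only [h1, smul_add, Finset.sum_add_distrib, Finset.smul_sum, smul_smul]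
  rfl

theorem inner_eq_sum (x t : E3) : (inner ℝ x t : ℝ) = x 0 * t 0 + x 1 * t 1 + x 2 * t 2 := by
  simp [PiLp.inner_apply, Fin.sum_univ_three, mul_comm]

/-- The symbol of `expandedL` on plane waves; it is symmetric in `x` and `t`. -/
def waveSymbol (α c : ℝ) (x t : E3) : ℂ :=
  c ^ 2 * (‖x‖ ^ 2 + ‖t‖ ^ 2 : ℝ) - c ^ 2 * (inner ℝ x t : ℝ) ^ 2
    - (2 * α + 4) * (Complex.I * c * (inner ℝ x t : ℝ))

theorem expandedL_fourierKernel (α c : ℝ) (x t : E3) :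
    expandedL α c (fourierKernel c x) t = waveSymbol α c x t * fourierKernel c x t := by
  have h1 (i : Fin 3) : pd i (fourierKernel c x)
      = fun t => (-Complex.I * c * x i) * fourierKernel c x t := funext fun t =>
    pd_fourierKernel c x t i
  have h2 (i j : Fin 3) : pd i (pd j (fourierKernel c x)) t
      = (-Complex.I * c * x j) * ((-Complex.I * c * x i) * fourierKernel c x t) := by
    rw [h1 j, ← pd_fourierKernel]
    simp only [pd]
    rw [fderiv_const_mul (smooth_differentiableAt (contDiff_fourierKernel c x) t)]
    simp
  rw [expandedL, xDotGrad_xDotGrad (contDiff_fourierKernel c x), lap, xDotGrad]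
  simp only [h2, pd_fourierKernel, Fin.sum_univ_three, Complex.real_smul, waveSymbol, norm_sq_eq,
    inner_eq_sum]
  push_cast
  ring_nf
  simp only [Complex.I_sq]
  ring

/-- Each x-derivative becomes multiplication by -ict_i under the integral. The same symbol appears
as for the kernel differentiated in t; this symmetry is what makes the operators commute. -/
theorem expandedL_finiteFourier {α c : ℝ} {u : E3 → ℂ} (hu : Integrable u (ballMeasure α))
    (x : E3) : expandedL α c (finiteFourier α c u) x
      = finiteFourier α c (fun t => waveSymbol α c x t * u t) x := by
  have hc (i : Fin 3) : Continuous fun t : E3 => -Complex.I * c * (t i : ℂ) := by fun_prop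
  have hi (i : Fin 3) := integrable_continuous_mul hu (hc i)
  have hij (i j : Fin 3) := integrable_continuous_mul (hi i) (hc j)
  have h2 (i j : Fin 3) : pd i (pd j (finiteFourier α c u))
      = finiteFourier α c fun t => (-Complex.I * c * t i) * ((-Complex.I * c * t j) * u t) := by
    rw [pd_finiteFourier hu, pd_finiteFourier (hi j)]
  rw [expandedL, xDotGrad_xDotGrad (contDiff_finiteFourier hu), lap, xDotGrad]
  simp only [h2]
  simp only [pd_finiteFourier hu, Complex.real_smul]
  have e : (fun t => waveSymbol α c x t * u t) = fun t : E3 =>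
      (∑ i, (-1) * ((-Complex.I * c * t i) * ((-Complex.I * c * t i) * u t))
      + ∑ i, ∑ j, ((x i * x j : ℝ) : ℂ) * ((-Complex.I * c * t i) * ((-Complex.I * c * t j) * u t)))
      + (∑ i, ((2 * α + 4) * (x i : ℂ)) * ((-Complex.I * c * t i) * u t)
      + ((c ^ 2 * ‖x‖ ^ 2 : ℝ) : ℂ) * u t) := by
    funext t
    simp only [waveSymbol, Fin.sum_univ_three, norm_sq_eq, inner_eq_sum]
    push_cast
    ring_nf
    simp only [Complex.I_sq]
    ring
  have i1 : ∀ i ∈ (Finset.univ : Finset (Fin 3)), Integrable (fun t : E3 =>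
      (-1) * ((-Complex.I * c * t i) * ((-Complex.I * c * t i) * u t))) (ballMeasure α) :=
    fun i _ => (hij i i).const_mul _
  have i2' (i : Fin 3) : ∀ j ∈ (Finset.univ : Finset (Fin 3)), Integrable (fun t : E3 =>
      ((x i * x j : ℝ) : ℂ) * ((-Complex.I * c * t i) * ((-Complex.I * c * t j) * u t)))
      (ballMeasure α) := fun j _ => (hij j i).const_mul _
  have i2 : ∀ i ∈ (Finset.univ : Finset (Fin 3)), Integrable (fun t : E3 => ∑ j,
      ((x i * x j : ℝ) : ℂ) * ((-Complex.I * c * t i) * ((-Complex.I * c * t j) * u t)))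
      (ballMeasure α) := fun i _ => integrable_finsetSum _ (i2' i)
  have i3 : ∀ i ∈ (Finset.univ : Finset (Fin 3)), Integrable (fun t : E3 =>
      ((2 * α + 4) * (x i : ℂ)) * ((-Complex.I * c * t i) * u t)) (ballMeasure α) :=
    fun i _ => (hi i).const_mul _
  rw [e, finiteFourier_add ((integrable_finsetSum _ i1).fun_add (integrable_finsetSum _ i2))
    ((integrable_finsetSum _ i3).fun_add (hu.const_mul _)),
    finiteFourier_add (integrable_finsetSum _ i1) (integrable_finsetSum _ i2),
    finiteFourier_add (integrable_finsetSum _ i3) (hu.const_mul _), finiteFourier_sum _ i1,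
    finiteFourier_sum _ i2, finiteFourier_sum _ i3]
  simp only [finiteFourier_sum _ (i2' _), finiteFourier_const_mul]
  simp only [Fin.sum_univ_three]
  push_cast
  ring

/-- Symmetry of L moves it onto the kernel, where acting in t or in x gives the same symbol. -/
theorem finiteFourier_expandedL {α : ℝ} (hα : -1 < α) (c : ℝ) {u : E3 → ℂ} (hu : ContDiff ℝ ∞ u)
    (x : E3) : finiteFourier α c (expandedL α c u) x = expandedL α c (finiteFourier α c u) x := by
  rw [expandedL_finiteFourier (integrable_ballMeasure hα hu.continuous), finiteFourier_eq,
    integral_expandedL_comm hα c hu (contDiff_fourierKernel c x), finiteFourier_eq]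
  refine integral_congr_ae (Filter.Eventually.of_forall fun t => ?_)
  dsimp only
  rw [expandedL_fourierKernel]
  ring

/-- The kernel depends on ⟨x,t⟩ only, so rotating t is the opposite of rotating x; integration by
parts supplies the second sign. -/
theorem finiteFourier_xCrossGrad {α : ℝ} (hα : -1 < α) (c : ℝ) {u : E3 → ℂ} (hu : ContDiff ℝ ∞ u)
    (x : E3) (i : Fin 3) :
    finiteFourier α c (fun t => xCrossGrad u t i) x = xCrossGrad (finiteFourier α c u) x i := by
  have hui := integrable_ballMeasure hα hu.continuous
  have hc (i : Fin 3) : Continuous fun t : E3 => -Complex.I * c * (t i : ℂ) := by fun_prop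
  have hi (i : Fin 3) := integrable_continuous_mul hui (hc i)
  rw [finiteFourier_eq, integral_xCrossGrad hα hu (contDiff_fourierKernel c x)]
  have main (a b : Fin 3) : -∫ t : E3, u t * (t a • pd b (fourierKernel c x) t
      - t b • pd a (fourierKernel c x) t) ∂(ballMeasure α)
      = x a • pd b (finiteFourier α c u) x - x b • pd a (finiteFourier α c u) x := by
    rw [pd_finiteFourier hui, pd_finiteFourier hui, Complex.real_smul, Complex.real_smul,
      sub_eq_add_neg, ← neg_mul, ← finiteFourier_const_mul, ← finiteFourier_const_mul,
      ← finiteFourier_add ((hi b).const_mul _) ((hi a).const_mul _), finiteFourier_eq, ← integral_neg]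
    refine integral_congr_ae (Filter.Eventually.of_forall fun t => ?_)
    simp only [pd_fourierKernel, Complex.real_smul]
    ring
  fin_cases i
  · exact main 1 2
  · exact main 2 0
  · exact main 0 1

end BallPSWF

/-! ### From the radial equation to eigenfunctions on the ball -/

namespace BallPSWF

open MeasureTheory
open MvPolynomial (pderiv X)

section CLM

variable {G H : Type*} [NormedAddCommGroup G] [NormedSpace ℝ G] [NormedAddCommGroup H]
  [NormedSpace ℝ H] (T : G →L[ℝ] H)

theorem pd_clm {f : E3 → G} (hf : ContDiff ℝ ∞ f) (i : Fin 3) :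
    pd i (fun y => T (f y)) = fun y => T (pd i f y) := by
  funext x
  have := (T.hasFDerivAt (x := f x)).comp x (smooth_differentiableAt hf x).hasFDerivAt
  simp only [pd]
  rw [show (fun y => T (f y)) = T ∘ f from rfl, this.fderiv]
  rfl

theorem xDotGrad_clm {f : E3 → G} (hf : ContDiff ℝ ∞ f) :
    xDotGrad (fun y => T (f y)) = fun y => T (xDotGrad f y) := by
  funext x
  simp only [xDotGrad, pd_clm T hf, map_sum, map_smul]

theorem expandedL_clm (α c : ℝ) {f : E3 → G} (hf : ContDiff ℝ ∞ f) :
    expandedL α c (fun y => T (f y)) = fun y => T (expandedL α c f y) := by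
  funext x
  simp only [expandedL, lap, xDotGrad_clm T hf, xDotGrad_clm T (ContDiff.xDotGrad hf), pd_clm T hf,
    pd_clm T (ContDiff.pd hf _), map_add, map_neg, map_sum, map_smul]

theorem xCrossGrad_clm {f : E3 → G} (hf : ContDiff ℝ ∞ f) (x : E3) (i : Fin 3) :
    xCrossGrad (fun y => T (f y)) x i = T (xCrossGrad f x i) := by
  simp only [xCrossGrad, pd_clm T hf]
  fin_cases i <;> simp

end CLM

theorem expandedL_congr {G : Type*} [NormedAddCommGroup G] [NormedSpace ℝ G] (α c : ℝ)
    {f g : E3 → G} {s : Set E3} (hs : IsOpen s) (h : Set.EqOn f g s) :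
    Set.EqOn (expandedL α c f) (expandedL α c g) s := fun x hx => by
  simp only [expandedL, lap_congr hs h hx, xDotGrad_congr hs h hx,
    xDotGrad_congr hs (xDotGrad_congr hs h) hx, h hx]

theorem finiteFourier_congr (α c : ℝ) {u v : E3 → ℂ} (h : Set.EqOn u v unitBall) :
    finiteFourier α c u = finiteFourier α c v := by
  funext x
  exact integral_congr_ae ((ae_mem_unitBall α).mono fun t ht => by dsimp only; rw [h ht])

theorem integral_ballMeasure_pos {α : ℝ} (hα : -1 < α) {f : E3 → ℝ} (hf : Continuous f)
    (h0 : ∀ x ∈ unitBall, 0 ≤ f x) {x₀ : E3} (hx₀ : x₀ ∈ unitBall) (hpos : 0 < f x₀) :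
    0 < ∫ x, f x ∂(ballMeasure α) := by
  rw [integral_pos_iff_support_of_nonneg_ae ((ae_mem_unitBall α).mono h0)
    (integrable_ballMeasure hα hf), pos_iff_ne_zero]
  intro hz
  rw [ballMeasure, withDensity_apply_eq_zero' (measurable_weight α).ennreal_ofReal.aemeasurable] at hz
  have ho : IsOpen (unitBall ∩ f ⁻¹' Set.Ioi 0) :=
    isOpen_unitBall.inter (isOpen_Ioi.preimage hf)
  have hvol := ho.measure_pos (volume : Measure E3) ⟨x₀, hx₀, hpos⟩
  refine hvol.ne' (le_antisymm ?_ (zero_le))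
  rw [← hz, Measure.restrict_apply₀']
  · refine measure_mono fun x hx => ⟨⟨?_, ne_of_gt hx.2⟩, hx.1⟩
    simp only [Set.mem_ofPred_eq, ne_eq, ENNReal.ofReal_eq_zero, not_le]
    exact Real.rpow_pos_of_pos (one_sub_norm_sq_pos hx.1) _
  · exact isOpen_unitBall.measurableSet.nullMeasurableSet

section SolidHarmonic

variable {p : MvPolynomial (Fin 3) ℝ} {n : ℕ}

theorem evalAt_zero_point (hn : 1 ≤ n) (hp : p.IsHomogeneous n) : evalAt p 0 = 0 := by
  have := evalAt_smul hp 0 0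
  rwa [zero_smul, zero_pow (by omega), zero_mul] at this

theorem expandedL_evalAt (α : ℝ) (hp : p.IsHomogeneous n) (hΔ : ∑ i, pderiv i (pderiv i p) = 0)
    (x : E3) : expandedL α 0 (evalAt p) x = (n * (n + 2 * α + 3)) * evalAt p x := by
  have h1 (i : Fin 3) (r : MvPolynomial (Fin 3) ℝ) : pd i (evalAt r) = evalAt (pderiv i r) :=
    funext fun x => pd_evalAt r x i
  have h2 (y : E3) : xDotGrad (evalAt p) y = n * evalAt p y := by
    rw [← euler_evalAt hp]
    simp only [xDotGrad, h1, Fin.sum_univ_three, smul_eq_mul]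
  have h3 : xDotGrad (xDotGrad (evalAt p)) x = n * (n * evalAt p x) := by
    rw [show xDotGrad (evalAt p) = fun y => n * evalAt p y from funext h2, xDotGrad_eq_fderiv,
      fderiv_const_mul (differentiableAt_evalAt p x), smul_apply,
      ← xDotGrad_eq_fderiv, h2, smul_eq_mul]
  have h4 : lap (evalAt p) x = 0 := by
    rw [← harmonic_eval hΔ x]
    simp only [lap, h1, Fin.sum_univ_three]
  rw [expandedL, h3, h2, h4]
  simp only [smul_eq_mul]
  ring

/-- A solid harmonic of positive degree has a zero outside the origin. -/
theorem exists_evalAt_eq_zero (hn : 1 ≤ n) (hp : p.IsHomogeneous n)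
    (hΔ : ∑ i, pderiv i (pderiv i p) = 0) : ∃ x : E3, x ≠ 0 ∧ evalAt p x = 0 := by
  by_contra! h
  have hint : ∫ x, evalAt p x ∂(ballMeasure 0) = 0 := by
    -- For α = c = 0 the constants have eigenvalue 0 and p has eigenvalue n(n+3) > 0, so symmetry
    -- makes p integrate to zero over the ball; without zeros it would keep one sign on the
    -- connected punctured space.
    have h1 := integral_expandedL_comm (R := ℝ) (α := 0) (by norm_num) 0
      (contDiff_evalAt p) (contDiff_const (c := (1 : ℝ)))
    have h2 (x : E3) : expandedL 0 0 (fun _ : E3 => (1 : ℝ)) x = 0 := by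
      have : ∀ (i : Fin 3) (a : ℝ), pd i (fun _ : E3 => a) = fun _ => 0 := fun i a => by
        funext y; simp [pd]
      have h3 (a : ℝ) : xDotGrad (fun _ : E3 => a) = fun _ => 0 := by
        funext y; simp [xDotGrad, this]
      simp [expandedL, lap, this, h3]
    simp only [h2, expandedL_evalAt 0 hp hΔ, one_mul, mul_zero, integral_zero,
      integral_const_mul] at h1
    exact (mul_eq_zero.1 h1).resolve_left (by positivity)
  have hrank : 1 < Module.rank ℝ E3 := by
    rw [← Module.finrank_eq_rank, finrank_euclideanSpace_fin]
    norm_num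
  have hpre : IsPreconnected ({0}ᶜ : Set E3) :=
    (isPathConnected_compl_singleton_of_one_lt_rank hrank 0).isConnected.isPreconnected
  have hc : Continuous (evalAt p) := (contDiff_evalAt p (n := 0)).continuous
  set e : E3 := EuclideanSpace.single 0 (1 / 2)
  have he : e ∈ unitBall := by
    rw [mem_unitBall, PiLp.norm_single]; norm_num
  have he0 : e ≠ 0 := fun h0 => by
    have := congrArg norm h0
    rw [PiLp.norm_single, norm_zero] at this
    norm_num at this
  have hsign (s : ℝ) (hs : 0 < s * evalAt p e) (x : E3) : 0 ≤ s * evalAt p x := by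
    rcases eq_or_ne x 0 with rfl | hx
    · rw [evalAt_zero_point hn hp, mul_zero]
    · by_contra! hneg
      obtain ⟨y, hy, hy0⟩ := hpre.intermediate_value (f := fun x => s * evalAt p x)
        (a := x) (b := e) hx he0 (hc.const_smul s).continuousOn ⟨hneg.le, hs.le⟩
      have hs0 : s ≠ 0 := by rintro rfl; simp at hs
      exact h y hy ((mul_eq_zero.1 hy0).resolve_left hs0)
  have hcon (s : ℝ) (hs : 0 < s * evalAt p e) : False := by
    have := integral_ballMeasure_pos (α := 0) (by norm_num) (f := fun x => s * evalAt p x)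
      (hc.const_smul s) (fun x _ => hsign s hs x) he hs
    rw [integral_const_mul, hint, mul_zero] at this
    exact lt_irrefl _ this
  rcases lt_or_gt_of_ne (h e he0) with h1 | h1
  · exact hcon (-1) (by linarith)
  · exact hcon 1 (by linarith)

theorem ballFun_eq_radMul (φ : ℝ → ℝ) :
    ballFun p φ = radMul p (fun q => φ (2 * q - 1)) := by
  funext x
  rw [ballFun, radMul, smul_eq_mul, mul_comm]

theorem zero_mem_unitBall : (0 : E3) ∈ unitBall := by rw [mem_unitBall, norm_zero]; exact one_pos

theorem mem_puncturedBall {x : E3} (hx : x ∈ unitBall) (h0 : x ≠ 0) : x ∈ puncturedBall :=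
  ⟨norm_pos_iff.2 h0, mem_unitBall.1 hx⟩

/-- Functions which are continuous at the origin and agree in the punctured ball agree. -/
theorem eqOn_unitBall_of_puncturedBall {H : Type*} [TopologicalSpace H] [T2Space H] {f g : E3 → H}
    (hf : ContinuousAt f 0) (hg : ContinuousAt g 0) (h : Set.EqOn f g puncturedBall) :
    Set.EqOn f g unitBall := by
  intro x hx
  rcases eq_or_ne x 0 with rfl | h0
  · have hne : (nhdsWithin (0 : E3) {0}ᶜ).NeBot := Module.punctured_nhds_neBot ℝ E3 0
    refine tendsto_nhds_unique (f := f) (l := nhdsWithin (0 : E3) {0}ᶜ) (hf.mono_left inf_le_left)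
      ((hg.mono_left inf_le_left : Filter.Tendsto g (nhdsWithin 0 {0}ᶜ) _).congr' ?_)
    have : unitBall ∩ {0}ᶜ ∈ nhdsWithin (0 : E3) {0}ᶜ :=
      Filter.inter_mem (mem_nhdsWithin_of_mem_nhds (isOpen_unitBall.mem_nhds hx))
        self_mem_nhdsWithin
    exact Filter.eventuallyEq_of_mem this fun y hy => (h (mem_puncturedBall hy.1 hy.2)).symm
  · exact h (mem_puncturedBall hx h0)

/-- The radial factor of a function `p(x) F(|x|²)` which is smooth on the ball is smooth. -/
theorem contDiffOn_radial (hp : p.IsHomogeneous n) (hp0 : ∃ x : E3, x ≠ 0 ∧ evalAt p x ≠ 0)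
    {F : ℝ → ℝ} {U : E3 → ℝ} (hU : ContDiff ℝ ∞ U) (h : Set.EqOn (radMul p F) U unitBall) :
    ContDiffOn ℝ ∞ F (Set.Ioo 0 1) := by
  obtain ⟨w, hw, hpw⟩ := exists_norm_eq_evalAt_ne_zero hp hp0 one_pos
  have hs : ContDiffOn ℝ ∞ Real.sqrt (Set.Ioo 0 1) :=
    fun q hq => (Real.contDiffAt_sqrt hq.1.ne').contDiffWithinAt
  -- The radial factor is read off along a ray on which p does not vanish.
  have h1 : ContDiffOn ℝ ∞ (fun q : ℝ => U (√q • w) / (√q ^ n * evalAt p w)) (Set.Ioo 0 1) := by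
    refine ContDiffOn.div (hU.comp_contDiffOn (hs.smul contDiffOn_const))
      ((hs.pow n).mul contDiffOn_const) fun q hq => ?_
    exact mul_ne_zero (pow_ne_zero _ (Real.sqrt_pos.2 hq.1).ne') hpw
  refine h1.congr fun q hq => ?_
  have hq' := Real.sqrt_pos.2 hq.1
  have hnorm : ‖√q • w‖ = √q := by rw [norm_smul, hw, mul_one, Real.norm_of_nonneg hq'.le]
  have hmem : √q • w ∈ unitBall := by
    rw [mem_unitBall, hnorm, Real.sqrt_lt' one_pos]; simpa using hq.2
  rw [← h hmem, radMul, hnorm, Real.sq_sqrt hq.1.le, evalAt_smul hp, smul_eq_mul,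
    mul_div_cancel_left₀]
  exact mul_ne_zero (pow_ne_zero _ hq'.ne') hpw

/-- The radial part of the operator `opL` on solid harmonics of degree `n`. -/
def radialOp (α c : ℝ) (n : ℕ) (F : ℝ → ℝ) (q : ℝ) : ℝ :=
  (n * (n + 2 * α + 3) + c ^ 2 * q) * F q
    + ((4 * n + 10 + 4 * α) * q - (4 * n + 6)) * deriv F q - 4 * q * (1 - q) * deriv (deriv F) q

theorem opL_radMul_eq (α c : ℝ) (hp : p.IsHomogeneous n) (hΔ : ∑ i, pderiv i (pderiv i p) = 0)
    {F : ℝ → ℝ} (hF : ContDiffOn ℝ 2 F (Set.Ioo 0 1)) :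
    Set.EqOn (opL α c (radMul p F)) (radMul p (radialOp α c n F)) puncturedBall := fun x hx => by
  rw [opL_radMul α c hp hΔ hF hx, radMul, radialOp]
  simp only [smul_eq_mul]

/-- The boundary condition is automatic: inside the ball T u coincides with ν V, and V is continuous
up to the sphere. -/
theorem isEigenfunctionOnBall_of_eqOn {H : Type*} [NormedAddCommGroup H] [NormedSpace ℝ H]
    {T : (E3 → H) → E3 → H} {ν : ℝ} {u V : E3 → H} (h0 : ∃ x ∈ unitBall, u x ≠ 0)
    (hV : ContDiff ℝ ∞ V) (huV : Set.EqOn u V unitBall)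
    (hT : Set.EqOn (T u) (fun x => ν • V x) unitBall) : IsEigenfunctionOnBall T ν u := by
  refine ⟨h0, fun x hx => by rw [hT hx, huV hx], V, hV, huV, fun x _ => ?_⟩
  refine (((hV.continuous.const_smul ν).tendsto x).mono_left inf_le_left).congr' ?_
  exact Filter.eventuallyEq_of_mem self_mem_nhdsWithin fun y hy => (hT hy).symm

theorem isEigenfunction_of_radial (α c χ : ℝ) (hn : 1 ≤ n) (hp : p.IsHomogeneous n)
    (hΔ : ∑ i, pderiv i (pderiv i p) = 0) (hp0 : ∃ x : E3, x ≠ 0 ∧ evalAt p x ≠ 0) {F : ℝ → ℝ}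
    {U : E3 → ℝ} (hU : ContDiff ℝ ∞ U) (h : Set.EqOn (radMul p F) U unitBall)
    (hF0 : ∃ q ∈ Set.Ioo (0 : ℝ) 1, F q ≠ 0)
    (hode : ∀ q ∈ Set.Ioo (0 : ℝ) 1, radialOp α c n F q = χ * F q) :
    IsEigenfunctionOnBall (opL α c) χ (radMul p F) ∧
    (∀ x ∈ unitBall, divergence (xCrossGrad (radMul p F)) x = 0) ∧
    IsEigenfunctionOnBall (opD α c) (χ + 2 * α + 2) (xCrossGrad (radMul p F)) := by
  have hF : ContDiffOn ℝ 2 F (Set.Ioo 0 1) := (contDiffOn_radial hp hp0 hU h).of_le (by norm_cast)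
  have hU2 (x : E3) : ContDiffAt ℝ 2 U x := hU.contDiffAt.of_le (by norm_cast)
  obtain ⟨q, hq, hFq⟩ := hF0
  have hsq : (√q) ^ 2 = q := Real.sq_sqrt hq.1.le
  have hsq1 : √q < 1 := by rw [Real.sqrt_lt' one_pos]; simpa using hq.2
  have hV := contDiff_xCrossGrad hU
  have hUV := xCrossGrad_congr isOpen_unitBall h
  have hcross : Set.EqOn (xCrossGrad (radMul p F)) (fun y i => radMul (crossPoly p i) F y)
      puncturedBall := fun x hx =>
    xCrossGrad_radMul (differentiableAt_of_contDiffOn hF (by norm_num) (norm_sq_mem hx))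
  refine ⟨isEigenfunctionOnBall_of_eqOn ?_ hU h ?_, ?_, isEigenfunctionOnBall_of_eqOn ?_ hV hUV ?_⟩
  · obtain ⟨x, hx, hpx⟩ := exists_norm_eq_evalAt_ne_zero hp hp0 (Real.sqrt_pos.2 hq.1)
    refine ⟨x, mem_unitBall.2 (hx ▸ hsq1), ?_⟩
    rw [radMul, hx, hsq]
    exact mul_ne_zero hpx hFq
  · have e : Set.EqOn (opL α c (radMul p F)) (expandedL α c U) unitBall := fun x hx => by
      rw [opL_congr α c isOpen_unitBall h hx, opL_eq_expandedL α c hx (hU2 x)]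
    refine e.trans (eqOn_unitBall_of_puncturedBall
      (ContDiff.expandedL α c hU).continuous.continuousAt
      (hU.continuous.const_smul χ).continuousAt fun x hx => ?_)
    rw [← e (puncturedBall_subset hx), opL_radMul_eq α c hp hΔ hF hx, radMul,
      hode _ (norm_sq_mem hx), ← h (puncturedBall_subset hx), radMul]
    simp only [smul_eq_mul]
    ring
  · intro x hx
    rw [divergence_congr isOpen_unitBall hUV hx, divergence_xCrossGrad (hU2 x)]
  · obtain ⟨x, hx, i, hi⟩ := exists_crossPoly_ne_zero hn hp hΔ (hp0.imp fun _ h => h.2)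
      (Real.sqrt_pos.2 hq.1)
    have hxΩ : x ∈ puncturedBall := ⟨hx ▸ Real.sqrt_pos.2 hq.1, hx ▸ hsq1⟩
    refine ⟨x, puncturedBall_subset hxΩ, fun h0 => ?_⟩
    have := congrFun h0 i
    rw [hcross hxΩ] at this
    simp only [radMul, hx, hsq] at this
    exact mul_ne_zero hi hFq this
  -- The computation with radial factors is valid off the origin only; continuity of both sides
  -- covers the origin.
  · refine (opD_congr α c isOpen_unitBall hUV).trans (eqOn_unitBall_of_puncturedBall
      (continuousAt_opD α c zero_mem_unitBall hV)
      (hV.continuous.const_smul (χ + 2 * α + 2)).continuousAt fun x hx => ?_)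
    rw [← opD_congr α c isOpen_unitBall hUV (puncturedBall_subset hx),
      opD_congr α c isOpen_puncturedBall hcross hx, opD_toroidal α c hn hp hΔ hF hx]
    rw [← hUV (puncturedBall_subset hx), hcross hx]
    funext i
    have := hode _ (norm_sq_mem hx)
    rw [radialOp] at this
    simp only [Pi.smul_apply, radMul, smul_eq_mul]
    linear_combination evalAt (crossPoly p i) x * this

end SolidHarmonic

end BallPSWF

/-! ### Existence and positivity of the eigenvalues -/

namespace BallPSWF

open MeasureTheory
open MvPolynomial (pderiv X)

section FourierEigenfunction

variable {α c : ℝ} {μ : ℂ}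

/-- On the ball u is μ⁻¹ times its own transform, which is smooth everywhere; the real part gives a
real extension. -/
theorem exists_contDiff_of_isFourierEigenfunction (hα : -1 < α) (hμ : μ ≠ 0) {u : E3 → ℝ}
    (hu : IsFourierEigenfunction α c μ u) :
    ∃ U : E3 → ℝ, ContDiff ℝ ∞ U ∧ Set.EqOn u U unitBall := by
  have := isFiniteMeasure_ballMeasure hα
  have hi : Integrable (fun t => (u t : ℂ)) (ballMeasure α) :=
    (hu.1.integrable (by norm_num)).ofReal
  refine ⟨fun x => Complex.reCLM (μ⁻¹ * finiteFourier α c (fun t => (u t : ℂ)) x),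
    Complex.reCLM.contDiff.comp (contDiff_const.mul (contDiff_finiteFourier hi)), fun x hx => ?_⟩
  dsimp only
  rw [hu.2.2 x hx, inv_mul_cancel_left₀ hμ, Complex.reCLM_apply, Complex.ofReal_re]

variable {U : E3 → ℝ}

theorem contDiff_ofReal_comp (hU : ContDiff ℝ ∞ U) : ContDiff ℝ ∞ fun t => (U t : ℂ) :=
  Complex.ofRealCLM.contDiff.comp hU

theorem finiteFourier_expandedL_eigen (hα : -1 < α) (hU : ContDiff ℝ ∞ U)
    (h : Set.EqOn (finiteFourier α c fun t => (U t : ℂ)) (fun x => μ * (U x : ℂ)) unitBall) :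
    Set.EqOn (finiteFourier α c fun t => ((expandedL α c U t : ℝ) : ℂ))
      (fun x => μ * ((expandedL α c U x : ℝ) : ℂ)) unitBall := by
  intro x hx
  have e := expandedL_clm Complex.ofRealCLM α c hU
  simp only [Complex.ofRealCLM_apply] at e
  rw [← e, finiteFourier_expandedL hα c (contDiff_ofReal_comp hU),
    expandedL_congr α c isOpen_unitBall h hx]
  have e2 := expandedL_clm ((ContinuousLinearMap.mul ℝ ℂ) μ) α c (contDiff_ofReal_comp hU)
  simp only [ContinuousLinearMap.mul_apply'] at e2
  rw [e2, e]

theorem finiteFourier_xCrossGrad_eigen (hα : -1 < α) (hU : ContDiff ℝ ∞ U)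
    (h : Set.EqOn (finiteFourier α c fun t => (U t : ℂ)) (fun x => μ * (U x : ℂ)) unitBall)
    (i : Fin 3) :
    Set.EqOn (finiteFourier α c fun t => ((xCrossGrad U t i : ℝ) : ℂ))
      (fun x => μ * ((xCrossGrad U x i : ℝ) : ℂ)) unitBall := by
  intro x hx
  have e := fun x => xCrossGrad_clm Complex.ofRealCLM hU x i
  simp only [Complex.ofRealCLM_apply] at e
  simp only [← e]
  rw [finiteFourier_xCrossGrad hα c (contDiff_ofReal_comp hU),
    xCrossGrad_congr isOpen_unitBall h hx]
  exact xCrossGrad_clm ((ContinuousLinearMap.mul ℝ ℂ) μ) (contDiff_ofReal_comp hU) x i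

end FourierEigenfunction

/-- By Cauchy-Schwarz, |x·∇u| ≤ |x||∇u| ≤ |∇u| in the ball. -/
theorem gradForm_self_nonneg (u : E3 → ℝ) {x : E3} (hx : x ∈ unitBall) : 0 ≤ gradForm u u x := by
  have hx' : ‖x‖ ^ 2 ≤ 1 := by linarith [one_sub_norm_sq_pos hx]
  have hcs := Finset.sum_mul_sq_le_sq_mul_sq Finset.univ (fun i => x i) (fun i => pd i u x)
  rw [← EuclideanSpace.real_norm_sq_eq] at hcs
  have : 0 ≤ ∑ i, pd i u x ^ 2 := Finset.sum_nonneg fun _ _ => sq_nonneg _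
  have h2 : gradForm u u x = ∑ i, pd i u x ^ 2 - (∑ i, x i * pd i u x) ^ 2 := by
    simp only [gradForm, xDotGrad, smul_eq_mul, sq]
  rw [h2]
  nlinarith

section SolidHarmonic

variable {p : MvPolynomial (Fin 3) ℝ} {n : ℕ} {α c : ℝ}

/-- At the origin the radial operator has no controlled value, but p(0) = 0 annihilates it. The
equality is needed there as well, because the Fourier eigenvalue equation is imposed at every point
of the ball. -/
theorem expandedL_eqOn_radMul (hn : 1 ≤ n) (hp : p.IsHomogeneous n)
    (hΔ : ∑ i, pderiv i (pderiv i p) = 0) (hp0 : ∃ x : E3, x ≠ 0 ∧ evalAt p x ≠ 0) {F : ℝ → ℝ}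
    {U : E3 → ℝ} (hU : ContDiff ℝ ∞ U) (h : Set.EqOn (radMul p F) U unitBall) :
    Set.EqOn (radMul p (radialOp α c n F)) (expandedL α c U) unitBall := by
  have hF : ContDiffOn ℝ 2 F (Set.Ioo 0 1) := (contDiffOn_radial hp hp0 hU h).of_le (by norm_cast)
  have hU2 (x : E3) : ContDiffAt ℝ 2 U x := hU.contDiffAt.of_le (by norm_cast)
  have hpun : Set.EqOn (radMul p (radialOp α c n F)) (expandedL α c U) puncturedBall :=
    fun x hx => by
      rw [← opL_radMul_eq α c hp hΔ hF hx,
        opL_congr α c isOpen_unitBall h (puncturedBall_subset hx),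
        opL_eq_expandedL α c (puncturedBall_subset hx) (hU2 x)]
  intro x hx
  rcases eq_or_ne x 0 with rfl | h0
  · rw [radMul, evalAt_zero_point hn hp, zero_smul]
    -- Along a ray on which p vanishes the product form is zero, so the continuous right-hand side
    -- is zero in the limit at the origin.
    obtain ⟨w, hw, hpw⟩ := exists_evalAt_eq_zero hn hp hΔ
    have hcont := (ContDiff.expandedL α c hU).continuous
    have ht : Filter.Tendsto (fun r : ℝ => expandedL α c U (r • w)) (nhdsWithin 0 (Set.Ioi 0))
        (nhds (expandedL α c U 0)) := by
      have : Continuous fun r : ℝ => expandedL α c U (r • w) := by fun_prop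
      have h1 := this.tendsto 0
      rw [zero_smul] at h1
      exact h1.mono_left inf_le_left
    refine tendsto_nhds_unique (tendsto_const_nhds.congr' ?_) ht
    have hw0 : 0 < ‖w‖ := norm_pos_iff.2 hw
    filter_upwards [Ioo_mem_nhdsGT (inv_pos.2 hw0)] with r hr
    have hnorm : ‖r • w‖ = r * ‖w‖ := by rw [norm_smul, Real.norm_of_nonneg hr.1.le]
    have hlt : r * ‖w‖ < 1 := by
      rw [← inv_mul_cancel₀ hw0.ne']
      exact mul_lt_mul_of_pos_right hr.2 hw0
    rw [← hpun ⟨hnorm ▸ mul_pos hr.1 hw0, hnorm ▸ hlt⟩, radMul, evalAt_smul hp, hpw, mul_zero,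
      zero_smul]
  · exact hpun (mem_puncturedBall hx h0)

theorem radial_eq_of_eqOn (hp : p.IsHomogeneous n) (hp0 : ∃ x : E3, x ≠ 0 ∧ evalAt p x ≠ 0)
    {F H : ℝ → ℝ} (h : Set.EqOn (radMul p F) (radMul p H) puncturedBall) :
    Set.EqOn F H (Set.Ioo 0 1) := by
  intro q hq
  obtain ⟨x, hx, hpx⟩ := exists_norm_eq_evalAt_ne_zero hp hp0 (Real.sqrt_pos.2 hq.1)
  have hsq1 : √q < 1 := by rw [Real.sqrt_lt' one_pos]; simpa using hq.2
  have := h (x := x) ⟨hx ▸ Real.sqrt_pos.2 hq.1, hx ▸ hsq1⟩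
  rw [radMul, radMul, hx, Real.sq_sqrt hq.1.le] at this
  exact mul_left_cancel₀ hpx this

theorem exists_radial_ne_zero (hn : 1 ≤ n) (hp : p.IsHomogeneous n) {F : ℝ → ℝ}
    (h : ∃ x ∈ unitBall, radMul p F x ≠ 0) : ∃ q ∈ Set.Ioo (0 : ℝ) 1, F q ≠ 0 := by
  obtain ⟨x, hx, h0⟩ := h
  have hx0 : x ≠ 0 := by
    rintro rfl
    rw [radMul, evalAt_zero_point hn hp, zero_smul] at h0
    exact h0 rfl
  refine ⟨‖x‖ ^ 2, norm_sq_mem (mem_puncturedBall hx hx0), fun hF => h0 ?_⟩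
  rw [radMul, hF, smul_zero]

/-- The eigenvalues of the Sturm-Liouville operator on functions of positive angular degree are
positive. -/
theorem eigenvalue_pos (hα : -1 < α) (hn : 1 ≤ n) (hp : p.IsHomogeneous n)
    (hΔ : ∑ i, pderiv i (pderiv i p) = 0) (hp0 : ∃ x : E3, x ≠ 0 ∧ evalAt p x ≠ 0) {F : ℝ → ℝ}
    {U : E3 → ℝ} (hc : 0 < c) (hU : ContDiff ℝ ∞ U) (h : Set.EqOn (radMul p F) U unitBall)
    (hF0 : ∃ q ∈ Set.Ioo (0 : ℝ) 1, F q ≠ 0) {χ : ℝ}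
    (hode : ∀ q ∈ Set.Ioo (0 : ℝ) 1, radialOp α c n F q = χ * F q) : 0 < χ := by
  have hL : Set.EqOn (expandedL α c U) (fun x => χ * U x) unitBall := by
    refine (expandedL_eqOn_radMul hn hp hΔ hp0 hU h).symm.trans fun x hx => ?_
    rw [← h hx]
    rcases eq_or_ne x 0 with rfl | h0
    · simp only [radMul, evalAt_zero_point hn hp, zero_smul, mul_zero]
    · rw [radMul, hode _ (norm_sq_mem (mem_puncturedBall hx h0)), radMul, smul_eq_mul, smul_eq_mul]
      ring
  obtain ⟨q, hq, hFq⟩ := hF0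
  obtain ⟨x₀, hx₀, hpx⟩ := exists_norm_eq_evalAt_ne_zero hp hp0 (Real.sqrt_pos.2 hq.1)
  have hsq1 : √q < 1 := by rw [Real.sqrt_lt' one_pos]; simpa using hq.2
  have hxb : x₀ ∈ unitBall := mem_unitBall.2 (hx₀ ▸ hsq1)
  have hUx : U x₀ ≠ 0 := by
    rw [← h hxb, radMul, hx₀, Real.sq_sqrt hq.1.le]
    exact mul_ne_zero hpx hFq
  have hUc := hU.continuous
  have hGc := continuous_gradForm hU hU
  have key := integral_mul_expandedL hα c hU hU
  have e1 : ∫ x, U x * expandedL α c U x ∂(ballMeasure α)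
      = χ * ∫ x, U x * U x ∂(ballMeasure α) := by
    rw [← integral_const_mul]
    exact integral_congr_ae ((ae_mem_unitBall α).mono fun x hx => by dsimp only; rw [hL hx]; ring)
  have e2 : 0 < ∫ x, U x * U x ∂(ballMeasure α) :=
    integral_ballMeasure_pos hα (hUc.mul hUc) (fun x _ => mul_self_nonneg _) hxb
      (mul_self_pos.2 hUx)
  -- Strict positivity comes from the potential c²|x|²U² at a point x₀ ≠ 0 with U(x₀) ≠ 0.
  have e3 : 0 < ∫ x, (gradForm U U x + (c ^ 2 * ‖x‖ ^ 2) • (U x * U x)) ∂(ballMeasure α) := by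
    refine integral_ballMeasure_pos hα (by fun_prop) (fun x hx => ?_) hxb ?_
    · exact add_nonneg (gradForm_self_nonneg U hx) (mul_nonneg (by positivity) (mul_self_nonneg _))
    · have : 0 < ‖x₀‖ := hx₀ ▸ Real.sqrt_pos.2 hq.1
      exact add_pos_of_nonneg_of_pos (gradForm_self_nonneg U hxb)
        (mul_pos (by positivity) (mul_self_pos.2 hUx))
  rw [← key, e1] at e3
  exact (pos_iff_pos_of_mul_pos e3).2 e2

end SolidHarmonic

section System

variable {α c : ℝ} {n : ℕ} {Y : Fin (2 * n + 1) → MvPolynomial (Fin 3) ℝ}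

theorem IsSphericalHarmonicBasis.exists_ne_zero (hY : IsSphericalHarmonicBasis n Y)
    (l : Fin (2 * n + 1)) : ∃ x : E3, x ≠ 0 ∧ evalAt (Y l) x ≠ 0 := by
  by_contra! h
  have h1 := hY.orthonormal l l
  rw [if_pos rfl] at h1
  refine one_ne_zero (h1.symm.trans ?_)
  have : ∀ w : Metric.sphere (0 : E3) 1, evalAt (Y l) w * evalAt (Y l) w = 0 := fun w => by
    rw [h w (fun h0 => by simpa [h0] using mem_sphere_zero_iff_norm.1 w.2), mul_zero]
  simp only [this, integral_zero]

variable {φ : ℕ → ℝ → ℝ} {lam : ℕ → ℝ}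

theorem IsBallPSWFSystem.eigenvalue_ne_zero (hS : IsBallPSWFSystem α c n Y φ lam) (hc : 0 < c)
    (k : ℕ) : (-Complex.I) ^ (n + 2 * k) * (lam k : ℂ) ≠ 0 :=
  mul_ne_zero (pow_ne_zero _ (neg_ne_zero.2 Complex.I_ne_zero))
    (Complex.ofReal_ne_zero.2 (hS.lam_pos hc k).ne')

/-- Lψ stays in the one-dimensional eigenspace of ψ among functions with the same harmonic. The
resulting equation involves φ_k alone, so testing with one harmonic yields a χ valid for all of
them. -/
theorem IsBallPSWFSystem.exists_radial_eigenvalue (hS : IsBallPSWFSystem α c n Y φ lam)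
    (hY : IsSphericalHarmonicBasis n Y) (hα : -1 < α) (hc : 0 < c) (hn : 1 ≤ n) (k : ℕ) :
    ∃ χ : ℝ, ∀ q ∈ Set.Ioo (0 : ℝ) 1,
      radialOp α c n (fun q => φ k (2 * q - 1)) q = χ * φ k (2 * q - 1) := by
  set F : ℝ → ℝ := fun q => φ k (2 * q - 1) with hFdef
  have hp := hY.homogeneous 0
  have hp0 := hY.exists_ne_zero 0
  have hE := hS.eigen hc k 0
  have hμ := hS.eigenvalue_ne_zero hc k
  set μ : ℂ := (-Complex.I) ^ (n + 2 * k) * (lam k : ℂ) with hμdef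
  obtain ⟨U, hU, huU⟩ := exists_contDiff_of_isFourierEigenfunction hα hμ hE
  have h := huU
  rw [ballFun_eq_radMul] at h
  have hUE : Set.EqOn (finiteFourier α c fun t => (U t : ℂ)) (fun x => μ * (U x : ℂ)) unitBall :=
    fun x hx => by
      rw [← finiteFourier_congr α c (u := fun t => ((ballFun (Y 0) (φ k) t : ℝ) : ℂ))
        (fun t ht => by dsimp only; rw [huU ht]), hE.2.2 x hx, huU hx]
  have hLE := finiteFourier_expandedL_eigen hα hU hUE
  have hR := expandedL_eqOn_radMul (α := α) (c := c) hn hp (hY.harmonic 0) hp0 hU h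
  by_cases h0 : ∃ x ∈ unitBall, expandedL α c U x ≠ 0
  · set g : ℝ → ℝ := fun s => radialOp α c n F ((s + 1) / 2) with hg
    have hgR : ballFun (Y 0) g = radMul (Y 0) (radialOp α c n F) := by
      rw [ballFun_eq_radMul, hg]
      congr 1
      funext q
      dsimp only
      rw [show (2 * q - 1 + 1) / 2 = q by ring]
    have hge : IsFourierEigenfunction α c μ (ballFun (Y 0) g) := by
      rw [hgR]
      refine ⟨(memLp_ballMeasure hα (ContDiff.expandedL α c hU).continuous 2).ae_eq
        ((ae_mem_unitBall α).mono fun x hx => (hR hx).symm), ?_, fun x hx => ?_⟩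
      · obtain ⟨x, hx, hx0⟩ := h0
        exact ⟨x, hx, by rwa [hR hx]⟩
      · rw [finiteFourier_congr α c (v := fun t => ((expandedL α c U t : ℝ) : ℂ))
          (fun t ht => by dsimp only; rw [hR ht]), hLE hx, hR hx]
    obtain ⟨j, a, hja⟩ := hS.exhaustive hc 0 g μ hμ hge
    obtain ⟨x, hx, hx0⟩ := hge.2.1
    have hjx := hja x hx
    have hj : (-Complex.I) ^ (n + 2 * j) * (lam j : ℂ) = μ := by
      have e1 := hge.2.2 x hx
      rw [finiteFourier_congr α c (v := fun t => (a : ℂ) * (ballFun (Y 0) (φ j) t : ℂ))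
        (fun t ht => by dsimp only; rw [hja t ht, Complex.ofReal_mul]), finiteFourier_const_mul,
        (hS.eigen hc j 0).2.2 x hx, mul_left_comm, ← Complex.ofReal_mul, ← hjx] at e1
      exact mul_right_cancel₀ (Complex.ofReal_ne_zero.2 hx0) e1
    -- Exhaustiveness only produces some index j; comparing Fourier eigenvalues at a point where the
    -- function is nonzero identifies it.
    obtain rfl : j = k := hS.distinct hc hj
    refine ⟨a, radial_eq_of_eqOn hp hp0 (H := fun q => a * F q) fun x hx => ?_⟩
    rw [← hgR, hja x (puncturedBall_subset hx), ballFun_eq_radMul, radMul, radMul, smul_eq_mul,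
      smul_eq_mul]
    ring
  -- If Lψ = 0, it is not an eigenfunction of the transform, but the radial equation holds with χ =
  -- 0.
  · push Not at h0
    refine ⟨0, radial_eq_of_eqOn hp hp0 (H := fun q => 0 * F q) fun x hx => ?_⟩
    rw [hR (puncturedBall_subset hx), h0 x (puncturedBall_subset hx), radMul, zero_mul, smul_zero]

theorem IsBallPSWFSystem.finiteFourier_divFreePSWF (hS : IsBallPSWFSystem α c n Y φ lam)
    (hα : -1 < α) (hc : 0 < c) (k : ℕ) (l : Fin (2 * n + 1)) (i : Fin 3) {x : E3}
    (hx : x ∈ unitBall) :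
    finiteFourier α c (fun t => ((divFreePSWF (Y l) (φ k) t i : ℝ) : ℂ)) x
      = (-Complex.I) ^ (n + 2 * k) * (lam k : ℂ) * ((divFreePSWF (Y l) (φ k) x i : ℝ) : ℂ) := by
  have hE := hS.eigen hc k l
  have hμ := hS.eigenvalue_ne_zero hc k
  set μ : ℂ := (-Complex.I) ^ (n + 2 * k) * (lam k : ℂ) with hμdef
  obtain ⟨U, hU, huU⟩ := exists_contDiff_of_isFourierEigenfunction hα hμ hE
  have hUE : Set.EqOn (finiteFourier α c fun t => (U t : ℂ)) (fun x => μ * (U x : ℂ)) unitBall :=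
    fun x hx => by
      rw [← finiteFourier_congr α c (u := fun t => ((ballFun (Y l) (φ k) t : ℝ) : ℂ))
        (fun t ht => by dsimp only; rw [huU ht]), hE.2.2 x hx, huU hx]
  have hV := xCrossGrad_congr isOpen_unitBall huU
  rw [finiteFourier_congr α c (v := fun t => ((xCrossGrad U t i : ℝ) : ℂ))
    (fun t ht => by dsimp only; rw [divFreePSWF, hV ht]),
    finiteFourier_xCrossGrad_eigen hα hU hUE i hx, divFreePSWF, hV hx]

end System

end BallPSWF

/-! ### The radial Sturm-Liouville problem: Wronskian, orthogonality, uniqueness -/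

namespace BallPSWF

open MeasureTheory
open MvPolynomial (pderiv X)

/-- `h` is a solution, smooth on `[0, 1]` and vanishing at the origin, of the radial equation
`d/dr (r² (1-r²)^{α+1} dh/dr) = (N + c² r⁴ - χ r²) (1-r²)^α h`. -/
structure IsRadialSolution (α c N χ : ℝ) (h : ℝ → ℝ) : Prop where
  contDiff : ContDiff ℝ ∞ h
  zero : h 0 = 0
  ode : ∀ r ∈ Set.Ioo (0 : ℝ) 1, r ^ 2 * (1 - r ^ 2) * deriv (deriv h) r
    + (2 * r - (2 * α + 4) * r ^ 3) * deriv h r = (N + c ^ 2 * r ^ 4 - χ * r ^ 2) * h r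

theorem mul_deriv_comp_smul {V : E3 → ℝ} (hV : ContDiff ℝ ∞ V) (w : E3) (r : ℝ) :
    r * deriv (fun s : ℝ => V (s • w)) r = xDotGrad V (r • w) := by
  have h1 : HasDerivAt (fun s : ℝ => s • w) w r := by
    simpa using (hasDerivAt_id r).smul_const w
  have h2 := (smooth_differentiableAt hV (r • w)).hasFDerivAt.comp_hasDerivAt r h1
  rw [show (fun s : ℝ => V (s • w)) = V ∘ fun s : ℝ => s • w from rfl, h2.deriv,
    xDotGrad_eq_fderiv, map_smul, smul_eq_mul]

theorem differentiable_deriv_of_smooth {h : ℝ → ℝ} (hh : ContDiff ℝ ∞ h) :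
    Differentiable ℝ (deriv h) :=
  ((contDiff_infty_iff_deriv.1 hh).2).differentiable (by norm_cast)

section

variable {p : MvPolynomial (Fin 3) ℝ} {n : ℕ} {α c : ℝ}

/-- Restricting the smooth extension to a ray gives a solution in r that is smooth through both
endpoints, which the factor F in the variable q is not known to be. -/
theorem isRadialSolution_of_radial (hn : 1 ≤ n) (hp : p.IsHomogeneous n)
    (hΔ : ∑ i, pderiv i (pderiv i p) = 0) (hp0 : ∃ x : E3, x ≠ 0 ∧ evalAt p x ≠ 0) {F : ℝ → ℝ}
    {U : E3 → ℝ} (hU : ContDiff ℝ ∞ U) (h : Set.EqOn (radMul p F) U unitBall) {χ : ℝ}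
    (hode : ∀ q ∈ Set.Ioo (0 : ℝ) 1, radialOp α c n F q = χ * F q) {w : E3} (hw : ‖w‖ = 1) :
    IsRadialSolution α c (n * (n + 1)) χ fun r => U (r • w) := by
  have hF : ContDiffOn ℝ 2 F (Set.Ioo 0 1) := (contDiffOn_radial hp hp0 hU h).of_le (by norm_cast)
  have hDU := ContDiff.xDotGrad hU
  have hh : ContDiff ℝ ∞ fun r : ℝ => U (r • w) := hU.comp (contDiff_id.smul contDiff_const)
  refine ⟨hh, ?_, fun r hr => ?_⟩
  · rw [zero_smul, ← h zero_mem_unitBall, radMul, evalAt_zero_point hn hp, zero_smul]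
  have hnorm : ‖r • w‖ = r := by rw [norm_smul, hw, mul_one, Real.norm_of_nonneg hr.1.le]
  have hx : r • w ∈ puncturedBall := ⟨hnorm.symm ▸ hr.1, hnorm.symm ▸ hr.2⟩
  have hx' := puncturedBall_subset hx
  have e1 := mul_deriv_comp_smul hU w r
  have e2 := mul_deriv_comp_smul hDU w r
  have e3 : (fun s : ℝ => xDotGrad U (s • w)) = fun s => s * deriv (fun r => U (r • w)) s :=
    funext fun s => (mul_deriv_comp_smul hU w s).symm
  have hd : DifferentiableAt ℝ (deriv fun r : ℝ => U (r • w)) r :=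
    differentiable_deriv_of_smooth hh r
  rw [e3, deriv_fun_mul differentiableAt_fun_id hd, deriv_id'', one_mul] at e2
  have e4 : lap0 U (r • w) = -(n * (n + 1)) * U (r • w) := by
    rw [← lap0_congr isOpen_unitBall h hx', lap0_radMul p hp hF hx, hΔ, evalAt_zero, ← h hx',
      radMul]
    simp only [smul_eq_mul]
    ring
  have e5 : xDotGrad (fun y => xDotGrad U y + U y) (r • w)
      = xDotGrad (xDotGrad U) (r • w) + xDotGrad U (r • w) := by
    rw [xDotGrad_eq_fderiv, fderiv_fun_add (smooth_differentiableAt hDU _)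
      (smooth_differentiableAt hU _), xDotGrad_eq_fderiv, xDotGrad_eq_fderiv]
    rfl
  have e6 : expandedL α c U (r • w) = χ * U (r • w) := by
    rw [← expandedL_eqOn_radMul hn hp hΔ hp0 hU h hx', radMul, hode _ (norm_sq_mem hx), ← h hx',
      radMul]
    simp only [smul_eq_mul]
    ring
  rw [lap0, e5, hnorm] at e4
  rw [expandedL, hnorm] at e6
  simp only [smul_eq_mul] at e4 e6
  set h1 := deriv (fun r : ℝ => U (r • w)) r
  set h2 := deriv (deriv fun r : ℝ => U (r • w)) r
  rw [← e1, ← e2] at e4 e6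
  -- The Laplacian is eliminated between Δ₀U = -n(n+1)U and the eigenvalue equation.
  linear_combination -e4 - r ^ 2 * e6

end

namespace IsRadialSolution

variable {α c N χ χ' : ℝ} {h k : ℝ → ℝ}

theorem differentiable (hh : IsRadialSolution α c N χ h) : Differentiable ℝ h :=
  hh.contDiff.differentiable (by norm_cast)

theorem differentiable_deriv (hh : IsRadialSolution α c N χ h) : Differentiable ℝ (deriv h) :=
  differentiable_deriv_of_smooth hh.contDiff

theorem const_mul (hh : IsRadialSolution α c N χ h) (a : ℝ) :
    IsRadialSolution α c N χ fun r => a * h r := by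
  have e1 : deriv (fun r => a * h r) = fun r => a * deriv h r :=
    funext fun r => deriv_const_mul a (hh.differentiable r)
  refine ⟨contDiff_const.mul hh.contDiff, by rw [hh.zero, mul_zero], fun r hr => ?_⟩
  rw [e1, deriv_const_mul a (hh.differentiable_deriv r)]
  linear_combination a * hh.ode r hr

theorem sub (hh : IsRadialSolution α c N χ h) (hk : IsRadialSolution α c N χ k) :
    IsRadialSolution α c N χ fun r => h r - k r := by
  have e1 : deriv (fun r => h r - k r) = fun r => deriv h r - deriv k r :=
    funext fun r => deriv_fun_sub (hh.differentiable r) (hk.differentiable r)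
  refine ⟨hh.contDiff.sub hk.contDiff, by rw [hh.zero, hk.zero, sub_zero], fun r hr => ?_⟩
  rw [e1, deriv_fun_sub (hh.differentiable_deriv r) (hk.differentiable_deriv r)]
  linear_combination hh.ode r hr - hk.ode r hr

theorem hasDerivAt_flux (hh : IsRadialSolution α c N χ h) {r : ℝ} (hr : r ∈ Set.Ioo (0 : ℝ) 1) :
    HasDerivAt (fun r => r ^ 2 * (1 - r ^ 2) ^ (α + 1) * deriv h r)
      ((1 - r ^ 2) ^ α * ((N + c ^ 2 * r ^ 4 - χ * r ^ 2) * h r)) r := by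
  have hpos : 0 < 1 - r ^ 2 := by nlinarith [hr.1, hr.2]
  have h1 : HasDerivAt (fun r : ℝ => 1 - r ^ 2) (-(2 * r)) r := by
    simpa using ((hasDerivAt_pow 2 r).const_sub 1)
  have h2 := h1.rpow_const (p := α + 1) (Or.inl hpos.ne')
  have h3 := ((hasDerivAt_pow 2 r).mul h2).mul (hh.differentiable_deriv r).hasDerivAt
  refine h3.congr_deriv ?_
  simp only [Pi.mul_apply]
  rw [← hh.ode r hr, add_sub_cancel_right, Real.rpow_add_one hpos.ne']
  push_cast
  ring

end IsRadialSolution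

theorem continuous_flux_weight {α : ℝ} (hα : -1 < α) :
    Continuous fun r : ℝ => (1 - r ^ 2) ^ (α + 1) :=
  (by fun_prop : Continuous fun r : ℝ => 1 - r ^ 2).rpow_const fun _ => Or.inr (by linarith)

namespace IsRadialSolution

variable {α c N χ χ' : ℝ} {h k : ℝ → ℝ}

theorem hasDerivAt_wronskian (hh : IsRadialSolution α c N χ h) (hk : IsRadialSolution α c N χ' k)
    {r : ℝ} (hr : r ∈ Set.Ioo (0 : ℝ) 1) :
    HasDerivAt (fun r => h r * (r ^ 2 * (1 - r ^ 2) ^ (α + 1) * deriv k r)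
        - k r * (r ^ 2 * (1 - r ^ 2) ^ (α + 1) * deriv h r))
      ((χ - χ') * ((1 - r ^ 2) ^ α * (r ^ 2 * (h r * k r)))) r := by
  have h1 := ((hh.differentiable r).hasDerivAt.mul (hk.hasDerivAt_flux hr)).sub
    ((hk.differentiable r).hasDerivAt.mul (hh.hasDerivAt_flux hr))
  refine h1.congr_deriv ?_
  ring

theorem continuous_wronskian (hα : -1 < α) (hh : IsRadialSolution α c N χ h)
    (hk : IsRadialSolution α c N χ' k) :
    Continuous (fun r => h r * (r ^ 2 * (1 - r ^ 2) ^ (α + 1) * deriv k r)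
        - k r * (r ^ 2 * (1 - r ^ 2) ^ (α + 1) * deriv h r)) := by
  have h1 := continuous_flux_weight hα
  have h2 := hh.differentiable.continuous
  have h3 := hk.differentiable.continuous
  have h4 := hh.differentiable_deriv.continuous
  have h5 := hk.differentiable_deriv.continuous
  fun_prop

/-- Lagrange's identity: the Wronskian flux vanishes at 0 through r² and at 1 through (1-r²)^{α+1},
as α + 1 > 0. -/
theorem integral_mul_eq_zero (hα : -1 < α) (hh : IsRadialSolution α c N χ h)
    (hk : IsRadialSolution α c N χ' k) (hne : χ ≠ χ') :
    ∫ r in Set.Ioo (0 : ℝ) 1, (1 - r ^ 2) ^ α * (r ^ 2 * (h r * k r)) = 0 := by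
  have hint : IntervalIntegrable (fun r => (1 - r ^ 2) ^ α * (r ^ 2 * (h r * k r))) volume 0 1 := by
    have h1 : IntervalIntegrable (fun r : ℝ => (1 - r ^ 2) ^ α) volume 0 1 := by
      rw [intervalIntegrable_iff_integrableOn_Ioo_of_le zero_le_one]
      exact integrableOn_one_sub_sq_rpow hα
    have h2 := hh.differentiable.continuous
    have h3 := hk.differentiable.continuous
    exact h1.mul_continuousOn (by fun_prop : Continuous fun r => r ^ 2 * (h r * k r)).continuousOn
  have key := intervalIntegral.integral_eq_sub_of_hasDerivAt_of_le zero_le_one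
    (continuous_wronskian hα hh hk).continuousOn (fun r hr => hasDerivAt_wronskian hh hk hr)
    (hint.const_mul _)
  have h0 : (0 : ℝ) ^ (α + 1) = 0 := Real.zero_rpow (by linarith)
  rw [intervalIntegral.integral_const_mul, intervalIntegral.integral_of_le zero_le_one,
    integral_Ioc_eq_integral_Ioo] at key
  simp only [one_pow, sub_self, h0, mul_zero, zero_mul, ne_eq, OfNat.ofNat_ne_zero,
    not_false_eq_true, zero_pow] at key
  exact (mul_eq_zero.1 key).resolve_left (sub_ne_zero.2 hne)

/-- For equal eigenvalues the Wronskian flux is constant, and it vanishes at 0. -/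
theorem wronskian_eq_zero (hα : -1 < α) (hh : IsRadialSolution α c N χ h)
    (hk : IsRadialSolution α c N χ k) {r : ℝ} (hr : r ∈ Set.Ioo (0 : ℝ) 1) :
    h r * deriv k r = k r * deriv h r := by
  have hpos : 0 < 1 - r ^ 2 := by nlinarith [hr.1, hr.2]
  have hP : 0 < r ^ 2 * (1 - r ^ 2) ^ (α + 1) :=
    mul_pos (pow_pos hr.1 2) (Real.rpow_pos_of_pos hpos _)
  obtain ⟨s, -, hs⟩ := exists_hasDerivAt_eq_slope _ _ hr.1
    (continuous_wronskian hα hh hk).continuousOn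
    fun s hs => hasDerivAt_wronskian hh hk ⟨hs.1, hs.2.trans hr.2⟩
  rw [sub_self, zero_mul, sub_zero, eq_comm, div_eq_zero_iff, or_iff_left hr.1.ne'] at hs
  refine mul_left_cancel₀ hP.ne' ?_
  simp only [ne_eq, OfNat.ofNat_ne_zero, not_false_eq_true, zero_pow, zero_mul, mul_zero,
    sub_self, sub_zero] at hs
  linear_combination hs

/-- A solution with vanishing initial data at an interior point vanishes. -/
theorem eq_zero_of_initial (hh : IsRadialSolution α c N χ h) {r₀ : ℝ}
    (hr₀ : r₀ ∈ Set.Ioo (0 : ℝ) 1) (h0 : h r₀ = 0) (h1 : deriv h r₀ = 0) :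
    ∀ r ∈ Set.Ioo (0 : ℝ) 1, h r = 0 := by
  intro r hr
  -- A compact subinterval of (0,1) around both points, on which the coefficients are bounded and
  -- the first-order system is Lipschitz.
  obtain ⟨a, ha0, ha⟩ := exists_between (lt_min hr₀.1 hr.1)
  obtain ⟨b, hb, hb1⟩ := exists_between (max_lt hr₀.2 hr.2)
  have hden {t : ℝ} (ht : t ∈ Set.Icc a b) : t ^ 2 * (1 - t ^ 2) ≠ 0 := by
    have h1 : 0 < t := ha0.trans_le ht.1
    have h2 : t < 1 := ht.2.trans_lt hb1
    have : 0 < 1 - t ^ 2 := by nlinarith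
    positivity
  set A : ℝ → ℝ := fun t => (N + c ^ 2 * t ^ 4 - χ * t ^ 2) / (t ^ 2 * (1 - t ^ 2))
  set B : ℝ → ℝ := fun t => (2 * t - (2 * α + 4) * t ^ 3) / (t ^ 2 * (1 - t ^ 2))
  obtain ⟨CA, hCA⟩ := (isCompact_Icc (a := a) (b := b)).exists_bound_of_continuousOn (f := A)
    (ContinuousOn.div (by fun_prop) (by fun_prop) fun t ht => hden ht)
  obtain ⟨CB, hCB⟩ := (isCompact_Icc (a := a) (b := b)).exists_bound_of_continuousOn (f := B)
    (ContinuousOn.div (by fun_prop) (by fun_prop) fun t ht => hden ht)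
  have hCA0 : 0 ≤ CA := (norm_nonneg _).trans
    (hCA r₀ ⟨(ha.trans_le (min_le_left _ _)).le, ((le_max_left _ _).trans_lt hb).le⟩)
  have hCB0 : 0 ≤ CB := (norm_nonneg _).trans
    (hCB r₀ ⟨(ha.trans_le (min_le_left _ _)).le, ((le_max_left _ _).trans_lt hb).le⟩)
  have hsol (t : ℝ) (ht : t ∈ Set.Ioo a b) :
      HasDerivAt (fun t => (h t, deriv h t)) (deriv h t, A t * h t - B t * deriv h t) t := by
    refine (hh.differentiable t).hasDerivAt.prodMk
      ((hh.differentiable_deriv t).hasDerivAt.congr_deriv ?_)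
    have hd := hden ⟨ht.1.le, ht.2.le⟩
    have := hh.ode t ⟨ha0.trans ht.1, ht.2.trans hb1⟩
    simp only [A, B]
    rw [div_mul_eq_mul_div, div_mul_eq_mul_div, ← sub_div, eq_div_iff hd]
    linear_combination this
  have key := ODE_solution_unique_of_mem_Icc (K := (1 + CA + CB).toNNReal)
    (v := fun t (y : ℝ × ℝ) => (y.2, A t * y.1 - B t * y.2)) (s := fun _ => Set.univ)
    (f := fun t => (h t, deriv h t)) (g := fun _ => 0) (t₀ := r₀) (a := a) (b := b)
    (fun t ht => LipschitzOnWith.of_dist_le_mul fun y _ z _ => ?_)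
    ⟨ha.trans_le (min_le_left _ _), (le_max_left _ _).trans_lt hb⟩
    (hh.differentiable.continuous.prodMk hh.differentiable_deriv.continuous).continuousOn
    hsol (fun _ _ => trivial) continuousOn_const
    (fun t _ => (hasDerivAt_const t (0 : ℝ × ℝ)).congr_deriv (by simp; rfl)) (fun _ _ => trivial)
    (by simp [h0, h1])
  · exact congrArg Prod.fst
      (key ⟨(ha.trans_le (min_le_right _ _)).le, ((le_max_right _ _).trans_lt hb).le⟩)
  · rw [Prod.dist_eq, Prod.dist_eq, Real.coe_toNNReal _ (by positivity)]
    simp only [Real.dist_eq]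
    set m := max |y.1 - z.1| |y.2 - z.2| with hm
    have hm1 : |y.1 - z.1| ≤ m := le_max_left _ _
    have hm2 : |y.2 - z.2| ≤ m := le_max_right _ _
    have hm0 : 0 ≤ m := (abs_nonneg _).trans hm1
    have hA := hCA t ⟨ht.1.le, ht.2.le⟩
    have hB := hCB t ⟨ht.1.le, ht.2.le⟩
    rw [Real.norm_eq_abs] at hA hB
    refine max_le (by nlinarith) ?_
    rw [show A t * y.1 - B t * y.2 - (A t * z.1 - B t * z.2)
      = A t * (y.1 - z.1) - B t * (y.2 - z.2) by ring]
    refine (abs_sub _ _).trans ?_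
    rw [abs_mul, abs_mul]
    have e1 := mul_le_mul hA hm1 (abs_nonneg _) hCA0
    have e2 := mul_le_mul hB hm2 (abs_nonneg _) hCB0
    nlinarith

/-- Solutions for the same eigenvalue are proportional. -/
theorem exists_eq_mul (hα : -1 < α) (hh : IsRadialSolution α c N χ h)
    (hk : IsRadialSolution α c N χ k) (hk0 : ∃ r ∈ Set.Ioo (0 : ℝ) 1, k r ≠ 0) :
    ∃ a : ℝ, ∀ r ∈ Set.Ioo (0 : ℝ) 1, h r = a * k r := by
  obtain ⟨r₀, hr₀, hkr⟩ := hk0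
  refine ⟨h r₀ / k r₀, fun r hr => sub_eq_zero.1 ?_⟩
  -- With the factor h(r₀)/k(r₀) the difference vanishes at r₀ by choice, and its derivative
  -- vanishes by the Wronskian identity.
  have hw := wronskian_eq_zero hα hh hk hr₀
  refine (hh.sub (hk.const_mul (h r₀ / k r₀))).eq_zero_of_initial hr₀ ?_ ?_ r hr
  · rw [div_mul_cancel₀ _ hkr, sub_self]
  · rw [deriv_fun_sub (hh.differentiable r₀) ((hk.const_mul _).differentiable r₀),
      deriv_const_mul _ (hk.differentiable r₀), sub_eq_zero, div_mul_eq_mul_div, eq_div_iff hkr]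
    linear_combination -hw

end IsRadialSolution

end BallPSWF

/-! ### Finiteness of the sublevel sets of the eigenvalues -/

namespace BallPSWF

open MeasureTheory Filter Topology

namespace IsRadialSolution

variable {α c N χ M : ℝ} {h : ℝ → ℝ}

/-- The flux vanishes at r = 1 and its derivative is at most C(1-s²)^α in modulus, so integrating
back from 1 bounds r²h'. The resulting bound is of order 1/r, hence the factor r³, for which it is
uniform. -/
theorem neg_le_cube_mul_deriv (hα : -1 < α) (hN : 0 ≤ N) (hh : IsRadialSolution α c N χ h)
    (hχ : |χ| ≤ M) (hb : ∀ r ∈ Set.Icc (0 : ℝ) 1, |h r| ≤ 1) {r : ℝ}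
    (hr : r ∈ Set.Ioo (0 : ℝ) 1) :
    -((N + c ^ 2 + M) / (2 * (α + 1))) ≤ r ^ 3 * deriv h r := by
  have hα1 : 0 < α + 1 := by linarith
  set C := N + c ^ 2 + M with hC
  have hM0 : 0 ≤ M := (abs_nonneg _).trans hχ
  have hC0 : 0 ≤ C := by positivity
  -- The derivative of κ(1-s²)^{α+1} is -C(s/r)(1-s²)^α, which dominates the flux derivative for s ≥
  -- r.
  set κ := C / (2 * (α + 1) * r) with hκ
  have hanti : AntitoneOn (fun s => s ^ 2 * (1 - s ^ 2) ^ (α + 1) * deriv h s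
      + κ * (1 - s ^ 2) ^ (α + 1)) (Set.Icc r 1) := by
    have hd (s : ℝ) (hs : s ∈ Set.Ioo r 1) : HasDerivAt (fun s => s ^ 2 * (1 - s ^ 2) ^ (α + 1)
        * deriv h s + κ * (1 - s ^ 2) ^ (α + 1))
        ((1 - s ^ 2) ^ α * ((N + c ^ 2 * s ^ 4 - χ * s ^ 2) * h s - C * (s / r))) s := by
      have hs0 : 0 < s := hr.1.trans hs.1
      have hpos : 0 < 1 - s ^ 2 := by nlinarith [hs.2]
      have h1 : HasDerivAt (fun r : ℝ => 1 - r ^ 2) (-(2 * s)) s := by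
        simpa using ((hasDerivAt_pow 2 s).const_sub 1)
      have h2 := (h1.rpow_const (p := α + 1) (Or.inl hpos.ne')).const_mul κ
      refine ((hh.hasDerivAt_flux ⟨hs0, hs.2⟩).add h2).congr_deriv ?_
      rw [add_sub_cancel_right, hκ]
      have := hr.1.ne'
      field_simp
      ring
    refine antitoneOn_of_hasDerivWithinAt_nonpos (convex_Icc r 1) ?_
      (fun s hs => (hd s (interior_Icc (a := r) (b := (1 : ℝ)) ▸ hs)).hasDerivWithinAt) ?_
    · have h1 := continuous_flux_weight hα
      have h4 := hh.differentiable_deriv.continuous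
      exact Continuous.continuousOn (by fun_prop)
    · intro s hs
      rw [interior_Icc] at hs
      have hs0 : 0 < s := hr.1.trans hs.1
      have hpos : 0 < 1 - s ^ 2 := by nlinarith [hs.2]
      refine mul_nonpos_of_nonneg_of_nonpos (Real.rpow_nonneg hpos.le _) (sub_nonpos.2 ?_)
      have hs2 : s ^ 2 ≤ 1 := by linarith
      have hs4 : s ^ 4 ≤ 1 := pow_le_one₀ hs0.le hs.2.le
      have hq : |N + c ^ 2 * s ^ 4 - χ * s ^ 2| ≤ C := by
        have h1 : |χ * s ^ 2| ≤ M := by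
          rw [abs_mul, abs_of_nonneg (sq_nonneg s)]
          nlinarith [abs_nonneg χ, sq_nonneg s]
        have h2 : |N + c ^ 2 * s ^ 4| ≤ N + c ^ 2 := by
          rw [abs_of_nonneg (by positivity)]
          nlinarith [sq_nonneg c]
        exact (abs_sub _ _).trans (by linarith)
      calc (N + c ^ 2 * s ^ 4 - χ * s ^ 2) * h s
          ≤ |N + c ^ 2 * s ^ 4 - χ * s ^ 2| * |h s| := by rw [← abs_mul]; exact le_abs_self _
        _ ≤ C * 1 := mul_le_mul hq (hb s ⟨hs0.le, hs.2.le⟩) (abs_nonneg _) hC0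
        _ ≤ C * (s / r) :=
          mul_le_mul_of_nonneg_left ((one_le_div hr.1).2 hs.1.le) hC0
  have key := hanti ⟨le_rfl, hr.2.le⟩ ⟨hr.2.le, le_rfl⟩ hr.2.le
  have h0 : (0 : ℝ) ^ (α + 1) = 0 := Real.zero_rpow (by linarith)
  simp only [one_pow, sub_self, h0, mul_zero, zero_mul, add_zero] at key
  have hpos : 0 < 1 - r ^ 2 := by nlinarith [hr.1, hr.2]
  have hW := Real.rpow_pos_of_pos hpos (α + 1)
  have k2 : 0 ≤ r ^ 2 * deriv h r + κ := by
    refine nonneg_of_mul_nonneg_right (b := r ^ 2 * deriv h r + κ) ?_ hW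
    linarith
  have k3 := mul_nonneg hr.1.le k2
  have k4 : r * κ = C / (2 * (α + 1)) := by
    rw [hκ]
    have := hr.1.ne'
    field_simp
  rw [← k4]
  linarith

theorem abs_cube_mul_deriv_le (hα : -1 < α) (hN : 0 ≤ N) (hh : IsRadialSolution α c N χ h)
    (hχ : |χ| ≤ M) (hb : ∀ r ∈ Set.Icc (0 : ℝ) 1, |h r| ≤ 1) {r : ℝ}
    (hr : r ∈ Set.Ioo (0 : ℝ) 1) :
    |r ^ 3 * deriv h r| ≤ (N + c ^ 2 + M) / (2 * (α + 1)) := by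
  refine abs_le.2 ⟨neg_le_cube_mul_deriv hα hN hh hχ hb hr, ?_⟩
  have := neg_le_cube_mul_deriv hα hN (hh.const_mul (-1)) hχ
    (fun r hr => by rw [abs_mul, abs_neg, abs_one, one_mul]; exact hb r hr) hr
  rw [deriv_const_mul _ (hh.differentiable r)] at this
  linarith

theorem abs_cube_mul_sub_le (hα : -1 < α) (hN : 0 ≤ N) (hh : IsRadialSolution α c N χ h)
    (hχ : |χ| ≤ M) (hb : ∀ r ∈ Set.Icc (0 : ℝ) 1, |h r| ≤ 1) {r s : ℝ}
    (hr : r ∈ Set.Icc (0 : ℝ) 1) (hs : s ∈ Set.Icc (0 : ℝ) 1) :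
    |s ^ 3 * h s - r ^ 3 * h r| ≤ (3 + (N + c ^ 2 + M) / (2 * (α + 1))) * |s - r| := by
  have hd (r : ℝ) : HasDerivAt (fun r => r ^ 3 * h r) (3 * r ^ 2 * h r + r ^ 3 * deriv h r) r := by
    simpa using (hasDerivAt_pow 3 r).fun_mul (hh.differentiable r).hasDerivAt
  have hcl : IsClosed {r : ℝ | ‖3 * r ^ 2 * h r + r ^ 3 * deriv h r‖
      ≤ 3 + (N + c ^ 2 + M) / (2 * (α + 1))} := by
    have h2 := hh.differentiable.continuous
    have h4 := hh.differentiable_deriv.continuous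
    exact isClosed_le (by fun_prop) continuous_const
  have hsub : Set.Icc (0 : ℝ) 1 ⊆ {r : ℝ | ‖3 * r ^ 2 * h r + r ^ 3 * deriv h r‖
      ≤ 3 + (N + c ^ 2 + M) / (2 * (α + 1))} := by
    rw [← closure_Ioo (zero_ne_one' ℝ)]
    refine hcl.closure_subset_iff.2 fun r hr => (norm_add_le _ _).trans (add_le_add ?_
      (abs_cube_mul_deriv_le hα hN hh hχ hb hr))
    rw [norm_mul, Real.norm_eq_abs, Real.norm_eq_abs, abs_of_nonneg (by positivity)]
    have h1 := hb r ⟨hr.1.le, hr.2.le⟩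
    have h2 : r ^ 2 ≤ 1 := pow_le_one₀ hr.1.le hr.2.le
    nlinarith [abs_nonneg (h r), sq_nonneg r]
  exact (convex_Icc (0 : ℝ) 1).norm_image_sub_le_of_norm_hasDerivWithin_le
    (fun r _ => (hd r).hasDerivWithinAt) (fun r hr => hsub hr) hr hs

/-- Maximum principle: at an interior positive maximum h' = 0 and h'' ≤ 0, so the coefficient N +
c²r⁴ - χr² cannot be positive. -/
theorem le_mul_sq_of_isMax (hh : IsRadialSolution α c N χ h) {r : ℝ}
    (hr : r ∈ Set.Ioo (0 : ℝ) 1) (hmax : ∀ s ∈ Set.Icc (0 : ℝ) 1, h s ≤ h r) (hpos : 0 < h r) :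
    N ≤ χ * r ^ 2 := by
  have hloc : IsLocalMax h r :=
    Filter.eventually_of_mem (Icc_mem_nhds hr.1 hr.2) hmax
  have h1 : deriv h r = 0 := hloc.deriv_eq_zero
  -- If h'' > 0, the point would also be a local minimum, so h would be locally constant with h'' =
  -- 0.
  have h2 : deriv (deriv h) r ≤ 0 := by
    by_contra! hlt
    have hmin := isLocalMin_of_deriv_deriv_pos hlt h1 hh.differentiable.continuous.continuousAt
    have hconst : h =ᶠ[𝓝 r] fun _ => h r := by
      filter_upwards [hloc, hmin] with s h1 h2 using le_antisymm h1 h2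
    have := hconst.deriv.deriv_eq
    simp only [deriv_const', deriv_const] at this
    exact hlt.ne' this
  have hode := hh.ode r hr
  rw [h1, mul_zero, add_zero] at hode
  have hr2 : 0 < 1 - r ^ 2 := by nlinarith [hr.1, hr.2]
  have h3 : (N + c ^ 2 * r ^ 4 - χ * r ^ 2) * h r ≤ 0 := by
    rw [← hode]
    exact mul_nonpos_of_nonneg_of_nonpos (by positivity) h2
  have h4 : N + c ^ 2 * r ^ 4 - χ * r ^ 2 ≤ 0 := by
    by_contra! h5
    exact (mul_pos h5 hpos).not_ge h3
  have : 0 ≤ c ^ 2 * r ^ 4 := by positivity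
  linarith

/-- A normalized solution attains modulus 1 where r² ≥ N/M, so multiplication by r³ cannot hide the
maximum near the origin. If it is attained at r = 1, the assumption N ≤ M suffices. -/
theorem exists_cube_mul_sq_ge (hN : 0 < N) (hNM : N ≤ M) (hh : IsRadialSolution α c N χ h)
    (hχ : χ ≤ M) (hb : ∀ r ∈ Set.Icc (0 : ℝ) 1, |h r| ≤ 1)
    (hmax : ∃ r ∈ Set.Icc (0 : ℝ) 1, |h r| = 1) :
    ∃ r ∈ Set.Icc (0 : ℝ) 1, (N / M) ^ 3 ≤ (r ^ 3 * h r) ^ 2 := by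
  have hM : 0 < M := hN.trans_le hNM
  obtain ⟨r, hr, hr1⟩ := hmax
  have key : N / M ≤ r ^ 2 := by
    rw [div_le_iff₀ hM]
    rcases eq_or_lt_of_le hr.2 with rfl | hlt
    · linarith
    have hr0 : r ≠ 0 := by
      rintro rfl
      rw [hh.zero, abs_zero] at hr1
      exact zero_ne_one hr1
    have hrI : r ∈ Set.Ioo (0 : ℝ) 1 := ⟨lt_of_le_of_ne hr.1 hr0.symm, hlt⟩
    have : N ≤ χ * r ^ 2 := by
      rcases (abs_eq zero_le_one).1 hr1 with h1 | h1
      · exact hh.le_mul_sq_of_isMax hrI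
          (fun s hs => h1 ▸ (le_abs_self _).trans (hb s hs)) (by linarith)
      · refine (hh.const_mul (-1)).le_mul_sq_of_isMax hrI (fun s hs => ?_) (by linarith)
        have := (neg_le_abs (h s)).trans (hb s hs)
        linarith
    nlinarith [sq_nonneg r]
  refine ⟨r, hr, ?_⟩
  rw [mul_pow, ← sq_abs (h r), hr1, one_pow, mul_one, ← pow_mul, pow_mul r 2 3]
  exact pow_le_pow_left₀ (by positivity) key 3

end IsRadialSolution

theorem exists_subseq_tendstoUniformly {f : ℕ → ℝ → ℝ} {Λ : ℝ} (hΛ : 0 ≤ Λ)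
    (hL : ∀ j, ∀ x ∈ Set.Icc (0 : ℝ) 1, ∀ y ∈ Set.Icc (0 : ℝ) 1, |f j x - f j y| ≤ Λ * |x - y|)
    (hb : ∀ j, ∀ x ∈ Set.Icc (0 : ℝ) 1, |f j x| ≤ 1) :
    ∃ (g : C(Set.Icc (0 : ℝ) 1, ℝ)) (e : ℕ → ℕ), StrictMono e ∧
      TendstoUniformly (fun m (x : Set.Icc (0 : ℝ) 1) => f (e m) x) g atTop := by
  have hLip (j : ℕ) : LipschitzWith Λ.toNNReal fun x : Set.Icc (0 : ℝ) 1 => f j x :=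
    LipschitzWith.of_dist_le_mul fun x y => by
      rw [Real.coe_toNNReal _ hΛ]
      exact hL j x x.2 y y.2
  set F : ℕ → BoundedContinuousFunction (Set.Icc (0 : ℝ) 1) ℝ := fun j =>
    BoundedContinuousFunction.mkOfCompact ⟨fun x => f j x, (hLip j).continuous⟩ with hF
  have hcomp : IsCompact (closure (Set.range F)) := by
    refine BoundedContinuousFunction.arzela_ascoli (Set.Icc (-1) 1) isCompact_Icc _ ?_ ?_
    · rintro _ x ⟨j, rfl⟩
      exact abs_le.1 (hb j x x.2)
    · refine (LipschitzWith.uniformEquicontinuous _ Λ.toNNReal ?_).equicontinuous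
      rintro ⟨_, j, rfl⟩
      exact hLip j
  obtain ⟨g, -, e, he, hg⟩ := hcomp.tendsto_subseq fun j => subset_closure (Set.mem_range_self j)
  exact ⟨g.toContinuousMap, e, he, BoundedContinuousFunction.tendsto_iff_tendstoUniformly.1 hg⟩

/-- Normalized solutions of the radial equation for distinct eigenvalues have unbounded
eigenvalues. -/
theorem not_bounded_eigenvalues {α c N M : ℝ} (hα : -1 < α) (hN : 0 < N) (hNM : N ≤ M)
    {χ : ℕ → ℝ} (hinj : Function.Injective χ) (hχ : ∀ j, |χ j| ≤ M) {h : ℕ → ℝ → ℝ}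
    (hh : ∀ j, IsRadialSolution α c N (χ j) (h j))
    (hb : ∀ j, ∀ r ∈ Set.Icc (0 : ℝ) 1, |h j r| ≤ 1)
    (hmax : ∀ j, ∃ r ∈ Set.Icc (0 : ℝ) 1, |h j r| = 1) : False := by
  have hα1 : 0 < α + 1 := by linarith
  have hM : 0 < M := hN.trans_le hNM
  obtain ⟨g, e, he, hg⟩ := exists_subseq_tendstoUniformly (f := fun j r => r ^ 3 * h j r)
    (Λ := 3 + (N + c ^ 2 + M) / (2 * (α + 1))) (by positivity)
    (fun j x hx y hy => (hh j).abs_cube_mul_sub_le hα hN.le (hχ j) (hb j) hy hx)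
    (fun j x hx => by
      rw [abs_mul, abs_of_nonneg (pow_nonneg hx.1 3)]
      exact mul_le_one₀ (pow_le_one₀ hx.1 hx.2) (abs_nonneg _) (hb j x hx))
  set G : ℝ → ℝ := Set.IccExtend zero_le_one g with hGdef
  have hGc : Continuous G := g.continuous.Icc_extend'
  have hGeq (x : Set.Icc (0 : ℝ) 1) : G x = g x := Set.IccExtend_val _ _ _
  set H : ℝ → ℝ := fun r => G r / r ^ 3 with hHdef
  have hlim (r : ℝ) (hr : r ∈ Set.Ioo (0 : ℝ) 1) :
      Tendsto (fun m => h (e m) r) atTop (𝓝 (H r)) := by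
    have hr3 : r ^ 3 ≠ 0 := pow_ne_zero _ hr.1.ne'
    have := (hg.tendsto_at ⟨r, hr.1.le, hr.2.le⟩).div_const (r ^ 3)
    rw [← hGeq] at this
    simpa only [mul_div_cancel_left₀ _ hr3] using this
  have hHb (r : ℝ) (hr : r ∈ Set.Ioo (0 : ℝ) 1) : |H r| ≤ 1 :=
    le_of_tendsto (hlim r hr).abs (Eventually.of_forall fun m => hb _ r ⟨hr.1.le, hr.2.le⟩)
  have hHm : Measurable H := hGc.measurable.div (measurable_id.pow_const 3)
  have hhm (j : ℕ) : Measurable (h j) := (hh j).differentiable.continuous.measurable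
  have hdom {u v : ℝ → ℝ} (hu : ∀ r ∈ Set.Ioo (0 : ℝ) 1, |u r| ≤ 1)
      (hv : ∀ r ∈ Set.Ioo (0 : ℝ) 1, |v r| ≤ 1) : ∀ᵐ r ∂(volume.restrict (Set.Ioo (0 : ℝ) 1)),
      ‖(1 - r ^ 2) ^ α * (r ^ 2 * (u r * v r))‖ ≤ (1 - r ^ 2) ^ α := by
    filter_upwards [ae_restrict_mem measurableSet_Ioo] with r hr
    have hpos : 0 < 1 - r ^ 2 := by nlinarith [hr.1, hr.2]
    rw [norm_mul, norm_mul, norm_mul, Real.norm_of_nonneg (Real.rpow_nonneg hpos.le α),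
      Real.norm_of_nonneg (sq_nonneg r)]
    refine mul_le_of_le_one_right (Real.rpow_nonneg hpos.le α) (mul_le_one₀ (by linarith)
      (by positivity) (mul_le_one₀ (hu r hr) (norm_nonneg _) (hv r hr)))
  have hconv {u : ℝ → ℝ} (hum : Measurable u) (hu : ∀ r ∈ Set.Ioo (0 : ℝ) 1, |u r| ≤ 1) :
      Tendsto (fun m => ∫ r in Set.Ioo (0 : ℝ) 1, (1 - r ^ 2) ^ α * (r ^ 2 * (u r * h (e m) r)))
        atTop (𝓝 (∫ r in Set.Ioo (0 : ℝ) 1, (1 - r ^ 2) ^ α * (r ^ 2 * (u r * H r)))) := by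
    refine tendsto_integral_of_dominated_convergence _ (fun m => ?_)
      (integrableOn_one_sub_sq_rpow hα)
      (fun m => hdom hu fun r hr => hb _ r ⟨hr.1.le, hr.2.le⟩) ?_
    · have := hhm (e m)
      exact Measurable.aestronglyMeasurable (by fun_prop)
    · filter_upwards [ae_restrict_mem measurableSet_Ioo] with r hr
      exact (((hlim r hr).const_mul _).const_mul _).const_mul _
  -- Each solution is orthogonal to all later members of the subsequence, hence to the limit.
  have hz1 (i : ℕ) :
      ∫ r in Set.Ioo (0 : ℝ) 1, (1 - r ^ 2) ^ α * (r ^ 2 * (h i r * H r)) = 0 := by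
    refine tendsto_nhds_unique (hconv (hhm i) fun r hr => hb _ r ⟨hr.1.le, hr.2.le⟩)
      (tendsto_const_nhds.congr' ?_)
    filter_upwards [eventually_gt_atTop i] with m hm
    refine ((hh i).integral_mul_eq_zero hα (hh (e m)) fun hχe => ?_).symm
    exact (hm.trans_le he.le_apply).ne (hinj hχe)
  -- Now the limit itself is the test function, so H is orthogonal to itself.
  have hz2 : ∫ r in Set.Ioo (0 : ℝ) 1, (1 - r ^ 2) ^ α * (r ^ 2 * (H r * H r)) = 0 := by
    refine tendsto_nhds_unique (hconv hHm hHb) (tendsto_const_nhds.congr fun m => ?_)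
    refine (hz1 (e m)).symm.trans ?_
    simp only [mul_comm (H _)]
  have hHc : ContinuousOn H (Set.Ioo 0 1) :=
    hGc.continuousOn.div (by fun_prop) fun r hr => pow_ne_zero _ hr.1.ne'
  have hH0 : Set.EqOn (fun r => (1 - r ^ 2) ^ α * (r ^ 2 * (H r * H r))) (fun _ => 0)
      (Set.Ioo 0 1) := by
    refine Measure.eqOn_open_of_ae_eq (μ := volume) ?_ isOpen_Ioo ?_ continuousOn_const
    · refine (setIntegral_eq_zero_iff_of_nonneg_ae ?_ ?_).1 hz2
      · filter_upwards [ae_restrict_mem measurableSet_Ioo] with r hr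
        have hpos : 0 < 1 - r ^ 2 := by nlinarith [hr.1, hr.2]
        exact mul_nonneg (Real.rpow_nonneg hpos.le α)
          (mul_nonneg (sq_nonneg r) (mul_self_nonneg _))
      · exact (integrableOn_one_sub_sq_rpow hα).mono' (Measurable.aestronglyMeasurable
          (by fun_prop)) (hdom hHb hHb)
    · refine ContinuousOn.mul (ContinuousOn.rpow_const (by fun_prop) fun r hr => Or.inl ?_)
        (by fun_prop)
      nlinarith [hr.1, hr.2]
  have hG0 : ∀ r ∈ Set.Icc (0 : ℝ) 1, G r = 0 := by
    rw [← closure_Ioo (zero_ne_one' ℝ)]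
    refine (isClosed_singleton.preimage hGc).closure_subset_iff.2 fun r hr => ?_
    have hpos : 0 < 1 - r ^ 2 := by nlinarith [hr.1, hr.2]
    have h1 := hH0 hr
    have h2 : H r = 0 := by
      simpa [(Real.rpow_pos_of_pos hpos α).ne', hr.1.ne'] using h1
    exact (div_eq_zero_iff.1 h2).resolve_right (pow_ne_zero _ hr.1.ne')
  have hδ : 0 < (N / M) ^ 3 := by positivity
  have hδ1 : (N / M) ^ 3 ≤ 1 := pow_le_one₀ (by positivity) ((div_le_one hM).2 hNM)
  -- Uniform convergence to 0 makes |r³h| < δ = (N/M)³ ≤ 1, whereas at some point its square is at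
  -- least δ.
  obtain ⟨m, hm⟩ := (Metric.tendstoUniformly_iff.1 hg _ hδ).exists
  obtain ⟨r, hr, hr2⟩ := (hh (e m)).exists_cube_mul_sq_ge hN hNM ((le_abs_self _).trans (hχ _))
    (hb _) (hmax _)
  have h1 := hm ⟨r, hr⟩
  rw [← hGeq, hG0 r hr, dist_comm, Real.dist_eq, sub_zero] at h1
  rw [← sq_abs] at hr2
  nlinarith [abs_nonneg (r ^ 3 * h (e m) r)]

/-- An injective sequence of reals with finite sublevel sets can be arranged increasingly. -/
theorem exists_perm_strictMono {χ : ℕ → ℝ} (hinj : Function.Injective χ)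
    (hfin : ∀ M, {k | χ k ≤ M}.Finite) : ∃ σ : Equiv.Perm ℕ, StrictMono fun k => χ (σ k) := by
  have hlt (k : ℕ) : {j | χ j < χ k}.Finite := (hfin (χ k)).subset fun j (hj : χ j < χ k) => hj.le
  -- The rank: the number of values strictly below χ_k. Its inverse is the required permutation.
  set ρ : ℕ → ℕ := fun k => {j | χ j < χ k}.ncard with hρ
  have hmono {i j : ℕ} (hij : χ i < χ j) : ρ i < ρ j := by
    refine Set.ncard_lt_ncard (Set.ssubset_iff_of_subset (fun k hk => hk.trans hij) |>.2
      ⟨i, hij, lt_irrefl (χ i)⟩) (hlt j)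
  have hρinj : Function.Injective ρ := fun i j hij => by
    by_contra hne
    rcases lt_or_gt_of_ne (hinj.ne hne) with h | h
    · exact (hmono h).ne hij
    · exact (hmono h).ne' hij
  -- Among the indices of rank at least m, one with the smallest χ has only indices of rank below m
  -- beneath it, and there are at most m of those.
  have hρsurj : Function.Surjective ρ := fun m => by
    set A : Set ℕ := {k | ρ k < m}
    have hA : A.Finite := (Set.finite_Iio m).preimage hρinj.injOn
    obtain ⟨i, hi⟩ := hA.infinite_compl.nonempty
    obtain ⟨k, ⟨hkA, hki⟩, hmin⟩ := Set.exists_min_image (Aᶜ ∩ {j | χ j ≤ χ i}) χ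
      ((hfin (χ i)).inter_of_right _) ⟨i, hi, le_refl (χ i)⟩
    have hkm : m ≤ ρ k := not_lt.1 hkA
    have hsub : {j | χ j < χ k} ⊆ A := fun j (hj : χ j < χ k) => by
      by_contra hjA
      exact (hmin j ⟨hjA, (hj.le.trans hki : χ j ≤ χ i)⟩).not_gt hj
    refine ⟨k, le_antisymm ?_ hkm⟩
    calc ρ k ≤ A.ncard := Set.ncard_le_ncard hsub hA
      _ = (ρ '' A).ncard := (Set.ncard_image_of_injective A hρinj).symm
      _ ≤ (Set.Iio m).ncard := Set.ncard_le_ncard (by rintro _ ⟨j, hj, rfl⟩; exact hj)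
          (Set.finite_Iio m)
      _ = m := by simp
  set σ := (Equiv.ofBijective ρ ⟨hρinj, hρsurj⟩).symm
  refine ⟨σ, fun i j hij => ?_⟩
  by_contra! hle
  have e1 (k : ℕ) : ρ (σ k) = k := (Equiv.ofBijective ρ ⟨hρinj, hρsurj⟩).apply_symm_apply k
  rcases hle.lt_or_eq with h | h
  · have := hmono h
    rw [e1, e1] at this
    exact hij.not_gt this
  · exact hij.ne (σ.injective (hinj h)).symm

theorem finite_eigenvalues_le {α c N : ℝ} (hα : -1 < α) (hN : 0 < N) {χ : ℕ → ℝ}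
    (hinj : Function.Injective χ) (hpos : ∀ j, 0 < χ j) {h : ℕ → ℝ → ℝ}
    (hh : ∀ j, IsRadialSolution α c N (χ j) (h j))
    (h0 : ∀ j, ∃ r ∈ Set.Ioo (0 : ℝ) 1, h j r ≠ 0) (M : ℝ) : {k | χ k ≤ M}.Finite := by
  by_contra hinf
  set e := Set.Infinite.natEmbedding _ hinf
  have hm (j : ℕ) : ∃ a : ℝ, (∀ r ∈ Set.Icc (0 : ℝ) 1, |a * h j r| ≤ 1) ∧
      ∃ r ∈ Set.Icc (0 : ℝ) 1, |a * h j r| = 1 := by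
    obtain ⟨r, hr, hmax⟩ := (isCompact_Icc (a := (0 : ℝ)) (b := 1)).exists_isMaxOn
      ⟨0, by simp⟩ (hh j).differentiable.continuous.abs.continuousOn
    have hpos : 0 < |h j r| := by
      obtain ⟨s, hs, hs0⟩ := h0 j
      exact (abs_pos.2 hs0).trans_le (hmax ⟨hs.1.le, hs.2.le⟩)
    refine ⟨|h j r|⁻¹, fun s hs => ?_, r, hr, ?_⟩
    · rw [abs_mul, abs_inv, abs_abs, inv_mul_le_one₀ hpos]
      exact hmax hs
    · rw [abs_mul, abs_inv, abs_abs, inv_mul_cancel₀ hpos.ne']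
  choose a ha ha1 using hm
  -- Taking max M N supplies the required bound N ≤ M.
  refine not_bounded_eigenvalues (α := α) (c := c) (M := max M N) hα hN (le_max_right _ _)
    (χ := fun j => χ (e j)) (h := fun j r => a (e j) * h (e j) r)
    (fun i j hij => e.injective (Subtype.ext (hinj hij))) (fun j => ?_)
    (fun j => (hh _).const_mul _) (fun j => ha _) (fun j => ha1 _)
  rw [abs_of_pos (hpos _)]
  exact le_max_of_le_left (e j).2

end BallPSWF

/-! ### The eigenvalue sequence for c > 0, and the Jacobi case c = 0 -/

namespace BallPSWF

open MeasureTheory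
open MvPolynomial (pderiv)

section System

variable {α c : ℝ} {n : ℕ} {Y : Fin (2 * n + 1) → MvPolynomial (Fin 3) ℝ} {φ : ℕ → ℝ → ℝ}
  {lam : ℕ → ℝ}

theorem IsBallPSWFSystem.exists_eigenvalues_of_pos (hS : IsBallPSWFSystem α c n Y φ lam)
    (hY : IsSphericalHarmonicBasis n Y) (hα : -1 < α) (hc : 0 < c) (hn : 1 ≤ n) :
    ∃ χ : ℕ → ℝ, (∀ k, 0 < χ k) ∧ (∃ σ : Equiv.Perm ℕ, StrictMono (fun k => χ (σ k))) ∧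
      ∀ (k : ℕ), ∀ q ∈ Set.Ioo (0 : ℝ) 1,
        radialOp α c n (fun q => φ k (2 * q - 1)) q = χ k * φ k (2 * q - 1) := by
  choose χ hχ using hS.exists_radial_eigenvalue hY hα hc hn
  have hp := hY.homogeneous 0
  have hp0 := hY.exists_ne_zero 0
  have hΔ := hY.harmonic 0
  have hU (k : ℕ) : ∃ U : E3 → ℝ, ContDiff ℝ ∞ U ∧
      Set.EqOn (radMul (Y 0) fun q => φ k (2 * q - 1)) U unitBall := by
    rw [← ballFun_eq_radMul]
    exact exists_contDiff_of_isFourierEigenfunction hα (hS.eigenvalue_ne_zero hc k)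
      (hS.eigen hc k 0)
  choose U hU hUe using hU
  have hF0 (k : ℕ) : ∃ q ∈ Set.Ioo (0 : ℝ) 1, φ k (2 * q - 1) ≠ 0 := by
    have := (hS.eigen hc k 0).2.1
    rw [ballFun_eq_radMul] at this
    exact exists_radial_ne_zero hn hp this
  have hpos (k : ℕ) : 0 < χ k := eigenvalue_pos hα hn hp hΔ hp0 hc (hU k) (hUe k) (hF0 k) (hχ k)
  obtain ⟨w, hw, hpw⟩ := exists_norm_eq_evalAt_ne_zero hp hp0 one_pos
  have hsol (k : ℕ) := isRadialSolution_of_radial hn hp hΔ hp0 (hU k) (hUe k) (hχ k) hw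
  have hval (k : ℕ) (r : ℝ) (hr : r ∈ Set.Ioo (0 : ℝ) 1) :
      U k (r • w) = r ^ n * evalAt (Y 0) w * φ k (2 * r ^ 2 - 1) := by
    have hnorm : ‖r • w‖ = r := by rw [norm_smul, hw, mul_one, Real.norm_of_nonneg hr.1.le]
    rw [← hUe k (mem_unitBall.2 (hnorm.trans_lt hr.2)), radMul, evalAt_smul hp, hnorm, smul_eq_mul]
  have hsol0 (k : ℕ) : ∃ r ∈ Set.Ioo (0 : ℝ) 1, U k (r • w) ≠ 0 := by
    obtain ⟨q, hq, hFq⟩ := hF0 k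
    have hsq1 : √q < 1 := by rw [Real.sqrt_lt' one_pos]; simpa using hq.2
    have hs : √q ∈ Set.Ioo (0 : ℝ) 1 := ⟨Real.sqrt_pos.2 hq.1, hsq1⟩
    refine ⟨√q, hs, ?_⟩
    rw [hval k _ hs, Real.sq_sqrt hq.1.le]
    exact mul_ne_zero (mul_ne_zero (pow_ne_zero _ hs.1.ne') hpw) hFq
  -- Equal χ makes the radial factors proportional, so the Fourier eigenvalues agree, and these
  -- determine the index.
  have hinj : Function.Injective χ := fun j k hjk => by
    obtain ⟨a, ha⟩ := (hjk ▸ hsol j).exists_eq_mul hα (hsol k) (hsol0 k)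
    have hF (r : ℝ) (hr : r ∈ Set.Ioo (0 : ℝ) 1) :
        φ j (2 * r ^ 2 - 1) = a * φ k (2 * r ^ 2 - 1) := by
      have := ha r hr
      rw [hval j r hr, hval k r hr] at this
      refine mul_left_cancel₀ (mul_ne_zero (pow_ne_zero n hr.1.ne') hpw) ?_
      linear_combination this
    have hE : Set.EqOn (ballFun (Y 0) (φ j)) (fun x => a * ballFun (Y 0) (φ k) x) unitBall :=
      fun x hx => by
        rcases eq_or_ne x 0 with rfl | h0
        · simp only [ballFun, evalAt_zero_point hn hp, mul_zero]
        · have hx' := mem_puncturedBall hx h0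
          simp only [ballFun]
          rw [hF _ ⟨hx'.1, hx'.2⟩, mul_assoc]
    obtain ⟨hmem, ⟨x, hx, hx0⟩, hFj⟩ := hS.eigen hc j 0
    refine hS.distinct hc (mul_right_cancel₀ (Complex.ofReal_ne_zero.2 hx0) ?_)
    dsimp only
    rw [← hFj x hx, finiteFourier_congr α c
      (v := fun t => (a : ℂ) * (ballFun (Y 0) (φ k) t : ℂ))
      (fun t ht => by dsimp only; rw [hE ht, Complex.ofReal_mul]), finiteFourier_const_mul,
      (hS.eigen hc k 0).2.2 x hx, hE hx, Complex.ofReal_mul]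
    ring
  have hN : (0 : ℝ) < n * (n + 1) := by
    have : (0 : ℝ) < n := by exact_mod_cast hn
    positivity
  exact ⟨χ, hpos, exists_perm_strictMono hinj fun M =>
    finite_eigenvalues_le hα hN hinj hpos hsol hsol0 M, hχ⟩

end System

/-- The coefficients of the Jacobi polynomial in powers of `(s - 1) / 2`. -/
def jacobiCoeff (a b : ℝ) (k j : ℕ) : ℝ :=
  (ascPochhammer ℝ j).eval (k + a + b + 1) * (ascPochhammer ℝ (k - j)).eval (a + j + 1)
    / ((j.factorial : ℝ) * ((k - j).factorial : ℝ))

theorem jacobiCoeff_succ (a b : ℝ) {k j : ℕ} (hj : j < k) :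
    (j + 1) * (j + a + 1) * jacobiCoeff a b k (j + 1)
      = (k - j) * (k + j + a + b + 1) * jacobiCoeff a b k j := by
  obtain ⟨m, rfl⟩ : ∃ m, k = j + 1 + m := ⟨k - (j + 1), by omega⟩
  rw [jacobiCoeff, jacobiCoeff, show j + 1 + m - (j + 1) = m by omega,
    show j + 1 + m - j = m + 1 by omega, ascPochhammer_succ_eval, ascPochhammer_succ_left,
    Polynomial.eval_mul, Polynomial.eval_X, Polynomial.eval_comp, Polynomial.eval_add,
    Polynomial.eval_X, Polynomial.eval_one, Nat.factorial_succ, Nat.factorial_succ]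
  push_cast
  have h1 : (j.factorial : ℝ) ≠ 0 := by positivity
  have h2 : (m.factorial : ℝ) ≠ 0 := by positivity
  have h3 : (j : ℝ) + 1 ≠ 0 := by positivity
  have h4 : (m : ℝ) + 1 ≠ 0 := by positivity
  rw [show a + (j + 1) + 1 = a + j + 1 + 1 by ring]
  field_simp
  ring

/-- The Jacobi polynomial in the variable `t = (s - 1) / 2`. -/
def jacobiPoly (a b : ℝ) (k : ℕ) : Polynomial ℝ :=
  ∑ j ∈ Finset.range (k + 1), Polynomial.monomial j (jacobiCoeff a b k j)

theorem eval_jacobiPoly (a b : ℝ) (k : ℕ) (s : ℝ) :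
    (jacobiPoly a b k).eval ((s - 1) / 2) = jacobiP a b k s := by
  simp only [jacobiPoly, jacobiP, Polynomial.eval_finsetSum, Polynomial.eval_monomial, jacobiCoeff]

theorem coeff_jacobiPoly (a b : ℝ) (k j : ℕ) :
    (jacobiPoly a b k).coeff j = if j ≤ k then jacobiCoeff a b k j else 0 := by
  simp [jacobiPoly, Polynomial.finsetSum_coeff, Polynomial.coeff_monomial]

open Polynomial in
-- The hypergeometric equation, read off from the two-term recurrence of the coefficients; at degree
-- k the factor k-j closes the recurrence.
theorem jacobiPoly_ode (a b : ℝ) (k : ℕ) :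
    (X ^ 2 + X) * derivative (derivative (jacobiPoly a b k))
      + (C (a + b + 2) * X + C (a + 1)) * derivative (jacobiPoly a b k)
      = C (k * (k + a + b + 1)) * jacobiPoly a b k := by
  set P := jacobiPoly a b k with hP
  have hrec (j : ℕ) : (j + 1) * (j + a + 1) * P.coeff (j + 1)
      = (k - j) * (k + j + a + b + 1) * P.coeff j := by
    rw [hP, coeff_jacobiPoly, coeff_jacobiPoly]
    rcases lt_trichotomy j k with h | rfl | h
    · rw [if_pos (by omega), if_pos h.le, jacobiCoeff_succ a b h]
    · simp
    · rw [if_neg (by omega), if_neg (by omega), mul_zero, mul_zero]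
  ext j
  rw [add_mul, add_mul]
  simp only [coeff_add, mul_assoc, coeff_C_mul]
  rcases j with _ | _ | j
  · have := hrec 0
    simp [coeff_derivative, pow_two, mul_assoc] at this ⊢
    linear_combination this
  · have := hrec 1
    simp [coeff_derivative, coeff_X_mul, pow_two, mul_assoc] at this ⊢
    linear_combination this
  · have := hrec (j + 2)
    simp only [coeff_derivative, coeff_X_mul, pow_two, mul_assoc] at this ⊢
    push_cast at this ⊢
    linear_combination this

/-- The constant coefficient (a+1)_k/k! is positive, and a nonzero polynomial has finitely many
roots. -/
theorem exists_eval_jacobiPoly_ne_zero {a : ℝ} (ha : -1 < a) (b : ℝ) (k : ℕ) :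
    ∃ q ∈ Set.Ioo (0 : ℝ) 1, (jacobiPoly a b k).eval (q - 1) ≠ 0 := by
  by_contra! h
  have h0 : jacobiPoly a b k = 0 := by
    refine Polynomial.eq_zero_of_infinite_isRoot _
      ((Set.Ioo_infinite (show (-1 : ℝ) < 0 by norm_num)).mono fun t ht => ?_)
    have := h (t + 1) ⟨by linarith [ht.1], by linarith [ht.2]⟩
    rwa [add_sub_cancel_right] at this
  have h1 := coeff_jacobiPoly a b k 0
  rw [h0, Polynomial.coeff_zero, if_pos (Nat.zero_le _), jacobiCoeff, ascPochhammer_zero,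
    Polynomial.eval_one, one_mul, Nat.sub_zero, Nat.cast_zero, add_zero] at h1
  have h2 := ascPochhammer_pos k (a + 1) (by linarith)
  exact (div_pos h2 (by positivity)).ne h1

theorem radialOp_congr (α c : ℝ) (n : ℕ) {F H : ℝ → ℝ} (h : Set.EqOn F H (Set.Ioo 0 1)) :
    Set.EqOn (radialOp α c n F) (radialOp α c n H) (Set.Ioo 0 1) := fun q hq => by
  have he : F =ᶠ[nhds q] H := Filter.eventuallyEq_of_mem (isOpen_Ioo.mem_nhds hq) h
  rw [radialOp, radialOp, h hq, he.deriv_eq, he.deriv.deriv_eq]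

/-- For c = 0 the radial equation is four times the Jacobi equation in t = q-1, and n(n+2α+3) +
4k(k+α+n+3/2) factors as shown. -/
theorem radialOp_jacobiPoly (α a : ℝ) (n k : ℕ) (q : ℝ) :
    radialOp α 0 n (fun q => a * (jacobiPoly α (n + 1 / 2) k).eval (q - 1)) q
      = (n + 2 * k) * (n + 2 * k + 2 * α + 3)
        * (a * (jacobiPoly α (n + 1 / 2) k).eval (q - 1)) := by
  have hd (P : Polynomial ℝ) : deriv (fun q => a * P.eval (q - 1))
      = fun q => a * P.derivative.eval (q - 1) := by
    funext q
    have h1 := (P.hasDerivAt (q - 1)).comp_sub_const q 1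
    exact (h1.const_mul a).deriv
  have hode := congrArg (Polynomial.eval (q - 1)) (jacobiPoly_ode α (n + 1 / 2) k)
  simp only [Polynomial.eval_add, Polynomial.eval_mul, Polynomial.eval_pow, Polynomial.eval_X,
    Polynomial.eval_C] at hode
  rw [radialOp, hd, hd]
  linear_combination 4 * a * hode

section Assembly

variable {α c : ℝ} {n : ℕ} {Y : Fin (2 * n + 1) → MvPolynomial (Fin 3) ℝ} {φ : ℕ → ℝ → ℝ}
  {lam : ℕ → ℝ}

theorem IsBallPSWFSystem.exists_contDiff (hS : IsBallPSWFSystem α c n Y φ lam) (hα : -1 < α)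
    (hc : 0 ≤ c) (k : ℕ) (l : Fin (2 * n + 1)) :
    ∃ U : E3 → ℝ, ContDiff ℝ ∞ U ∧ Set.EqOn (ballFun (Y l) (φ k)) U unitBall := by
  rcases hc.eq_or_lt with h0 | hc
  · obtain ⟨a, -, ha⟩ := hS.jacobi h0.symm k
    refine ⟨fun x => a * (jacobiPoly α (n + 1 / 2) k).eval (‖x‖ ^ 2 - 1) * evalAt (Y l) x,
      (contDiff_const.mul ((by
        simpa using Polynomial.contDiff_aeval (𝕜 := ℝ) (jacobiPoly α (n + 1 / 2) k) ∞ :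
          ContDiff ℝ ∞ fun t => (jacobiPoly α (n + 1 / 2) k).eval t).comp
        ((contDiff_norm_sq ℝ).sub contDiff_const))).mul (contDiff_evalAt _), fun x hx => ?_⟩
    have h1 := one_sub_norm_sq_pos hx
    have h2 := sq_nonneg ‖x‖
    rw [ballFun, ha _ ⟨by linarith, by linarith⟩, ← eval_jacobiPoly]
    ring_nf
  · exact exists_contDiff_of_isFourierEigenfunction hα (hS.eigenvalue_ne_zero hc k)
      (hS.eigen hc k l)

theorem IsBallPSWFSystem.jacobi_eqOn (hS : IsBallPSWFSystem α c n Y φ lam) (h0 : c = 0) (k : ℕ) :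
    ∃ a : ℝ, a ≠ 0 ∧ Set.EqOn (fun q => φ k (2 * q - 1))
      (fun q => a * (jacobiPoly α (n + 1 / 2) k).eval (q - 1)) (Set.Ioo 0 1) := by
  obtain ⟨a, ha0, ha⟩ := hS.jacobi h0 k
  refine ⟨a, ha0, fun q hq => ?_⟩
  dsimp only
  rw [ha _ ⟨by linarith [hq.1], by linarith [hq.2]⟩, ← eval_jacobiPoly,
    show (2 * q - 1 - 1) / 2 = q - 1 by ring]

theorem IsBallPSWFSystem.exists_radial_ne_zero (hS : IsBallPSWFSystem α c n Y φ lam)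
    (hY : IsSphericalHarmonicBasis n Y) (hα : -1 < α) (hc : 0 ≤ c) (hn : 1 ≤ n) (k : ℕ) :
    ∃ q ∈ Set.Ioo (0 : ℝ) 1, φ k (2 * q - 1) ≠ 0 := by
  rcases hc.eq_or_lt with h0 | hc
  · obtain ⟨a, ha0, ha⟩ := hS.jacobi_eqOn h0.symm k
    obtain ⟨q, hq, hne⟩ := exists_eval_jacobiPoly_ne_zero hα (n + 1 / 2) k
    refine ⟨q, hq, ?_⟩
    have := ha hq
    dsimp only at this
    rw [this]
    exact mul_ne_zero ha0 hne
  · have := (hS.eigen hc k 0).2.1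
    rw [ballFun_eq_radMul] at this
    exact BallPSWF.exists_radial_ne_zero hn (hY.homogeneous 0) this

theorem IsBallPSWFSystem.exists_eigenvalues (hS : IsBallPSWFSystem α c n Y φ lam)
    (hY : IsSphericalHarmonicBasis n Y) (hα : -1 < α) (hc : 0 ≤ c) (hn : 1 ≤ n) :
    ∃ χ : ℕ → ℝ, (∀ k, 0 < χ k) ∧ (∃ σ : Equiv.Perm ℕ, StrictMono (fun k => χ (σ k))) ∧
      ∀ (k : ℕ), ∀ q ∈ Set.Ioo (0 : ℝ) 1,
        radialOp α c n (fun q => φ k (2 * q - 1)) q = χ k * φ k (2 * q - 1) := by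
  rcases hc.eq_or_lt with rfl | hc
  · have hn1 : (1 : ℝ) ≤ n := by exact_mod_cast hn
    refine ⟨fun k => (n + 2 * k) * (n + 2 * k + 2 * α + 3), fun k => ?_,
      ⟨Equiv.refl ℕ, fun i j hij => ?_⟩, fun k q hq => ?_⟩
    · have : (0 : ℝ) ≤ k := k.cast_nonneg
      exact mul_pos (by linarith) (by linarith)
    · have h1 : (i : ℝ) < j := by exact_mod_cast hij
      have h2 : (0 : ℝ) ≤ i := i.cast_nonneg
      exact mul_lt_mul'' (by simpa using h1) (by simpa using h1)
        (by simp only [Equiv.refl_apply]; linarith) (by simp only [Equiv.refl_apply]; linarith)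
    · obtain ⟨a, -, ha⟩ := hS.jacobi_eqOn rfl k
      have := ha hq
      dsimp only at this
      rw [radialOp_congr α 0 n ha hq, radialOp_jacobiPoly, this]
  · exact hS.exists_eigenvalues_of_pos hY hα hc hn

end Assembly

end BallPSWF

end

/-! ### The theorem -/

theorem theorem4p5 (α c : ℝ) (hα : -1 < α) (hc : 0 ≤ c) (n : ℕ) (hn : 1 ≤ n)
    (Y : Fin (2 * n + 1) → MvPolynomial (Fin 3) ℝ)
    (hY : BallPSWF.IsSphericalHarmonicBasis n Y) :
    (∀ (φ : ℕ → ℝ → ℝ) (lam : ℕ → ℝ), BallPSWF.IsBallPSWFSystem α c n Y φ lam →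
      ∃ χ : ℕ → ℝ,
        (∀ k, 0 < χ k) ∧
        (∃ σ : Equiv.Perm ℕ, StrictMono (fun k => χ (σ k))) ∧
        ∀ (k : ℕ) (l : Fin (2 * n + 1)),
          BallPSWF.IsEigenfunctionOnBall (BallPSWF.opL α c) (χ k)
            (BallPSWF.ballFun (Y l) (φ k)) ∧
          (∀ x ∈ BallPSWF.unitBall,
            BallPSWF.divergence (BallPSWF.divFreePSWF (Y l) (φ k)) x = 0) ∧
          (0 < c → ∀ i, ∀ x ∈ BallPSWF.unitBall,
            BallPSWF.finiteFourier α c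
                (fun t => ((BallPSWF.divFreePSWF (Y l) (φ k) t i : ℝ) : ℂ)) x
              = (-Complex.I) ^ (n + 2 * k) * (lam k : ℂ)
                * ((BallPSWF.divFreePSWF (Y l) (φ k) x i : ℝ) : ℂ)) ∧
          BallPSWF.IsEigenfunctionOnBall (BallPSWF.opD α c) (χ k + 2 * α + 2)
            (BallPSWF.divFreePSWF (Y l) (φ k))) ∧
    (0 < c → ∀ (l : Fin (2 * n + 1)) (θ : ℝ → ℂ), ContDiffOn ℝ 3 θ (Set.Ioo 0 1) →
      ¬ ∃ ν : ℂ,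
        (∃ x : BallPSWF.E3, 0 < ‖x‖ ∧ ‖x‖ < 1 ∧ BallPSWF.poloidalField (Y l) θ x ≠ 0) ∧
        ∀ x : BallPSWF.E3, 0 < ‖x‖ → ‖x‖ < 1 →
          BallPSWF.opD α c (BallPSWF.poloidalField (Y l) θ) x
            = ν • BallPSWF.poloidalField (Y l) θ x) := by
  refine ⟨fun φ lam hS => ?_, fun hc' l θ hθ => ?_⟩
  · obtain ⟨χ, hpos, hσ, hode⟩ := hS.exists_eigenvalues hY hα hc hn
    refine ⟨χ, hpos, hσ, fun k l => ?_⟩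
    obtain ⟨U, hU, hUe⟩ := hS.exists_contDiff hα hc k l
    rw [BallPSWF.ballFun_eq_radMul] at hUe
    obtain ⟨h1, h2, h3⟩ := BallPSWF.isEigenfunction_of_radial α c (χ k) hn (hY.homogeneous l)
      (hY.harmonic l) (hY.exists_ne_zero l) hU hUe (hS.exists_radial_ne_zero hY hα hc hn k)
      (hode k)
    rw [← BallPSWF.ballFun_eq_radMul] at h1 h2 h3
    exact ⟨h1, h2, fun hc' i x hx => hS.finiteFourier_divFreePSWF hα hc' k l i hx, h3⟩
  · rintro ⟨ν, ⟨x, hx0, hx1, hx⟩, h⟩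
    exact hx (BallPSWF.poloidalField_eq_zero hα hc' hn (hY.homogeneous l) (hY.harmonic l)
      (hY.exists_ne_zero l) hθ (fun x hx => h x hx.1 hx.2) x ⟨hx0, hx1⟩)
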